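/- Work on a randomized real random access machine: finite programs (sequencing, conditionals, while-loops) with natural-number registers, arrays of natural numbers and arrays of real numbers that are addressed through registers, integer constants, addition and truncated subtraction of natural numbers, exact $+,-,\times,/$ on real numbers, order comparisons of naturals and of reals, and independent fair coin tosses; each executed instruction and each test costs one step. For $A\in\mathbb{R}^{n\times d}$ with $d\ge 1$ and $\operatorname{rank}(A)=d$, and for $b\in\mathbb{R}^n$, let $\mathcal{Z}=\min_{x\in\mathbb{R}^d}\|Ax-b\|_2$, let $x_{opt}=A^{\dagger}b$ be the minimizer of smallest Euclidean norm, let $\kappa(A)=\sigma_{\max}(A)/\sigma_{\min}(A)$ be the condition number of $A$, and let $\gamma=\|U_AU_A^Tb\|_2/\|b\|_2$, where the columns of $U_A$ are an orthonormal basis of the column space of $A$ (if $b=0$, put $\gamma=0$). There is a single program that, given any $n$, $d\ge 1$, $A\in\mathbb{R}^{n\times d}$ of rank $d$, $b\in\mathbb{R}^n$ and $\epsilon\in(0,1)$, halts for all outcomes of its coin tosses and returns a vector $\tilde{x}_{opt}\in\mathbb{R}^d$ such that, with probability at least $0.8$, the following two claims hold simultaneously: first, $$\|A\tilde{x}_{opt}-b\|_2\le(1+\epsilon)\mathcal{Z};$$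 and second, if $\gamma>0$, then $$\|x_{opt}-\tilde{x}_{opt}\|_2\le\sqrt{\epsilon}\left(\kappa(A)\sqrt{\gamma^{-2}-1}\right)\|x_{opt}\|_2.$$ Moreover, for all constants $\epsilon\in(0,1)$ and $c>0$ there is a constant $C$, depending only on $\epsilon$ and $c$, such that for all $n$ and $d\ge 2$ with $c\,d^2\le n\le e^d$ and all $A\in\mathbb{R}^{n\times d}$ of rank $d$ and $b\in\mathbb{R}^n$, the program with input $(A,b,\epsilon)$ halts after at most $C\,n\,d\ln d$ steps, whatever the outcomes of its coin tosses. -/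

import Mathlib

open MeasureTheory

noncomputable section

/-! ## Least squares -/

namespace LeastSquares

variable {n d : ℕ}

/-- The optimal value `Z = min_x ‖A x - b‖₂`. -/
def optValue (A : Matrix (Fin n) (Fin d) ℝ) (b : EuclideanSpace ℝ (Fin n)) : ℝ :=
  ⨅ x : EuclideanSpace ℝ (Fin d), ‖A.toEuclideanLin x - b‖

/-- `x` minimizes `‖A x - b‖₂`. -/
def IsMinimizer (A : Matrix (Fin n) (Fin d) ℝ) (b : EuclideanSpace ℝ (Fin n))
    (x : EuclideanSpace ℝ (Fin d)) : Prop :=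
  ∀ y : EuclideanSpace ℝ (Fin d), ‖A.toEuclideanLin x - b‖ ≤ ‖A.toEuclideanLin y - b‖

/-- `x` is the minimizer of `‖A x - b‖₂` of minimum Euclidean norm, that is `x = A† b`. -/
def IsMinNormSolution (A : Matrix (Fin n) (Fin d) ℝ) (b : EuclideanSpace ℝ (Fin n))
    (x : EuclideanSpace ℝ (Fin d)) : Prop :=
  IsMinimizer A b x ∧ ∀ y, IsMinimizer A b y → ‖x‖ ≤ ‖y‖

/-- The condition number: the largest singular value over the smallest nonzero one
(singular values are indexed from zero, in decreasing order). -/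
def condNumber (A : Matrix (Fin n) (Fin d) ℝ) : ℝ :=
  A.toEuclideanLin.singularValues 0 / A.toEuclideanLin.singularValues (A.rank - 1)

/-- The fraction of the norm of `b` that lies in the column space of `A`; the projection of `b` to
that space is `U Uᵀ b` for every matrix `U` whose columns are an orthonormal basis of it. -/
def colSpaceFraction (A : Matrix (Fin n) (Fin d) ℝ) (b : EuclideanSpace ℝ (Fin n)) : ℝ :=
  ‖(LinearMap.range A.toEuclideanLin).starProjection b‖ / ‖b‖

end LeastSquares

/-! ## Randomized real random access machine

Programs work on natural number registers, on arrays of natural numbers and on arrays of real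
numbers (an array is addressed indirectly, by the content of a register), and may toss fair coins.
Real arithmetic is exact. Every executed instruction and every evaluated test costs one unit.
There is neither a multiplication of natural numbers nor a conversion of reals to natural numbers,
and the only constants are integers written in the program. -/

namespace RealRAM

/-- The array cell whose index is the content of the register `idx`, in the array named `arr`. -/
structure Cell where
  arr : ℕ
  idx : ℕ

/-- The arithmetic operations on real numbers. -/
inductive FieldOp
  | add | sub | mul | div

/-- Division by zero gives zero; a program can test its divisors. -/
def FieldOp.eval : FieldOp → ℝ → ℝ → ℝ
  | .add, x, y => x + y
  | .sub, x, y => x - y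
  | .mul, x, y => x * y
  | .div, x, y => x / y

/-- Instructions. The target is the first argument. -/
inductive Instr
  | natConst (r k : ℕ)
  | natAdd (r p q : ℕ)
  | natSub (r p q : ℕ)
  | natLoad (r : ℕ) (x : Cell)
  | natStore (x : Cell) (r : ℕ)
  | coin (r : ℕ)
  | realConst (x : Cell) (k : ℤ)
  | realCopy (x y : Cell)
  | realOp (o : FieldOp) (x y z : Cell)

/-- Tests: comparison of two registers, or of two cells of real arrays. -/
inductive Test
  | natLt (p q : ℕ)
  | realLt (x y : Cell)

/-- Programs; `loop c P` repeats `P` as long as the test `c` succeeds. -/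
inductive Prog
  | skip
  | instr (i : Instr)
  | seq (P Q : Prog)
  | ite (c : Test) (P Q : Prog)
  | loop (c : Test) (P : Prog)

/-- Memory content, and the number of coins tossed so far. -/
structure State where
  reg : ℕ → ℕ
  nats : ℕ → ℕ → ℕ
  reals : ℕ → ℕ → ℝ
  coins : ℕ

namespace State

def setReg (s : State) (r v : ℕ) : State :=
  { s with reg := Function.update s.reg r v }

def getNat (s : State) (x : Cell) : ℕ := s.nats x.arr (s.reg x.idx)

def setNat (s : State) (x : Cell) (v : ℕ) : State :=
  { s with
    nats := Function.update s.nats x.arr <| Function.update (s.nats x.arr) (s.reg x.idx) v }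

def getReal (s : State) (x : Cell) : ℝ := s.reals x.arr (s.reg x.idx)

def setReal (s : State) (x : Cell) (v : ℝ) : State :=
  { s with
    reals := Function.update s.reals x.arr <| Function.update (s.reals x.arr) (s.reg x.idx) v }

end State

/-- The effect of one instruction, when the coin tosses come out as `ω 0, ω 1, ω 2, …`.
`natSub` is truncated subtraction. -/
def Instr.eval (ω : ℕ → Bool) : Instr → State → State
  | .natConst r k, s => s.setReg r k
  | .natAdd r p q, s => s.setReg r (s.reg p + s.reg q)
  | .natSub r p q, s => s.setReg r (s.reg p - s.reg q)
  | .natLoad r x, s => s.setReg r (s.getNat x)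
  | .natStore x r, s => s.setNat x (s.reg r)
  | .coin r, s => { s.setReg r (ω s.coins).toNat with coins := s.coins + 1 }
  | .realConst x k, s => s.setReal x (k : ℝ)
  | .realCopy x y, s => s.setReal x (s.getReal y)
  | .realOp o x y z, s => s.setReal x (o.eval (s.getReal y) (s.getReal z))

def Test.Holds : Test → State → Prop
  | .natLt p q, s => s.reg p < s.reg q
  | .realLt x y, s => s.getReal x < s.getReal y

/-- `Exec ω P s s' t`: with coin tosses `ω`, the program `P` started in `s` halts in `s'` after
exactly `t` steps. -/
inductive Exec (ω : ℕ → Bool) : Prog → State → State → ℕ → Prop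
  | skip (s : State) : Exec ω .skip s s 1
  | instr (i : Instr) (s : State) : Exec ω (.instr i) s (i.eval ω s) 1
  | seq {P Q : Prog} {s₁ s₂ s₃ : State} {t₁ t₂ : ℕ} :
      Exec ω P s₁ s₂ t₁ → Exec ω Q s₂ s₃ t₂ → Exec ω (.seq P Q) s₁ s₃ (t₁ + t₂)
  | iteTrue {c : Test} {P Q : Prog} {s s' : State} {t : ℕ} :
      c.Holds s → Exec ω P s s' t → Exec ω (.ite c P Q) s s' (t + 1)
  | iteFalse {c : Test} {P Q : Prog} {s s' : State} {t : ℕ} :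
      ¬ c.Holds s → Exec ω Q s s' t → Exec ω (.ite c P Q) s s' (t + 1)
  | loopTrue {c : Test} {P : Prog} {s₁ s₂ s₃ : State} {t₁ t₂ : ℕ} :
      c.Holds s₁ → Exec ω P s₁ s₂ t₁ → Exec ω (.loop c P) s₂ s₃ t₂ →
      Exec ω (.loop c P) s₁ s₃ (t₁ + t₂ + 1)
  | loopFalse {c : Test} {P : Prog} {s : State} :
      ¬ c.Holds s → Exec ω (.loop c P) s s 1

/-- The final state and the number of steps are determined by the coin tosses. -/
theorem Exec.unique {ω : ℕ → Bool} {P : Prog} {s s₁ s₂ : State} {t₁ t₂ : ℕ}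
    (h₁ : Exec ω P s s₁ t₁) (h₂ : Exec ω P s s₂ t₂) : s₁ = s₂ ∧ t₁ = t₂ := by
  induction h₁ generalizing s₂ t₂ with
  | skip s => cases h₂; exact ⟨rfl, rfl⟩
  | instr i s => cases h₂; exact ⟨rfl, rfl⟩
  | seq _ _ ih₁ ih₂ =>
    cases h₂ with
    | seq a b =>
      obtain ⟨rfl, rfl⟩ := ih₁ a
      obtain ⟨rfl, rfl⟩ := ih₂ b
      exact ⟨rfl, rfl⟩
  | iteTrue hc _ ih =>
    cases h₂ with
    | iteTrue _ a => obtain ⟨rfl, rfl⟩ := ih a; exact ⟨rfl, rfl⟩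
    | iteFalse hn _ => exact absurd hc hn
  | iteFalse hn _ ih =>
    cases h₂ with
    | iteTrue hc _ => exact absurd hc hn
    | iteFalse _ a => obtain ⟨rfl, rfl⟩ := ih a; exact ⟨rfl, rfl⟩
  | loopTrue hc _ _ ih₁ ih₂ =>
    cases h₂ with
    | loopTrue _ a b =>
      obtain ⟨rfl, rfl⟩ := ih₁ a
      obtain ⟨rfl, rfl⟩ := ih₂ b
      exact ⟨rfl, rfl⟩
    | loopFalse hn => exact absurd hc hn
  | loopFalse hn =>
    cases h₂ with
    | loopTrue hc _ _ => exact absurd hc hn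
    | loopFalse _ => exact ⟨rfl, rfl⟩

/-- The initial memory: registers `0`, `1` hold `n`, `d`; the real arrays `0`, `1`, `2` hold the
matrix `A` row by row, the vector `b`, and the number `ε`; everything else is zero. -/
def input {n d : ℕ} (A : Matrix (Fin n) (Fin d) ℝ) (b : EuclideanSpace ℝ (Fin n)) (ε : ℝ) :
    State where
  reg := fun r => if r = 0 then n else if r = 1 then d else 0
  nats := fun _ _ => 0
  reals := fun a k =>
    if a = 0 then
      if h : k < n * d then A (Fin.divNat ⟨k, h⟩) (Fin.modNat ⟨k, h⟩) else 0
    else if a = 1 then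
      if h : k < n then b ⟨k, h⟩ else 0
    else if a = 2 then
      if k = 0 then ε else 0
    else 0
  coins := 0

/-- The output vector, in the first `d` cells of the real array `3`. -/
def output (d : ℕ) (s : State) : EuclideanSpace ℝ (Fin d) :=
  WithLp.toLp 2 fun j => s.reals 3 j

/-- On input `(A, b, ε)` and with coin tosses `ω`, the program `P` returns `x` after exactly `t`
steps. -/
def Returns {n d : ℕ} (P : Prog) (ω : ℕ → Bool) (A : Matrix (Fin n) (Fin d) ℝ)
    (b : EuclideanSpace ℝ (Fin n)) (ε : ℝ) (x : EuclideanSpace ℝ (Fin d)) (t : ℕ) : Prop :=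
  ∃ s : State, Exec ω P (input A b ε) s t ∧ output d s = x

/-- The law of an infinite sequence of independent fair coin tosses. -/
def coinMeasure : Measure (ℕ → Bool) :=
  Measure.infinitePi fun _ => (PMF.uniformOfFintype Bool).toMeasure

end RealRAM

end

/-! ## Rademacher series of symmetric matrices -/

/-! The program pads `[A | b]` with zero rows to a multiple of `B = 2 ^ logBlock d`, where `d² ≤ B ≤
2d²`. It multiplies every row by a random sign, applies a Walsh–Hadamard transform to each block of
`B` rows separately, and then repeatedly keeps one random row of each pair of neighbours. The small
problem is solved through its normal equations.

Accuracy needs only one property. If the rescaled sketch preserves squared norms on the span of the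
columns of `A` and `b` up to a factor `1 ± √ε/2`, then the sketched solution `y` and the true
solution `x` satisfy `‖A(y - x)‖ ≤ √ε Z` (`norm_toEuclideanLin_sub_le`). This error is orthogonal to
the residual, so Pythagoras gives the first claim, and the extreme singular values of `A` give the
second (`sketched_solution_accurate`).

The embedding property is `le_measure_energy_close`. After mixing, each row of an orthonormal basis
of the span is a Rademacher sum of vectors. Linearizing `exp ‖·‖²` by a Gaussian shows that with
high probability all these rows have squared length at most `L = O(d + log N)`, against a
normalization by `B` (`count_mix_bad_le`). A halving round changes the quadratic form by a matrix
Rademacher series `∑ ±ρ(uuᵀ - vvᵀ)`, whose variance is small because the rows are short. Its tail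
follows from trace moments (`sum_trace_pow_le`), proved by flipping one sign at a time. The variance
doubles from round to round, so geometric thresholds make the distortions summable and the failure
probabilities as well.

Only finitely many coins matter, so probabilities are counts of bit strings. Conditioning on earlier
rounds is replaced by an indicator that is invariant under flips of the later coins.

For the running time, blocks of length `O(d²)` keep the transform at `O(n d log d)` even if `log n`
is of order `d`. With `log n ≤ d`, the halving leaves `O(n log d / d)` rows for fixed `ε`, so the
Gram matrix also costs `O(n d log d)`. Elimination costs `O(d³)`, which `c d² ≤ n` absorbs. Programs
are verified by timed triples (`Spec`) with automatic framing (`Exec.frame`). -/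

namespace Matrix

variable {m : Type*} [Fintype m] [DecidableEq m]

theorem exists_orthogonal_diagonalization {X : Matrix m m ℝ} (hX : Xᵀ = X) :
    ∃ (P : Matrix m m ℝ) (D : m → ℝ), Pᵀ * P = 1 ∧ P * Pᵀ = 1 ∧
      ∀ k : ℕ, X ^ k = P * diagonal (fun i => D i ^ k) * Pᵀ := by
  have hH : X.IsHermitian := by rw [IsHermitian, conjTranspose_eq_transpose_of_trivial, hX]
  obtain ⟨P, hPd⟩ : ∃ P : Matrix m m ℝ, P = hH.eigenvectorUnitary.1 := ⟨_, rfl⟩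
  have hP : Pᵀ * P = 1 := by
    have := Unitary.coe_star_mul_self hH.eigenvectorUnitary
    rw [star_eq_conjTranspose, conjTranspose_eq_transpose_of_trivial] at this
    rw [hPd]; exact this
  have h1 : X = P * diagonal hH.eigenvalues * Pᵀ := by
    have := hH.spectral_theorem
    rw [Unitary.conjStarAlgAut_apply, star_eq_conjTranspose,
      conjTranspose_eq_transpose_of_trivial] at this
    rw [hPd]; exact this
  obtain ⟨D, hD⟩ : ∃ D, D = hH.eigenvalues := ⟨_, rfl⟩
  rw [← hD] at h1
  refine ⟨P, D, hP, mul_eq_one_comm.mp hP, fun k => ?_⟩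
  induction k with
  | zero => simp [mul_eq_one_comm.mp hP]
  | succ k ih =>
    rw [pow_succ, ih]
    conv_lhs => rw [h1]
    calc P * diagonal (fun i => D i ^ k) * Pᵀ * (P * diagonal D * Pᵀ)
        = P * diagonal (fun i => D i ^ k) * (Pᵀ * P) *
            diagonal D * Pᵀ := by simp only [Matrix.mul_assoc]
      _ = _ := by
        rw [hP, Matrix.mul_one, Matrix.mul_assoc P, diagonal_mul_diagonal]
        simp only [pow_succ]

theorem trace_mul_diagonal_mul_transpose_mul_diagonal (M : Matrix m m ℝ) (x y : m → ℝ) :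
    trace (Mᵀ * diagonal x * M * diagonal y) = ∑ i, ∑ j, x i * y j * M i j ^ 2 := by
  simp only [trace, diag_apply, mul_diagonal, mul_apply (M := Mᵀ * diagonal x), transpose_apply,
    Finset.sum_mul]
  rw [Finset.sum_comm]
  exact Finset.sum_congr rfl fun i _ => Finset.sum_congr rfl fun j _ => by ring

/-- In eigenbases of `X` and `Y` the mixed trace is a combination of the numbers `Dᵢ^q Eⱼ^s` with
nonnegative weights `(PᵀAQ)ᵢⱼ²`. Hence the scalar bound `|a|^q |b|^s ≤ a^n + b^n` for even `n`
suffices; the sharper weighted Young inequality is not needed. -/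
theorem trace_mul_pow_mul_mul_pow_le {A X Y : Matrix m m ℝ} (hA : Aᵀ = A) (hX : Xᵀ = X)
    (hY : Yᵀ = Y) {q s n : ℕ} (hn : Even n) (hqs : q + s = n) :
    trace (A * X ^ q * A * Y ^ s) ≤ trace (A * A * X ^ n) + trace (A * A * Y ^ n) := by
  obtain ⟨P, D, hP, hP', hXk⟩ := exists_orthogonal_diagonalization hX
  obtain ⟨Q, E, hQ, hQ', hYk⟩ := exists_orthogonal_diagonalization hY
  have key : ∀ a b : ℕ, trace (A * X ^ a * A * Y ^ b) =
      ∑ i, ∑ j, D i ^ a * E j ^ b * (Pᵀ * A * Q) i j ^ 2 := by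
    intro a b
    rw [← trace_mul_diagonal_mul_transpose_mul_diagonal, hXk, hYk]
    simp only [transpose_mul, transpose_transpose, hA]
    rw [← Matrix.mul_assoc _ _ Qᵀ, trace_mul_comm _ Qᵀ]
    simp only [Matrix.mul_assoc]
  have h1 : trace (A * A * X ^ n) = trace (A * X ^ n * A * Y ^ 0) := by
    rw [pow_zero, Matrix.mul_one, trace_mul_comm (A * X ^ n), Matrix.mul_assoc]
  have h2 : trace (A * A * Y ^ n) = trace (A * X ^ 0 * A * Y ^ n) := by
    rw [pow_zero, Matrix.mul_one]
  rw [h1, h2, key, key, key, ← Finset.sum_add_distrib]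
  refine Finset.sum_le_sum fun i _ => ?_
  rw [← Finset.sum_add_distrib]
  refine Finset.sum_le_sum fun j _ => ?_
  rw [← add_mul]
  refine mul_le_mul_of_nonneg_right ?_ (sq_nonneg _)
  rw [pow_zero, pow_zero, mul_one, one_mul, ← hn.pow_abs, ← hn.pow_abs (E j)]
  calc D i ^ q * E j ^ s ≤ |D i ^ q * E j ^ s| := le_abs_self _
    _ = |D i| ^ q * |E j| ^ s := by rw [abs_mul, abs_pow, abs_pow]
    _ ≤ _ := by
      have ha := abs_nonneg (D i)
      have hb := abs_nonneg (E j)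
      rcases le_total (|D i|) (|E j|) with h | h
      · calc |D i| ^ q * |E j| ^ s ≤ |E j| ^ q * |E j| ^ s := by gcongr
          _ = |E j| ^ n := by rw [← pow_add, hqs]
          _ ≤ _ := le_add_of_nonneg_left (by positivity)
      · calc |D i| ^ q * |E j| ^ s ≤ |D i| ^ q * |D i| ^ s := by gcongr
          _ = |D i| ^ n := by rw [← pow_add, hqs]
          _ ≤ _ := le_add_of_nonneg_right (by positivity)

theorem transpose_pow_eq {X : Matrix m m ℝ} (hX : Xᵀ = X) (k : ℕ) : (X ^ k)ᵀ = X ^ k := by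
  rw [transpose_pow, hX]

/-- By cyclicity, with `n = 2k`, this is the trace of `X^k C X^k`, whose diagonal entries are the
quadratic form of `C` at the columns of `X^k`. -/
theorem trace_mul_pow_le_of_quadratic_le {C X : Matrix m m ℝ} (hX : Xᵀ = X)
    {σ : ℝ} (h : ∀ x : m → ℝ, x ⬝ᵥ C *ᵥ x ≤ σ * (x ⬝ᵥ x)) {n : ℕ} (hn : Even n) :
    trace (C * X ^ n) ≤ σ * trace (X ^ n) := by
  obtain ⟨k, rfl⟩ := hn
  have e : ∀ i, X ^ k = X ^ k → (X ^ k * C * X ^ k) i i =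
      (fun j => (X ^ k) j i) ⬝ᵥ C *ᵥ (fun j => (X ^ k) j i) := by
    intro i _
    have hs : ∀ j, (X ^ k) i j = (X ^ k) j i := fun j => by
      conv_lhs => rw [← transpose_pow_eq hX k, transpose_apply]
    rw [Matrix.mul_assoc, mul_apply]
    simp only [dotProduct, mulVec, mul_apply, hs]
  rw [pow_add, ← Matrix.mul_assoc, trace_mul_comm, ← Matrix.mul_assoc, trace, trace, Finset.mul_sum]
  refine Finset.sum_le_sum fun i _ => ?_
  rw [diag_apply, diag_apply, e i rfl]
  refine (h _).trans_eq ?_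
  congr 1
  rw [mul_apply]
  simp only [dotProduct]
  refine Finset.sum_congr rfl fun j _ => ?_
  congr 1
  conv_lhs => rw [← transpose_pow_eq hX k, transpose_apply]

/-- If a quadratic form is large at some vector, so are the traces of the even powers. -/
theorem pow_le_trace_pow_of_lt_abs_quadratic {X : Matrix m m ℝ} (hX : Xᵀ = X) {t : ℝ} (ht : 0 ≤ t)
    {x : m → ℝ} (hx : t * (x ⬝ᵥ x) < |x ⬝ᵥ X *ᵥ x|) (p : ℕ) :
    t ^ (2 * p) ≤ trace (X ^ (2 * p)) := by
  obtain ⟨P, D, hP, hP', hXk⟩ := exists_orthogonal_diagonalization hX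
  have htr : trace (X ^ (2 * p)) = ∑ i, D i ^ (2 * p) := by
    rw [hXk, trace_mul_comm, ← Matrix.mul_assoc, hP, Matrix.one_mul, trace_diagonal]
  -- Otherwise the quadratic form, written in the eigenbasis, would be bounded by `t` times the
  -- squared norm.
  have hD : ∃ i, t < |D i| := by
    by_contra! hD
    apply hx.not_ge
    set y := Pᵀ *ᵥ x with hy
    have h1 : x ⬝ᵥ x = ∑ i, y i ^ 2 := by
      have : x ⬝ᵥ x = y ⬝ᵥ y := by
        rw [hy, dotProduct_mulVec, vecMul_transpose, mulVec_mulVec, hP', one_mulVec]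
      rw [this]; simp [dotProduct, sq]
    have h2 : x ⬝ᵥ X *ᵥ x = ∑ i, D i * y i ^ 2 := by
      have e := hXk 1
      simp only [pow_one] at e
      rw [e, ← mulVec_mulVec, ← mulVec_mulVec, dotProduct_mulVec, ← mulVec_transpose]
      simp only [dotProduct, mulVec_diagonal, ← hy]
      exact Finset.sum_congr rfl fun i _ => by ring
    rw [h1, h2, Finset.mul_sum]
    refine (Finset.abs_sum_le_sum_abs _ _).trans (Finset.sum_le_sum fun i _ => ?_)
    rw [abs_mul, abs_of_nonneg (sq_nonneg (y i))]
    exact mul_le_mul_of_nonneg_right (hD i) (sq_nonneg _)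
  obtain ⟨i, hi⟩ := hD
  rw [htr]
  have he : Even (2 * p) := even_two_mul p
  calc t ^ (2 * p) ≤ |D i| ^ (2 * p) := by gcongr
    _ = D i ^ (2 * p) := he.pow_abs _
    _ ≤ _ := Finset.single_le_sum (f := fun i => D i ^ (2 * p)) (fun j _ => he.pow_nonneg _)
      (Finset.mem_univ i)

theorem pow_sub_pow_eq_sum (X Y : Matrix m m ℝ) (n : ℕ) :
    X ^ (n + 1) - Y ^ (n + 1) = ∑ q ∈ Finset.range (n + 1), X ^ q * (X - Y) * Y ^ (n - q) := by
  induction n with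
  | zero => simp
  | succ n ih =>
    rw [Finset.sum_range_succ]
    have : ∀ q ∈ Finset.range (n + 1), X ^ q * (X - Y) * Y ^ (n + 1 - q) =
        X ^ q * (X - Y) * Y ^ (n - q) * Y := fun q hq => by
      rw [Finset.mem_range] at hq
      rw [show n + 1 - q = n - q + 1 by omega, pow_succ, Matrix.mul_assoc _ _ Y]
    rw [Finset.sum_congr rfl this, ← Finset.sum_mul, ← ih]
    simp only [Nat.sub_self, pow_zero, Matrix.mul_one, Matrix.sub_mul, Matrix.mul_sub, pow_succ]
    abel

end Matrix

/-- A finite probability space with a family of random signs, each of which can be flipped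
independently of the others. -/
structure SignFamily (Ω κ : Type*) where
  sign : κ → Ω → ℝ
  flip : κ → Ω → Ω
  flip_flip : ∀ k ω, flip k (flip k ω) = ω
  sign_sq : ∀ k ω, sign k ω * sign k ω = 1
  sign_flip_self : ∀ k ω, sign k (flip k ω) = - sign k ω
  sign_flip_of_ne : ∀ k l ω, l ≠ k → sign l (flip k ω) = sign l ω

/-! ### Trace moments of matrix Rademacher series -/

namespace SignFamily

open Matrix

variable {Ω κ m : Type*} [Fintype Ω] [Fintype m] [DecidableEq m]

theorem sum_flip (S : SignFamily Ω κ) (k : κ) (f : Ω → ℝ) : ∑ ω, f (S.flip k ω) = ∑ ω, f ω :=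
  Equiv.sum_comp (Function.Involutive.toPerm (S.flip k) (S.flip_flip k)) f

variable (S : SignFamily Ω κ) (T : Finset κ) (A : κ → Ω → Matrix m m ℝ) (χ : Ω → ℝ)

/-- Integration by parts for signs. Splitting one factor off `X = ∑ ±A k` and averaging over the
flip of sign `k` replaces `±A k X^(2p+1)` by half of `±A k (X^(2p+1) - X'^(2p+1))`, where `X - X' =
±2 A k`. Telescoping leaves `2p + 1` traces containing `A k` twice, and
`trace_mul_pow_mul_mul_pow_le` merges the two factors into `A k * A k`. The weight `χ` and the
matrices may depend on other coins, just not on the signs being flipped. -/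
theorem sum_trace_pow_succ_le (hA : ∀ k ω, (A k ω)ᵀ = A k ω)
    (hAf : ∀ k ∈ T, ∀ l ω, A l (S.flip k ω) = A l ω)
    (hχ : ∀ ω, 0 ≤ χ ω) (hχf : ∀ k ∈ T, ∀ ω, χ (S.flip k ω) = χ ω) {σ : ℝ}
    (hσ : ∀ ω, χ ω ≠ 0 → ∀ x : m → ℝ,
      x ⬝ᵥ (∑ k ∈ T, A k ω * A k ω) *ᵥ x ≤ σ * (x ⬝ᵥ x)) (p : ℕ) :
    ∑ ω, χ ω * trace ((∑ k ∈ T, S.sign k ω • A k ω) ^ (2 * p + 2)) ≤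
      (2 * (2 * p + 1) * σ) * ∑ ω, χ ω * trace ((∑ k ∈ T, S.sign k ω • A k ω) ^ (2 * p)) := by
  classical
  set X : Ω → Matrix m m ℝ := fun ω => ∑ k ∈ T, S.sign k ω • A k ω with hXdef
  change ∑ ω, χ ω * trace (X ω ^ (2 * p + 2)) ≤ _ * ∑ ω, χ ω * trace (X ω ^ (2 * p))
  have hX : ∀ ω, (X ω)ᵀ = X ω := fun ω => by simp [hXdef, transpose_sum, hA]
  have hdiff : ∀ k ∈ T, ∀ ω, X ω - X (S.flip k ω) = (2 * S.sign k ω) • A k ω := by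
    intro k hk ω
    simp only [hXdef, ← Finset.sum_sub_distrib]
    rw [Finset.sum_eq_single_of_mem k hk]
    · rw [hAf k hk, S.sign_flip_self, ← sub_smul]; congr 1; ring
    · intro l _ hl
      rw [hAf k hk, S.sign_flip_of_ne k l ω hl, sub_self]
  have hterm : ∀ k ∈ T, ∑ ω, χ ω * (S.sign k ω * trace (A k ω * X ω ^ (2 * p + 1))) ≤
      2 * (2 * p + 1) * ∑ ω, χ ω * trace (A k ω * A k ω * X ω ^ (2 * p)) := by
    intro k hk
    -- The flip is a bijection that negates sign `k` and fixes everything else in the summand but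
    -- `X`.
    have h1 : ∑ ω, χ ω * (S.sign k ω * trace (A k ω * X ω ^ (2 * p + 1))) =
        - ∑ ω, χ ω * (S.sign k ω * trace (A k ω * X (S.flip k ω) ^ (2 * p + 1))) := by
      rw [← S.sum_flip k, ← Finset.sum_neg_distrib]
      refine Finset.sum_congr rfl fun ω _ => ?_
      rw [hχf k hk, S.sign_flip_self, hAf k hk]; ring
    -- The flip exchanges `X` and `X'`, so both terms of the bound have the same sum.
    have h2 : ∑ ω, χ ω * trace (A k ω * A k ω * X (S.flip k ω) ^ (2 * p)) =
        ∑ ω, χ ω * trace (A k ω * A k ω * X ω ^ (2 * p)) := by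
      rw [← S.sum_flip k]
      refine Finset.sum_congr rfl fun ω _ => ?_
      rw [hχf k hk, S.flip_flip, hAf k hk]
    have h3 : ∀ ω, χ ω * (S.sign k ω * trace (A k ω * X ω ^ (2 * p + 1))) -
        χ ω * (S.sign k ω * trace (A k ω * X (S.flip k ω) ^ (2 * p + 1))) ≤
        2 * ((2 * p + 1) * (χ ω * trace (A k ω * A k ω * X ω ^ (2 * p)) +
          χ ω * trace (A k ω * A k ω * X (S.flip k ω) ^ (2 * p)))) := by
      intro ω
      have e : S.sign k ω * trace (A k ω * X ω ^ (2 * p + 1)) -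
          S.sign k ω * trace (A k ω * X (S.flip k ω) ^ (2 * p + 1)) =
          2 * ∑ q ∈ Finset.range (2 * p + 1),
            trace (A k ω * X ω ^ q * A k ω * X (S.flip k ω) ^ (2 * p - q)) := by
        rw [← mul_sub, ← trace_sub, ← Matrix.mul_sub, pow_sub_pow_eq_sum, hdiff k hk,
          Finset.mul_sum, trace_sum, Finset.mul_sum, Finset.mul_sum]
        refine Finset.sum_congr rfl fun q _ => ?_
        rw [Matrix.mul_smul, Matrix.smul_mul, Matrix.mul_smul, trace_smul, smul_eq_mul, ← mul_assoc,
          mul_left_comm, S.sign_sq, mul_one]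
        simp only [Matrix.mul_assoc]
      have hb : ∑ q ∈ Finset.range (2 * p + 1),
            trace (A k ω * X ω ^ q * A k ω * X (S.flip k ω) ^ (2 * p - q)) ≤
          (2 * p + 1) * (trace (A k ω * A k ω * X ω ^ (2 * p)) +
            trace (A k ω * A k ω * X (S.flip k ω) ^ (2 * p))) := by
        have := Finset.sum_le_card_nsmul (Finset.range (2 * p + 1))
          (fun q => trace (A k ω * X ω ^ q * A k ω * X (S.flip k ω) ^ (2 * p - q))) _
          (fun q hq => trace_mul_pow_mul_mul_pow_le (hA k ω) (hX ω) (hX _) (even_two_mul p)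
            (Nat.add_sub_cancel' (Nat.lt_succ_iff.mp (Finset.mem_range.mp hq))))
        rw [Finset.card_range, nsmul_eq_mul] at this
        exact_mod_cast this
      rw [← mul_sub, e]
      linarith [mul_le_mul_of_nonneg_left hb (hχ ω)]
    have h4 := Finset.sum_le_sum fun ω (_ : ω ∈ Finset.univ) => h3 ω
    rw [Finset.sum_sub_distrib, ← Finset.mul_sum, ← Finset.mul_sum, Finset.sum_add_distrib, h2]
      at h4
    linarith
  calc ∑ ω, χ ω * trace (X ω ^ (2 * p + 2))
      = ∑ k ∈ T, ∑ ω, χ ω * (S.sign k ω * trace (A k ω * X ω ^ (2 * p + 1))) := by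
        rw [Finset.sum_comm]
        refine Finset.sum_congr rfl fun ω _ => ?_
        rw [← Finset.mul_sum, pow_succ' (X ω) (2 * p + 1)]
        congr 1
        conv_lhs => enter [1, 1]; rw [hXdef]
        rw [Finset.sum_mul, trace_sum]
        refine Finset.sum_congr rfl fun k _ => ?_
        rw [Matrix.smul_mul, trace_smul, smul_eq_mul]
    _ ≤ ∑ k ∈ T, 2 * (2 * p + 1) * ∑ ω, χ ω * trace (A k ω * A k ω * X ω ^ (2 * p)) :=
        Finset.sum_le_sum hterm
    _ = 2 * (2 * p + 1) * ∑ ω, χ ω * trace ((∑ k ∈ T, A k ω * A k ω) * X ω ^ (2 * p)) := by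
        rw [← Finset.mul_sum, Finset.sum_comm]
        congr 1
        refine Finset.sum_congr rfl fun ω _ => ?_
        rw [← Finset.mul_sum, Finset.sum_mul, trace_sum]
    _ ≤ 2 * (2 * p + 1) * ∑ ω, χ ω * (σ * trace (X ω ^ (2 * p))) := by
        refine mul_le_mul_of_nonneg_left (Finset.sum_le_sum fun ω _ => ?_) (by positivity)
        by_cases h0 : χ ω = 0
        · simp [h0]
        · exact mul_le_mul_of_nonneg_left
            (trace_mul_pow_le_of_quadratic_le (hX ω) (hσ ω h0) (even_two_mul p)) (hχ ω)
    _ = _ := by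
        simp only [mul_left_comm _ σ, ← Finset.mul_sum]; ring

/-- Iterating the previous bound down to the power zero, whose trace is the dimension. Each step
contributes a factor at most `4 P σ`; fixing `P` in advance keeps this factor uniform along the
induction. -/
theorem sum_trace_pow_le (hA : ∀ k ω, (A k ω)ᵀ = A k ω)
    (hAf : ∀ k ∈ T, ∀ l ω, A l (S.flip k ω) = A l ω)
    (hχ : ∀ ω, 0 ≤ χ ω) (hχf : ∀ k ∈ T, ∀ ω, χ (S.flip k ω) = χ ω) {σ : ℝ} (hσ0 : 0 ≤ σ)
    (hσ : ∀ ω, χ ω ≠ 0 → ∀ x : m → ℝ,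
      x ⬝ᵥ (∑ k ∈ T, A k ω * A k ω) *ᵥ x ≤ σ * (x ⬝ᵥ x)) {p P : ℕ} (hp : p ≤ P) :
    ∑ ω, χ ω * trace ((∑ k ∈ T, S.sign k ω • A k ω) ^ (2 * p)) ≤
      (4 * P * σ) ^ p * (Fintype.card m * ∑ ω, χ ω) := by
  induction p with
  | zero => simp [← Finset.sum_mul, mul_comm]
  | succ p ih =>
    refine (S.sum_trace_pow_succ_le T A χ hA hAf hχ hχf hσ p).trans ?_
    rw [pow_succ', mul_assoc (4 * P * σ)]
    have hc : (p : ℝ) + 1 ≤ P := by exact_mod_cast hp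
    refine mul_le_mul (mul_le_mul_of_nonneg_right (by linarith) hσ0)
      (ih (by omega)) ?_ (by positivity)
    refine Finset.sum_nonneg fun ω _ => mul_nonneg (hχ ω) ?_
    have hX : (∑ k ∈ T, S.sign k ω • A k ω)ᵀ = ∑ k ∈ T, S.sign k ω • A k ω := by
      simp [transpose_sum, hA]
    obtain ⟨Q, D, hQ, -, hk⟩ := exists_orthogonal_diagonalization hX
    rw [hk, trace_mul_comm, ← Matrix.mul_assoc, hQ, Matrix.one_mul, trace_diagonal]
    exact Finset.sum_nonneg fun i _ => (even_two_mul p).pow_nonneg _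

/-- Tail bound for a matrix Rademacher series, on an event `χ` that does not depend on the
signs. -/
theorem sum_indicator_quadratic_le (hA : ∀ k ω, (A k ω)ᵀ = A k ω)
    (hAf : ∀ k ∈ T, ∀ l ω, A l (S.flip k ω) = A l ω)
    (hχ : ∀ ω, 0 ≤ χ ω) (hχf : ∀ k ∈ T, ∀ ω, χ (S.flip k ω) = χ ω) {σ : ℝ} (hσ0 : 0 ≤ σ)
    (hσ : ∀ ω, χ ω ≠ 0 → ∀ x : m → ℝ,
      x ⬝ᵥ (∑ k ∈ T, A k ω * A k ω) *ᵥ x ≤ σ * (x ⬝ᵥ x)) {t : ℝ} (ht : 0 < t) (p : ℕ)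
    (E : Set Ω) [DecidablePred (· ∈ E)]
    (hE : ∀ ω ∈ E, ∃ x : m → ℝ, t * (x ⬝ᵥ x) < |x ⬝ᵥ (∑ k ∈ T, S.sign k ω • A k ω) *ᵥ x|) :
    ∑ ω, (if ω ∈ E then χ ω else 0) ≤
      Fintype.card m * (4 * p * σ / t ^ 2) ^ p * ∑ ω, χ ω := by
  have h := S.sum_trace_pow_le T A χ hA hAf hχ hχf hσ0 hσ (le_refl p)
  have hX : ∀ ω, (∑ k ∈ T, S.sign k ω • A k ω)ᵀ = ∑ k ∈ T, S.sign k ω • A k ω := fun ω => by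
    simp [transpose_sum, hA]
  -- Markov's inequality for the trace moment: the trace is at least `t ^ (2p)` on `E` and
  -- nonnegative elsewhere.
  have hl : t ^ (2 * p) * ∑ ω, (if ω ∈ E then χ ω else 0) ≤
      ∑ ω, χ ω * trace ((∑ k ∈ T, S.sign k ω • A k ω) ^ (2 * p)) := by
    rw [Finset.mul_sum]
    refine Finset.sum_le_sum fun ω _ => ?_
    split_ifs with hω
    · obtain ⟨x, hx⟩ := hE ω hω
      rw [mul_comm]
      exact mul_le_mul_of_nonneg_left
        (pow_le_trace_pow_of_lt_abs_quadratic (hX ω) ht.le hx p) (hχ ω)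
    · rw [mul_zero]
      refine mul_nonneg (hχ ω) ?_
      obtain ⟨Q, D, hQ, -, hk⟩ := exists_orthogonal_diagonalization (hX ω)
      rw [hk, trace_mul_comm, ← Matrix.mul_assoc, hQ, Matrix.one_mul, trace_diagonal]
      exact Finset.sum_nonneg fun i _ => (even_two_mul p).pow_nonneg _
  rw [div_pow, ← pow_mul]
  have htp : 0 < t ^ (2 * p) := by positivity
  rw [mul_div_assoc', div_mul_eq_mul_div, le_div_iff₀ htp]
  linarith [hl.trans h]

end SignFamily

/-! ## Exponential moments of Rademacher sums of vectors -/

namespace RademacherVector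

open ProbabilityTheory

/-- The sign `1` or `-1` of a coin. -/
def sgn (b : Bool) : ℝ := if b then -1 else 1

theorem sum_exp_sum_sgn_le {ι : Type*} [Fintype ι] [DecidableEq ι] (a : ι → ℝ) :
    ∑ ω : ι → Bool, Real.exp (∑ i, sgn (ω i) * a i) ≤
      2 ^ Fintype.card ι * Real.exp ((∑ i, a i ^ 2) / 2) := by
  calc ∑ ω : ι → Bool, Real.exp (∑ i, sgn (ω i) * a i)
      = ∏ i, ∑ b : Bool, Real.exp (sgn b * a i) := by
        rw [Finset.prod_univ_sum, Fintype.piFinset_univ]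
        simp only [Real.exp_sum]
    _ = ∏ i, 2 * Real.cosh (a i) := by
        refine Finset.prod_congr rfl fun i _ => ?_
        rw [Fintype.sum_bool, Real.cosh_eq]
        simp only [sgn]; norm_num; ring
    _ ≤ ∏ i, 2 * Real.exp (a i ^ 2 / 2) := by
        refine Finset.prod_le_prod (fun i _ => by have := Real.cosh_pos (a i); positivity)
          fun i _ => ?_
        gcongr
        exact Real.cosh_le_exp_half_sq _
    _ = _ := by
        rw [Finset.prod_mul_distrib, ← Real.exp_sum, Finset.prod_const, Finset.card_univ,
          Finset.sum_div]

theorem integrable_exp_mul_sq_gaussian :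
    Integrable (fun x : ℝ => Real.exp (x ^ 2 / 4)) (gaussianReal 0 1) ∧
      ∫ x, Real.exp (x ^ 2 / 4) ∂(gaussianReal 0 1) = √2 := by
  have e : ∀ x : ℝ, gaussianPDFReal 0 1 x • Real.exp (x ^ 2 / 4) =
      (√(2 * Real.pi))⁻¹ * Real.exp (-(1 / 4) * x ^ 2) := by
    intro x
    simp only [gaussianPDFReal, NNReal.coe_one, mul_one, sub_zero, smul_eq_mul]
    rw [mul_assoc, ← Real.exp_add]
    congr 2; ring
  constructor
  · rw [gaussianReal_of_var_ne_zero _ one_ne_zero, gaussianPDF_def]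
    rw [integrable_withDensity_iff_integrable_smul' (by fun_prop) (by simp)]
    simp only [ENNReal.toReal_ofReal (gaussianPDFReal_nonneg 0 1 _), e]
    exact (integrable_exp_neg_mul_sq (by norm_num)).const_mul _
  · rw [integral_gaussianReal_eq_integral_smul one_ne_zero]
    simp only [e]
    rw [integral_const_mul, integral_gaussian, ← Real.sqrt_inv, ← Real.sqrt_mul (by positivity)]
    congr 1
    field_simp
    norm_num

theorem exp_mul_gaussian (w : ℝ) :
    Integrable (fun x : ℝ => Real.exp (w * x)) (gaussianReal 0 1) ∧
      ∫ x, Real.exp (w * x) ∂(gaussianReal 0 1) = Real.exp (w ^ 2 / 2) := by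
  refine ⟨integrable_exp_mul_gaussianReal w, ?_⟩
  have := mgf_gaussianReal (p := gaussianReal 0 1) (X := id) (by rw [Measure.map_id]) w
  simpa [mgf] using this

theorem exp_norm_sq_eq_integral {α : Type*} [Fintype α] (w : α → ℝ) :
    Integrable (fun g : α → ℝ => Real.exp (∑ a, w a * g a)) (Measure.pi fun _ => gaussianReal 0 1) ∧
      ∫ g : α → ℝ, Real.exp (∑ a, w a * g a) ∂(Measure.pi fun _ => gaussianReal 0 1) =
        Real.exp ((∑ a, w a ^ 2) / 2) := by
  simp only [Real.exp_sum]
  constructor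
  · exact Integrable.fintype_prod fun a => (exp_mul_gaussian (w a)).1
  · rw [integral_fintype_prod_eq_prod (fun a x => Real.exp (w a * x)), Finset.sum_div,
      Real.exp_sum]
    exact Finset.prod_congr rfl fun a _ => (exp_mul_gaussian (w a)).2

/-- Gaussian linearization: `exp (‖s‖²/4)` is the mean of `exp (⟨s, g⟩/√2)` over a standard Gaussian
`g`. After exchanging the averages, a scalar Rademacher sum remains for fixed `g`. Its exponential
moment is at most `exp (∑ ⟨vᵢ, g⟩²/4) ≤ exp (‖g‖²/4)`, and the Gaussian mean of the latter is `√2`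
per coordinate. -/
theorem sum_exp_norm_sq_le {ι α : Type*} [Fintype ι] [DecidableEq ι] [Fintype α]
    (v : ι → α → ℝ) (hv : ∀ g : α → ℝ, ∑ i, (∑ a, v i a * g a) ^ 2 ≤ ∑ a, g a ^ 2) :
    ∑ ω : ι → Bool, Real.exp ((∑ a, (∑ i, sgn (ω i) * v i a) ^ 2) / 4) ≤
      2 ^ Fintype.card ι * √2 ^ Fintype.card α := by
  set γ : Measure (α → ℝ) := Measure.pi fun _ => gaussianReal 0 1 with hγ
  have h2 : (√2 : ℝ) ^ 2 = 2 := Real.sq_sqrt (by norm_num)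
  have h1 : ∀ ω : ι → Bool, Real.exp ((∑ a, (∑ i, sgn (ω i) * v i a) ^ 2) / 4) =
      ∫ g, Real.exp (∑ a, (∑ i, sgn (ω i) * v i a) / √2 * g a) ∂γ := by
    intro ω
    rw [(exp_norm_sq_eq_integral fun a => (∑ i, sgn (ω i) * v i a) / √2).2]
    simp only [div_pow, h2, ← Finset.sum_div]
    rw [div_div]; norm_num
  have hint : Integrable (fun g : α → ℝ => Real.exp ((∑ a, g a ^ 2) / 4)) γ ∧
      ∫ g, Real.exp ((∑ a, g a ^ 2) / 4) ∂γ = √2 ^ Fintype.card α := by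
    simp only [Finset.sum_div, Real.exp_sum]
    refine ⟨Integrable.fintype_prod fun a => integrable_exp_mul_sq_gaussian.1, ?_⟩
    rw [hγ, integral_fintype_prod_eq_prod (fun (_ : α) (x : ℝ) => Real.exp (x ^ 2 / 4))]
    simp [integrable_exp_mul_sq_gaussian.2]
  simp only [h1]
  rw [← integral_finsetSum _ fun ω _ =>
    (exp_norm_sq_eq_integral fun a => (∑ i, sgn (ω i) * v i a) / √2).1, ← hint.2,
    ← integral_const_mul]
  refine integral_mono (integrable_finsetSum _ fun ω _ =>
    (exp_norm_sq_eq_integral fun a => (∑ i, sgn (ω i) * v i a) / √2).1) (hint.1.const_mul _) ?_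
  intro g
  have h3 : ∀ ω : ι → Bool, ∑ a, (∑ i, sgn (ω i) * v i a) / √2 * g a =
      ∑ i, sgn (ω i) * ((∑ a, v i a * g a) / √2) := by
    intro ω
    simp only [Finset.sum_div, Finset.mul_sum, Finset.sum_mul]
    rw [Finset.sum_comm]
    exact Finset.sum_congr rfl fun i _ => Finset.sum_congr rfl fun a _ => by ring
  simp only [h3]
  refine (sum_exp_sum_sgn_le _).trans ?_
  refine mul_le_mul_of_nonneg_left (Real.exp_le_exp.mpr ?_) (by positivity)
  simp only [div_pow, h2, ← Finset.sum_div]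
  rw [div_div]
  have := hv g
  linarith

/-- Markov's inequality: beyond the threshold the exponential is at least `2 ^ (k + m)`, with `m`
the dimension, and the factor `2 ^ m` absorbs the mean `√2 ^ m`. -/
theorem sum_indicator_norm_sq_gt_le {ι α : Type*} [Fintype ι] [DecidableEq ι] [Fintype α]
    (v : ι → α → ℝ) (hv : ∀ g : α → ℝ, ∑ i, (∑ a, v i a * g a) ^ 2 ≤ ∑ a, g a ^ 2)
    (k : ℕ) (E : Set (ι → Bool)) [DecidablePred (· ∈ E)]
    (hE : ∀ ω ∈ E, 4 * (k + Fintype.card α : ℝ) < ∑ a, (∑ i, sgn (ω i) * v i a) ^ 2) :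
    ∑ ω, (if ω ∈ E then (1 : ℝ) else 0) ≤ 2 ^ Fintype.card ι / 2 ^ k := by
  have h := sum_exp_norm_sq_le v hv
  have h1 : ∑ ω, (if ω ∈ E then (1 : ℝ) else 0) * 2 ^ (k + Fintype.card α) ≤
      ∑ ω : ι → Bool, Real.exp ((∑ a, (∑ i, sgn (ω i) * v i a) ^ 2) / 4) := by
    refine Finset.sum_le_sum fun ω _ => ?_
    split_ifs with hω
    · have h2 : (2 : ℝ) ≤ Real.exp 1 := by have := Real.add_one_le_exp 1; linarith
      calc (1 : ℝ) * 2 ^ (k + Fintype.card α) ≤ Real.exp 1 ^ (k + Fintype.card α) := by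
            rw [one_mul]; gcongr
        _ = Real.exp ((k + Fintype.card α : ℕ) : ℝ) := by rw [← Real.exp_nat_mul, mul_one]
        _ ≤ _ := by
          refine Real.exp_le_exp.mpr ?_
          have := hE ω hω
          push_cast; linarith
    · rw [zero_mul]; positivity
  rw [← Finset.sum_mul] at h1
  have h4 : √2 ^ Fintype.card α ≤ (2 : ℝ) ^ Fintype.card α := by
    gcongr
    rw [Real.sqrt_le_left (by norm_num)]; norm_num
  rw [le_div_iff₀ (by positivity)]
  have h5 := (h1.trans h).trans (mul_le_mul_of_nonneg_left h4 (by positivity))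
  rw [pow_add, ← mul_assoc] at h5
  exact le_of_mul_le_mul_right h5 (by positivity)

end RademacherVector

/-! ## The sketch: random signs, Hadamard mixing of blocks, and repeated halving -/

namespace Sketch

open RademacherVector Matrix

/-- One stage of the Walsh–Hadamard transform, with stride `h`. -/
def had (h : ℕ) (y : ℕ → ℝ) (f : ℕ) : ℝ :=
  if f / h % 2 = 0 then y f + y (f + h) else y (f - h) - y f

/-- The unnormalized Walsh–Hadamard transform of each block of `2 ^ s` consecutive entries. -/
def hads : ℕ → (ℕ → ℝ) → ℕ → ℝ
  | 0, y => y
  | s + 1, y => had (2 ^ s) (hads s y)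

/-- Random signs followed by the block Walsh–Hadamard transform. -/
def mix (β : ℕ) (ω : ℕ → Bool) (y : ℕ → ℝ) : ℕ → ℝ := hads β fun i => sgn (ω i) * y i

/-- After mixing, `j` rounds of keeping a random entry of each pair of consecutive entries. -/
def sketch (N β : ℕ) (ω : ℕ → Bool) : ℕ → (ℕ → ℝ) → ℕ → ℝ
  | 0, y => mix β ω y
  | j + 1, y => fun k => sketch N β ω j y (2 * k + (ω (2 * N - N / 2 ^ j + k)).toNat)

theorem hads_sum {α : Type*} (A : Finset α) (s : ℕ) (x : α → ℝ) (y : α → ℕ → ℝ) (f : ℕ) :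
    hads s (fun i => ∑ a ∈ A, x a * y a i) f = ∑ a ∈ A, x a * hads s (y a) f := by
  induction s generalizing f with
  | zero => rfl
  | succ s ih =>
    simp only [hads, had, ih]
    split_ifs
    · rw [← Finset.sum_add_distrib]; exact Finset.sum_congr rfl fun a _ => by ring
    · rw [← Finset.sum_sub_distrib]; exact Finset.sum_congr rfl fun a _ => by ring

theorem sketch_sum {α : Type*} (A : Finset α) (N β : ℕ) (ω : ℕ → Bool) (j : ℕ) (x : α → ℝ)
    (y : α → ℕ → ℝ) (k : ℕ) :
    sketch N β ω j (fun i => ∑ a ∈ A, x a * y a i) k = ∑ a ∈ A, x a * sketch N β ω j (y a) k := by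
  induction j generalizing k with
  | zero =>
    simp only [sketch, mix, ← hads_sum]
    congr 1; funext i
    rw [Finset.mul_sum]; exact Finset.sum_congr rfl fun a _ => by ring
  | succ j ih => simp only [sketch, ih]

/-- The matrix entries of the block Walsh–Hadamard transform. -/
def kernel (s f i : ℕ) : ℝ := hads s (fun i' => if i' = i then 1 else 0) f

/-- A stage combines two entries from distinct blocks of length `2 ^ s`, whose kernels have disjoint
supports; at most one of the two terms is nonzero, so the bound by one survives. The support clause
is what carries the induction. -/
theorem kernel_spec (s f i : ℕ) :
    |kernel s f i| ≤ 1 ∧ (kernel s f i ≠ 0 → i / 2 ^ s = f / 2 ^ s) := by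
  induction s generalizing f with
  | zero =>
    simp only [kernel, hads]
    split_ifs with h <;> simp [h]
  | succ s ih =>
    have hh : 0 < 2 ^ s := by positivity
    have key : ∀ f g : ℕ, f / 2 ^ s / 2 = g / 2 ^ s / 2 → f / 2 ^ s ≠ g / 2 ^ s → ∀ c : ℝ,
        (c = 1 ∨ c = -1) → |kernel s f i + c * kernel s g i| ≤ 1 ∧
        (kernel s f i + c * kernel s g i ≠ 0 → i / 2 ^ s / 2 = f / 2 ^ s / 2) := by
      intro f g hfg hne c hc
      have hc1 : |c| = 1 := by rcases hc with rfl | rfl <;> simp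
      obtain ⟨hf1, hf2⟩ := ih f
      obtain ⟨hg1, hg2⟩ := ih g
      by_cases h0 : kernel s f i = 0
      · rw [h0, zero_add, abs_mul, hc1, one_mul]
        refine ⟨hg1, fun h => ?_⟩
        rw [hg2 (right_ne_zero_of_mul h), hfg]
      · have h1 : kernel s g i = 0 := by
          by_contra h1
          exact hne ((hf2 h0).symm.trans (hg2 h1))
        rw [h1, mul_zero, add_zero]
        exact ⟨hf1, fun _ => by rw [hf2 h0]⟩
    have e : kernel (s + 1) f i = if f / 2 ^ s % 2 = 0 then kernel s f i + kernel s (f + 2 ^ s) i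
        else kernel s (f - 2 ^ s) i - kernel s f i := rfl
    rw [e, pow_succ, ← Nat.div_div_eq_div_mul, ← Nat.div_div_eq_div_mul]
    split_ifs with h
    · have h1 : (f + 2 ^ s) / 2 ^ s = f / 2 ^ s + 1 := Nat.add_div_right _ hh
      have := key f (f + 2 ^ s) (by omega) (by omega) 1 (Or.inl rfl)
      rwa [one_mul] at this
    · have h0 : 2 ^ s ≤ f := by
        by_contra! h0
        rw [Nat.div_eq_of_lt h0] at h; simp at h
      have h1 : (f - 2 ^ s) / 2 ^ s = f / 2 ^ s - 1 := by
        simpa using Nat.sub_mul_div f (2 ^ s) 1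
      have h2 : (f - 2 ^ s) / 2 ^ s / 2 = f / 2 ^ s / 2 := by
        rw [h1]; generalize f / 2 ^ s = a at h; omega
      have h3 : (f - 2 ^ s) / 2 ^ s ≠ f / 2 ^ s := by
        rw [h1]; generalize f / 2 ^ s = a at h; omega
      have := key (f - 2 ^ s) f h2 h3 (-1) (Or.inr rfl)
      rw [neg_one_mul, ← sub_eq_add_neg] at this
      exact ⟨this.1, fun hn => by rw [this.2 hn, h2]⟩

theorem lt_of_div_even {h N f : ℕ} (hN : 2 * h ∣ N) (hf : f < N) (he : f / h % 2 = 0) :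
    f + h < N := by
  obtain ⟨q, rfl⟩ := hN
  have hh : 0 < h := Nat.pos_of_ne_zero (by rintro rfl; simp at hf)
  have h1 : f / h < 2 * q := by
    rw [Nat.div_lt_iff_lt_mul hh]; linarith [mul_right_comm 2 h q]
  have h2 : f / h + 1 < 2 * q := by omega
  have h3 : (f + h) / h < 2 * q := by rwa [Nat.add_div_right _ hh]
  rw [Nat.div_lt_iff_lt_mul hh] at h3
  linarith [mul_right_comm 2 h q]

theorem hads_congr {s N : ℕ} (hN : 2 ^ s ∣ N) {y z : ℕ → ℝ} (h : ∀ i < N, y i = z i) :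
    ∀ f < N, hads s y f = hads s z f := by
  induction s with
  | zero => exact h
  | succ s ih =>
    intro f hf
    have ih := ih ((Nat.pow_dvd_pow 2 s.le_succ).trans hN)
    simp only [hads, had]
    split_ifs with he
    · rw [ih f hf, ih (f + 2 ^ s) (lt_of_div_even (by rwa [← pow_succ']) hf he)]
    · rw [ih f hf, ih (f - 2 ^ s) (by omega)]

theorem hads_eq_sum {s N : ℕ} (hN : 2 ^ s ∣ N) (y : ℕ → ℝ) {f : ℕ} (hf : f < N) :
    hads s y f = ∑ i ∈ Finset.range N, y i * kernel s f i := by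
  simp only [kernel]
  rw [← hads_sum]
  refine hads_congr hN (fun i hi => ?_) f hf
  simp [hi]

/-- The identity `(a + b)² + (a - b)² = 2a² + 2b²` for each pair at distance `h`; the induction adds
one group of `2h` entries at a time. -/
theorem sum_had_sq {h N : ℕ} (hN : 2 * h ∣ N) (y : ℕ → ℝ) :
    ∑ f ∈ Finset.range N, had h y f ^ 2 = 2 * ∑ f ∈ Finset.range N, y f ^ 2 := by
  rcases Nat.eq_zero_or_pos h with rfl | hh
  · have : N = 0 := by simpa using hN
    simp [this]
  obtain ⟨q, rfl⟩ := hN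
  induction q with
  | zero => simp
  | succ q ih =>
    rw [show 2 * h * (q + 1) = 2 * h * q + (h + h) by ring, Finset.sum_range_add,
      Finset.sum_range_add _ (2 * h * q), ih, mul_add]
    congr 1
    rw [Finset.sum_range_add, Finset.sum_range_add, ← Finset.sum_add_distrib,
      ← Finset.sum_add_distrib, Finset.mul_sum]
    refine Finset.sum_congr rfl fun i hi => ?_
    rw [Finset.mem_range] at hi
    have e1 : (2 * h * q + i) / h = 2 * q := by
      rw [show 2 * h * q + i = i + h * (2 * q) by ring, Nat.add_mul_div_left _ _ hh,
        Nat.div_eq_of_lt hi, zero_add]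
    have e2 : (2 * h * q + (h + i)) / h = 2 * q + 1 := by
      rw [show 2 * h * q + (h + i) = i + h * (2 * q + 1) by ring, Nat.add_mul_div_left _ _ hh,
        Nat.div_eq_of_lt hi, zero_add]
    have e3 : 2 * h * q + (h + i) - h = 2 * h * q + i := by omega
    have e4 : 2 * h * q + i + h = 2 * h * q + (h + i) := by omega
    simp only [had, e1, e2, e3, e4, Nat.mul_mod_right, if_true,
      show (2 * q + 1) % 2 ≠ 0 by omega, if_false]
    ring

theorem sum_hads_sq {s N : ℕ} (hN : 2 ^ s ∣ N) (y : ℕ → ℝ) :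
    ∑ f ∈ Finset.range N, hads s y f ^ 2 = 2 ^ s * ∑ f ∈ Finset.range N, y f ^ 2 := by
  induction s with
  | zero => simp [hads]
  | succ s ih =>
    rw [hads, sum_had_sq (by rwa [← pow_succ']), ih ((Nat.pow_dvd_pow 2 s.le_succ).trans hN),
      pow_succ']
    ring

theorem sgn_sq (b : Bool) : sgn b * sgn b = 1 := by cases b <;> simp [sgn]

theorem sum_mix_sq {β N : ℕ} (hN : 2 ^ β ∣ N) (ω : ℕ → Bool) (y : ℕ → ℝ) :
    ∑ f ∈ Finset.range N, mix β ω y f ^ 2 = 2 ^ β * ∑ f ∈ Finset.range N, y f ^ 2 := by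
  rw [mix, sum_hads_sq hN]
  congr 1
  refine Finset.sum_congr rfl fun i _ => ?_
  rw [mul_pow, sq (sgn _), sgn_sq, one_mul]

theorem div_pow_eq_two_mul {N j : ℕ} (h : 2 ^ (j + 1) ∣ N) : N / 2 ^ j = 2 * (N / 2 ^ (j + 1)) := by
  obtain ⟨q, rfl⟩ := h
  rw [Nat.mul_div_cancel_left _ (by positivity), pow_succ, mul_assoc,
    Nat.mul_div_cancel_left _ (by positivity)]

/-- The signs use the first `N` tosses, and the rounds before stage `j` use `N/2 + … + N/2^j = N -
N/2^j` more, so nothing later has been read. This is the independence needed between successive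
rounds. -/
theorem sketch_congr {N β j : ℕ} (hβ : 2 ^ β ∣ N) (hj : 2 ^ j ∣ N) {ω ω' : ℕ → Bool}
    (h : ∀ t < 2 * N - N / 2 ^ j, ω t = ω' t) (y : ℕ → ℝ) :
    ∀ k < N / 2 ^ j, sketch N β ω j y k = sketch N β ω' j y k := by
  induction j with
  | zero =>
    intro k hk
    rw [pow_zero, Nat.div_one] at hk h
    refine hads_congr hβ (fun i hi => ?_) k hk
    rw [h i (by omega)]
  | succ j ih =>
    intro k hk
    have e := div_pow_eq_two_mul hj
    have hle : N / 2 ^ j ≤ N := Nat.div_le_self _ _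
    simp only [sketch]
    rw [h _ (by omega)]
    refine ih ((Nat.pow_dvd_pow 2 j.le_succ).trans hj) (fun t ht => h t (by omega)) _ ?_
    have := Bool.toNat_le (ω' (2 * N - N / 2 ^ j + k))
    omega

/-- Halving only selects entries, and the selected index depends on the tosses alone. One `f` thus
serves all columns at once, so bounds on whole rows after mixing persist through all rounds. -/
theorem exists_sketch_eq_mix {N β j : ℕ} (hj : 2 ^ j ∣ N) (ω : ℕ → Bool) :
    ∀ k < N / 2 ^ j, ∃ f < N, ∀ y, sketch N β ω j y k = mix β ω y f := by
  induction j with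
  | zero => intro k hk; exact ⟨k, by simpa using hk, fun y => rfl⟩
  | succ j ih =>
    intro k hk
    have e := div_pow_eq_two_mul hj
    have := Bool.toNat_le (ω (2 * N - N / 2 ^ j + k))
    obtain ⟨f, hf, hy⟩ := ih ((Nat.pow_dvd_pow 2 j.le_succ).trans hj)
      (2 * k + (ω (2 * N - N / 2 ^ j + k)).toNat) (by omega)
    exact ⟨f, hf, fun y => hy y⟩

/-- Extension of finitely many coin tosses by heads. -/
def ext {K : ℕ} (x : Fin K → Bool) (t : ℕ) : Bool := if h : t < K then x ⟨t, h⟩ else false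

/-- Independent fair coins are a sign family. -/
def coinSigns {ι κ : Type*} [DecidableEq ι] (c : κ → ι) (hc : Function.Injective c) :
    SignFamily (ι → Bool) κ where
  sign k ω := sgn (ω (c k))
  flip k ω := Function.update ω (c k) (!ω (c k))
  flip_flip k ω := by simp
  sign_sq k ω := sgn_sq _
  sign_flip_self k ω := by
    cases h : ω (c k) <;> simp [sgn]
  sign_flip_of_ne k l ω h := by
    rw [Function.update_of_ne (hc.ne h)]

/-- Each cylinder over `K` tosses has measure `2⁻ᴷ`, and the event is a finite disjoint union of
cylinders. Probability thereby becomes counting. -/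
theorem coinMeasure_restrict (K : ℕ) (S : Set (Fin K → Bool)) [DecidablePred (· ∈ S)] :
    RealRAM.coinMeasure {ω | (fun i : Fin K => ω i) ∈ S} =
      ENNReal.ofReal ((∑ x, if x ∈ S then (1 : ℝ) else 0) / 2 ^ K) := by
  have hU : (PMF.uniformOfFintype Bool).toMeasure Set.univ = 1 := measure_univ
  have h1 : ∀ x : Fin K → Bool, RealRAM.coinMeasure {ω | (fun i : Fin K => ω i) = x} =
      ENNReal.ofReal (1 / 2 ^ K) := by
    intro x
    have e : {ω : ℕ → Bool | (fun i : Fin K => ω i) = x} =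
        Set.pi (Finset.range K : Set ℕ) fun t => {ext x t} := by
      ext ω
      simp only [Set.mem_ofPred_eq, Set.mem_pi, Finset.coe_range, Set.mem_Iio,
        Set.mem_singleton_iff, funext_iff, ext]
      constructor
      · intro h t ht; rw [dif_pos ht]; exact h ⟨t, ht⟩
      · intro h i; rw [h i i.2, dif_pos i.2]
    rw [e, RealRAM.coinMeasure, Measure.infinitePi_pi _ (fun _ _ => measurableSet_singleton _)]
    simp only [PMF.toMeasure_apply_singleton _ _ (measurableSet_singleton _),
      PMF.uniformOfFintype_apply, Fintype.card_bool, Finset.prod_const, Finset.card_range]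
    rw [ENNReal.ofReal_div_of_pos (by positivity), ENNReal.ofReal_one,
      ENNReal.ofReal_pow (by norm_num), one_div, ← ENNReal.inv_pow]
    norm_num
  have e : {ω : ℕ → Bool | (fun i : Fin K => ω i) ∈ S} =
      ⋃ x ∈ Finset.univ.filter (· ∈ S), {ω | (fun i : Fin K => ω i) = x} := by
    ext ω; simp
  rw [e, measure_biUnion_finset]
  · simp only [h1]
    rw [Finset.sum_const, ← Finset.sum_filter, Finset.sum_const, nsmul_eq_mul, nsmul_eq_mul,
      mul_one, ← ENNReal.ofReal_natCast, ← ENNReal.ofReal_mul (by positivity), mul_one_div]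
  · intro x _ y _ hxy
    refine Set.disjoint_left.mpr fun ω hx hy => hxy ?_
    exact hx.symm.trans hy
  · intro x _
    have : Measurable fun (ω : ℕ → Bool) (i : Fin K) => ω i := by fun_prop
    exact this (measurableSet_singleton x)

end Sketch

/-! ### The effect of mixing and of one halving round -/

namespace Sketch

open RademacherVector Matrix

variable {α : Type*} [Fintype α]

/-- The rescaled squared norm of the sketch of a combination of the columns `U`. -/
noncomputable def energy (N β : ℕ) (U : α → ℕ → ℝ) (ω : ℕ → Bool) (j : ℕ) (x : α → ℝ) : ℝ :=
  2 ^ j / 2 ^ β * ∑ k ∈ Finset.range (N / 2 ^ j), (∑ a, x a * sketch N β ω j (U a) k) ^ 2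

theorem energy_eq (N β : ℕ) (U : α → ℕ → ℝ) (ω : ℕ → Bool) (j : ℕ) (x : α → ℝ) :
    energy N β U ω j x = 2 ^ j / 2 ^ β * ∑ k ∈ Finset.range (N / 2 ^ j),
      sketch N β ω j (fun i => ∑ a, x a * U a i) k ^ 2 := by
  simp only [energy, sketch_sum]

theorem energy_zero {N β : ℕ} (hβ : 2 ^ β ∣ N) (U : α → ℕ → ℝ) (ω : ℕ → Bool) (x : α → ℝ) :
    energy N β U ω 0 x = ∑ i ∈ Finset.range N, (∑ a, x a * U a i) ^ 2 := by
  rw [energy_eq]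
  simp only [sketch, pow_zero, Nat.div_one]
  rw [sum_mix_sq hβ, one_div, inv_mul_cancel_left₀ (by positivity)]

theorem energy_congr {N β j : ℕ} (hβ : 2 ^ β ∣ N) (hj : 2 ^ j ∣ N) {ω ω' : ℕ → Bool}
    (h : ∀ t < 2 * N - N / 2 ^ j, ω t = ω' t) (U : α → ℕ → ℝ) (x : α → ℝ) :
    energy N β U ω j x = energy N β U ω' j x := by
  rw [energy_eq, energy_eq]
  congr 1
  refine Finset.sum_congr rfl fun k hk => ?_
  rw [sketch_congr hβ hj h _ k (Finset.mem_range.mp hk)]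

/-- Keeping `p` from a pair `p, q` and doubling the weight changes `p² + q²` by `p² - q²`; keeping
`q` changes it by the opposite amount. The increment is therefore a Rademacher series in the coins
of this round. -/
theorem energy_succ_sub {N β j : ℕ} (hj : 2 ^ (j + 1) ∣ N) (U : α → ℕ → ℝ) (ω : ℕ → Bool)
    (x : α → ℝ) :
    energy N β U ω (j + 1) x - energy N β U ω j x =
      ∑ k ∈ Finset.range (N / 2 ^ (j + 1)), sgn (ω (2 * N - N / 2 ^ j + k)) * (2 ^ j / 2 ^ β *
        ((∑ a, x a * sketch N β ω j (U a) (2 * k)) ^ 2 -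
          (∑ a, x a * sketch N β ω j (U a) (2 * k + 1)) ^ 2)) := by
  have hpair : ∀ (g : ℕ → ℝ) (r : ℕ), ∑ k ∈ Finset.range (2 * r), g k =
      ∑ k ∈ Finset.range r, (g (2 * k) + g (2 * k + 1)) := by
    intro g r
    induction r with
    | zero => simp
    | succ r ih =>
      rw [show 2 * (r + 1) = 2 * r + 1 + 1 by ring, Finset.sum_range_succ, Finset.sum_range_succ,
        ih, Finset.sum_range_succ, add_assoc]
  rw [energy, energy, div_pow_eq_two_mul hj, hpair, Finset.mul_sum, Finset.mul_sum,
    ← Finset.sum_sub_distrib]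
  refine Finset.sum_congr rfl fun k _ => ?_
  simp only [sketch, div_pow_eq_two_mul hj]
  cases ω (2 * N - 2 * (N / 2 ^ (j + 1)) + k) <;> simp [sgn, pow_succ] <;> ring

theorem dotProduct_vecMulVec_mulVec (u x : α → ℝ) : x ⬝ᵥ (vecMulVec u u) *ᵥ x = (u ⬝ᵥ x) ^ 2 := by
  rw [vecMulVec_mulVec, dotProduct_smul]
  simp [dotProduct_comm x u, sq]

theorem dotProduct_self_nonneg' (u : α → ℝ) : 0 ≤ u ⬝ᵥ u :=
  Finset.sum_nonneg fun i _ => mul_self_nonneg (u i)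

/-- The left side is the squared length of `ρ(⟨u, x⟩u - ⟨v, x⟩v)`, and `‖a - b‖² ≤ 2‖a‖² + 2‖b‖²`.
Summed over all pairs, this bounds the matrix variance by a multiple of the current energy. -/
theorem dotProduct_sq_sub_le {u v : α → ℝ} {L : ℝ} (hu : u ⬝ᵥ u ≤ L) (hv : v ⬝ᵥ v ≤ L) (ρ : ℝ)
    (x : α → ℝ) :
    x ⬝ᵥ ((ρ • (vecMulVec u u - vecMulVec v v)) * (ρ • (vecMulVec u u - vecMulVec v v))) *ᵥ x ≤
      2 * ρ ^ 2 * L * ((u ⬝ᵥ x) ^ 2 + (v ⬝ᵥ x) ^ 2) := by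
  set p := u ⬝ᵥ x
  set q := v ⬝ᵥ x
  have h1 : (ρ • (vecMulVec u u - vecMulVec v v)) *ᵥ x = ρ • (p • u - q • v) := by
    rw [smul_mulVec, sub_mulVec, vecMulVec_mulVec, vecMulVec_mulVec]
    simp [p, q]
  have h2 : x ᵥ* (ρ • (vecMulVec u u - vecMulVec v v)) = ρ • (p • u - q • v) := by
    rw [← h1, ← mulVec_transpose]
    simp [transpose_smul, transpose_sub, transpose_vecMulVec]
  rw [← mulVec_mulVec, dotProduct_mulVec, h1, h2]
  have h3 : (p • u - q • v) ⬝ᵥ (p • u - q • v) ≤ 2 * (p ^ 2 * (u ⬝ᵥ u) + q ^ 2 * (v ⬝ᵥ v)) := by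
    have := dotProduct_self_nonneg' (p • u + q • v)
    simp only [add_dotProduct, dotProduct_add, sub_dotProduct, dotProduct_sub, smul_dotProduct,
      dotProduct_smul, smul_eq_mul, dotProduct_comm v u] at this ⊢
    nlinarith
  rw [smul_dotProduct, dotProduct_smul, smul_eq_mul, smul_eq_mul, ← mul_assoc, ← sq]
  have h4 : 2 * (p ^ 2 * (u ⬝ᵥ u) + q ^ 2 * (v ⬝ᵥ v)) ≤ 2 * (p ^ 2 * L + q ^ 2 * L) := by gcongr
  calc ρ ^ 2 * _ ≤ ρ ^ 2 * (2 * (p ^ 2 * L + q ^ 2 * L)) := by gcongr; exact h3.trans h4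
    _ = _ := by ring

open Classical in
/-- One halving round rarely changes the energy of some vector by much, provided that the rows
are short and that the energy before the round is bounded. -/
theorem count_halving_bad_le {N β j : ℕ} (hβ : 2 ^ β ∣ N) (hj : 2 ^ (j + 1) ∣ N) (U : α → ℕ → ℝ)
    {L t : ℝ} (hL : 0 ≤ L) (ht : 0 < t) (p : ℕ) (G : (Fin (2 * N) → Bool) → Prop)
    (hGf : ∀ (k : Fin (2 * N)) ω, 2 * N - N / 2 ^ j ≤ k → (G (Function.update ω k (!ω k)) ↔ G ω))
    (hG : ∀ ω, G ω → (∀ f < N, ∑ a, mix β (ext ω) (U a) f ^ 2 ≤ L) ∧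
      ∀ x, energy N β U (ext ω) j x ≤ 2 * ∑ a, x a ^ 2) :
    ∑ ω, (if G ω ∧ ∃ x, t * ∑ a, x a ^ 2 <
        |energy N β U (ext ω) (j + 1) x - energy N β U (ext ω) j x| then (1 : ℝ) else 0) ≤
      Fintype.card α * (4 * p * (4 * 2 ^ j * L / 2 ^ β) / t ^ 2) ^ p * 2 ^ (2 * N) := by
  have e := div_pow_eq_two_mul hj
  have hj' : 2 ^ j ∣ N := (Nat.pow_dvd_pow 2 j.le_succ).trans hj
  have hle : N / 2 ^ j ≤ N := Nat.div_le_self _ _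
  -- The coins tossed in this round.
  let c : Fin (N / 2 ^ (j + 1)) → Fin (2 * N) := fun k => ⟨2 * N - N / 2 ^ j + k, by omega⟩
  have hc : Function.Injective c := fun k l h => by
    have := congrArg Fin.val h
    simp only [c] at this
    exact Fin.ext (by omega)
  let W : (Fin (2 * N) → Bool) → ℕ → α → ℝ := fun ω k a => sketch N β (ext ω) j (U a) k
  let ρ : ℝ := 2 ^ j / 2 ^ β
  let A : Fin (N / 2 ^ (j + 1)) → (Fin (2 * N) → Bool) → Matrix α α ℝ := fun k ω =>
    ρ • (vecMulVec (W ω (2 * k)) (W ω (2 * k)) - vecMulVec (W ω (2 * k + 1)) (W ω (2 * k + 1)))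
  have hρ : 0 ≤ ρ := by positivity
  have hW : ∀ ω, G ω → ∀ k < N / 2 ^ j, W ω k ⬝ᵥ W ω k ≤ L := by
    intro ω hω k hk
    obtain ⟨f, hf, hy⟩ := exists_sketch_eq_mix (β := β) hj' (ext ω) k hk
    have := (hG ω hω).1 f hf
    simpa only [W, dotProduct, hy, ← sq] using this
  -- The rows before the round were read off earlier coins, so these flips leave them fixed.
  have hWf : ∀ k ω, ∀ i < N / 2 ^ j, W ((coinSigns c hc).flip k ω) i = W ω i := by
    intro k ω i hi
    funext a
    refine sketch_congr hβ hj' (fun s hs => ?_) _ i hi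
    have hs2 : s < 2 * N := by omega
    simp only [ext, hs2, dif_pos, coinSigns]
    rw [Function.update_of_ne]
    intro h
    have := congrArg Fin.val h
    simp only [c] at this
    omega
  have hquad : ∀ ω x, x ⬝ᵥ (∑ k, (coinSigns c hc).sign k ω • A k ω) *ᵥ x =
      energy N β U (ext ω) (j + 1) x - energy N β U (ext ω) j x := by
    intro ω x
    rw [energy_succ_sub hj, sum_mulVec, dotProduct_sum, ← Fin.sum_univ_eq_sum_range (fun k =>
      sgn (ext ω (2 * N - N / 2 ^ j + k)) * (2 ^ j / 2 ^ β *
        ((∑ a, x a * sketch N β (ext ω) j (U a) (2 * k)) ^ 2 -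
          (∑ a, x a * sketch N β (ext ω) j (U a) (2 * k + 1)) ^ 2)))]
    refine Finset.sum_congr rfl fun k _ => ?_
    rw [smul_mulVec, dotProduct_smul, smul_mulVec, dotProduct_smul, sub_mulVec, dotProduct_sub,
      dotProduct_vecMulVec_mulVec, dotProduct_vecMulVec_mulVec, smul_eq_mul, smul_eq_mul]
    have h1 : (coinSigns c hc).sign k ω = sgn (ext ω (2 * N - N / 2 ^ j + k)) := by
      simp only [coinSigns, ext]
      rw [dif_pos (c k).2]
    rw [h1]
    simp only [dotProduct, W, ρ, mul_comm (x _)]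
  have hAs : ∀ k ω, (A k ω)ᵀ = A k ω := fun k ω => by
    simp [A, transpose_smul, transpose_sub, transpose_vecMulVec]
  have key := (coinSigns c hc).sum_indicator_quadratic_le Finset.univ A
    (fun ω => if G ω then 1 else 0) hAs
    (fun k _ l ω => by
      have hl := l.2
      simp only [A]
      rw [hWf k ω _ (by omega), hWf k ω _ (by omega)])
    (fun ω => by split_ifs <;> norm_num)
    (fun k _ ω => by
      have := hGf (c k) ω (by simp [c])
      simp only [coinSigns, this])
    (σ := 4 * 2 ^ j * L / 2 ^ β) (by positivity)
    (fun ω hω x => by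
      have hGω : G ω := by by_contra h; simp [h] at hω
      rw [sum_mulVec, dotProduct_sum]
      calc ∑ k, x ⬝ᵥ (A k ω * A k ω) *ᵥ x
          ≤ ∑ k : Fin (N / 2 ^ (j + 1)), 2 * ρ ^ 2 * L *
              ((W ω (2 * k) ⬝ᵥ x) ^ 2 + (W ω (2 * k + 1) ⬝ᵥ x) ^ 2) :=
            Finset.sum_le_sum fun k _ => by
              have hk := k.2
              exact dotProduct_sq_sub_le (hW ω hGω _ (by omega)) (hW ω hGω _ (by omega)) ρ x
        _ = 2 * ρ * L * energy N β U (ext ω) j x := by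
            have hpair : ∀ (g : ℕ → ℝ) (r : ℕ), ∑ k ∈ Finset.range (2 * r), g k =
                ∑ k ∈ Finset.range r, (g (2 * k) + g (2 * k + 1)) := by
              intro g r
              induction r with
              | zero => simp
              | succ r ih =>
                rw [show 2 * (r + 1) = 2 * r + 1 + 1 by ring, Finset.sum_range_succ,
                  Finset.sum_range_succ, ih, Finset.sum_range_succ, add_assoc]
            rw [energy, e, hpair, ← Fin.sum_univ_eq_sum_range (fun k =>
              (∑ a, x a * sketch N β (ext ω) j (U a) (2 * k)) ^ 2 +
                (∑ a, x a * sketch N β (ext ω) j (U a) (2 * k + 1)) ^ 2), ← Finset.mul_sum]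
            simp only [dotProduct, W, mul_comm (x _), ρ]
            ring
        _ ≤ 2 * ρ * L * (2 * ∑ a, x a ^ 2) := by
            have := (hG ω hGω).2 x
            gcongr
        _ = 4 * 2 ^ j * L / 2 ^ β * (x ⬝ᵥ x) := by
            simp only [dotProduct, ← sq, ρ]; ring)
    ht p {ω | ∃ x, t * ∑ a, x a ^ 2 <
        |energy N β U (ext ω) (j + 1) x - energy N β U (ext ω) j x|}
    (fun ω ⟨x, hx⟩ => ⟨x, by
      rw [hquad]; simpa only [dotProduct, ← sq] using hx⟩)
  have hcard : ∑ ω : Fin (2 * N) → Bool, (if G ω then (1 : ℝ) else 0) ≤ 2 ^ (2 * N) := by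
    calc ∑ ω : Fin (2 * N) → Bool, (if G ω then (1 : ℝ) else 0)
        ≤ ∑ ω : Fin (2 * N) → Bool, (1 : ℝ) :=
          Finset.sum_le_sum fun ω _ => by split_ifs <;> norm_num
      _ = _ := by simp
  calc _ = ∑ ω, (if ω ∈ {ω | ∃ x, t * ∑ a, x a ^ 2 <
        |energy N β U (ext ω) (j + 1) x - energy N β U (ext ω) j x|} then
          (if G ω then (1 : ℝ) else 0) else 0) := by
        refine Finset.sum_congr rfl fun ω _ => ?_
        by_cases h1 : G ω <;> simp [h1]
    _ ≤ _ := key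
    _ ≤ _ := by gcongr

open Classical in
/-- Mixing makes all rows short, with high probability. -/
theorem count_mix_bad_le {N β ℓ : ℕ} (hβ : 2 ^ β ∣ N) (hN : N ≤ 2 ^ ℓ) (U : α → ℕ → ℝ)
    (hU : ∀ x : α → ℝ, ∑ i ∈ Finset.range N, (∑ a, x a * U a i) ^ 2 = ∑ a, x a ^ 2) :
    ∑ ω : Fin (2 * N) → Bool, (if ¬ ∀ f < N, ∑ a, mix β (ext ω) (U a) f ^ 2 ≤
      4 * (((ℓ + 4 : ℕ) : ℝ) + Fintype.card α) then (1 : ℝ) else 0) ≤ 2 ^ (2 * N) / 16 := by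
  have h1 : ∀ f ∈ Finset.range N, ∑ ω : Fin (2 * N) → Bool, (if 4 * (((ℓ + 4 : ℕ) : ℝ) +
      Fintype.card α) < ∑ a, mix β (ext ω) (U a) f ^ 2 then (1 : ℝ) else 0) ≤
      2 ^ (2 * N) / 2 ^ (ℓ + 4) := by
    intro f hf
    rw [Finset.mem_range] at hf
    -- All `2N` coins serve as index set; those that are not row signs get the zero vector.
    let v : Fin (2 * N) → α → ℝ := fun i a => if (i : ℕ) < N then U a i * kernel β f i else 0
    have hmix : ∀ (ω : Fin (2 * N) → Bool) a, mix β (ext ω) (U a) f = ∑ i, sgn (ω i) * v i a := by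
      intro ω a
      rw [mix, hads_eq_sum hβ _ hf]
      have : ∀ i : Fin (2 * N), sgn (ω i) * v i a =
          (fun i : ℕ => if i < N then sgn (ext ω i) * U a i * kernel β f i else 0) i := by
        intro i
        simp only [v, ext, i.2, dif_pos, mul_ite, mul_zero, mul_assoc]
      rw [Finset.sum_congr rfl fun i _ => this i, Fin.sum_univ_eq_sum_range
        (fun i : ℕ => if i < N then sgn (ext ω i) * U a i * kernel β f i else 0)]
      rw [← Finset.sum_subset (Finset.range_subset_range.mpr (by omega : N ≤ 2 * N))]
      · exact Finset.sum_congr rfl fun i hi => by rw [if_pos (Finset.mem_range.mp hi)]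
      · intro i _ hi
        rw [if_neg (by simpa using hi)]
    -- The kernel entries are at most one in absolute value and the columns `U` are orthonormal.
    have hv : ∀ g : α → ℝ, ∑ i, (∑ a, v i a * g a) ^ 2 ≤ ∑ a, g a ^ 2 := by
      intro g
      rw [← hU g]
      have : ∀ i : Fin (2 * N), (∑ a, v i a * g a) ^ 2 =
          (fun i : ℕ => if i < N then (kernel β f i * ∑ a, g a * U a i) ^ 2 else 0) i := by
        intro i
        simp only [v]
        split_ifs
        · rw [Finset.mul_sum]
          congr 1
          exact Finset.sum_congr rfl fun a _ => by ring
        · simp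
      rw [Finset.sum_congr rfl fun i _ => this i, Fin.sum_univ_eq_sum_range
        (fun i : ℕ => if i < N then (kernel β f i * ∑ a, g a * U a i) ^ 2 else 0)]
      rw [← Finset.sum_subset (Finset.range_subset_range.mpr (by omega : N ≤ 2 * N))]
      · refine Finset.sum_le_sum fun i hi => ?_
        rw [if_pos (Finset.mem_range.mp hi), mul_pow]
        refine mul_le_of_le_one_left (sq_nonneg _) ?_
        rw [← sq_abs]
        exact pow_le_one₀ (abs_nonneg _) (kernel_spec β f i).1
      · intro i _ hi
        rw [if_neg (by simpa using hi)]
    -- A single row fails with probability at most `2 ^ -(ℓ + 4)`; the union over at most `2 ^ ℓ`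
    -- rows leaves `1/16`.
    have := sum_indicator_norm_sq_gt_le v hv (ℓ + 4) {ω | 4 * (((ℓ + 4 : ℕ) : ℝ) +
      Fintype.card α) < ∑ a, mix β (ext ω) (U a) f ^ 2} (fun ω hω => by
        rw [Set.mem_ofPred_eq] at hω
        simpa only [← hmix] using hω)
    simpa using this
  calc _ ≤ ∑ ω : Fin (2 * N) → Bool, ∑ f ∈ Finset.range N, (if 4 * (((ℓ + 4 : ℕ) : ℝ) +
      Fintype.card α) < ∑ a, mix β (ext ω) (U a) f ^ 2 then (1 : ℝ) else 0) := by
        refine Finset.sum_le_sum fun ω _ => ?_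
        split_ifs with h
        · exact Finset.sum_nonneg fun f _ => by split_ifs <;> norm_num
        · push Not at h
          obtain ⟨f, hf, h⟩ := h
          refine le_trans ?_ (Finset.single_le_sum (fun f _ => ?_) (Finset.mem_range.mpr hf))
          · rw [if_pos h]
          · split_ifs <;> norm_num
    _ ≤ ∑ f ∈ Finset.range N, 2 ^ (2 * N) / 2 ^ (ℓ + 4) := by
        rw [Finset.sum_comm]
        exact Finset.sum_le_sum h1
    _ = N * (2 ^ (2 * N) / 2 ^ (ℓ + 4)) := by simp
    _ ≤ 2 ^ ℓ * (2 ^ (2 * N) / 2 ^ (ℓ + 4)) := by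
        gcongr; exact_mod_cast hN
    _ = _ := by rw [pow_add]; field_simp; norm_num

end Sketch

/-! ### Accumulated distortion and failure probability of all rounds -/

namespace Sketch

open RademacherVector Matrix

variable {α : Type*} [Fintype α]

theorem sum_geom_reflect_le {r : ℝ} (h0 : 0 ≤ r) (h1 : r < 1) {j J : ℕ} (hj : j ≤ J) :
    ∑ i ∈ Finset.range j, r ^ (J - 1 - i) ≤ (1 - r)⁻¹ := by
  calc ∑ i ∈ Finset.range j, r ^ (J - 1 - i) ≤ ∑ i ∈ Finset.range J, r ^ (J - 1 - i) :=
        Finset.sum_le_sum_of_subset_of_nonneg (Finset.range_subset_range.mpr hj)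
          fun i _ _ => by positivity
    _ = ∑ i ∈ Finset.range J, r ^ i := Finset.sum_range_reflect (fun i => r ^ i) J
    _ ≤ ∑' i, r ^ i := (summable_geometric_of_lt_one h0 h1).sum_le_tsum _ fun i _ => by positivity
    _ = _ := tsum_geometric_of_lt_one h0 h1

/-- Union bound in counting form: `Q` can fail only if `P` has failed already or if `R` happens
while `P` holds. -/
theorem ite_not_le {P Q R : Prop} [Decidable P] [Decidable Q] [Decidable R] (h : P → ¬ R → Q) :
    (if ¬ Q then (1 : ℝ) else 0) ≤ (if ¬ P then 1 else 0) + if P ∧ R then 1 else 0 := by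
  by_cases hP : P <;> by_cases hQ : Q <;> by_cases hR : R <;> simp_all

/-- With the halving rounds that are allowed by `hJ`, the sketch is a subspace embedding with
distortion `δ`, with probability at least `0.8`. -/
theorem le_measure_energy_close {N β J lam ℓ : ℕ} (hβ : 2 ^ β ∣ N) (hJβ : J ≤ β) (hN : N ≤ 2 ^ ℓ)
    (U : α → ℕ → ℝ)
    (hU : ∀ x : α → ℝ, ∑ i ∈ Finset.range N, (∑ a, x a * U a i) ^ 2 = ∑ a, x a ^ 2)
    (hcard : Fintype.card α ≤ 2 ^ lam) {δ L : ℝ} (hδ : 0 < δ) (hδ1 : δ ≤ 1)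
    (hL : 4 * (((ℓ + 4 : ℕ) : ℝ) + Fintype.card α) ≤ L)
    (hJ : 0 < J → 512 * (lam + 4) * L * 2 ^ J ≤ 2 ^ β * δ ^ 2) :
    ENNReal.ofReal 0.8 ≤ RealRAM.coinMeasure
      {ω | ∀ x, |energy N β U ω J x - ∑ a, x a ^ 2| ≤ δ * ∑ a, x a ^ 2} := by
  classical
  have hL0 : 0 ≤ L := le_trans (by positivity) hL
  -- The change allowed in round `i`. These thresholds sum to at most `δ`. From one round to the
  -- next the variance doubles while `t²` grows only by `16/9`, so the ratio of variance to `t²`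
  -- shrinks by `8/9` per round counted back from the last one.
  let t : ℕ → ℝ := fun i => δ / 4 * (3 / 4) ^ (J - 1 - i)
  have ht : ∀ i, 0 < t i := fun i => by positivity
  let Good : ℕ → (ℕ → Bool) → Prop := fun j ω => (∀ f < N, ∑ a, mix β ω (U a) f ^ 2 ≤ L) ∧
    ∀ i < j, ∀ x, |energy N β U ω (i + 1) x - energy N β U ω i x| ≤ t i * ∑ a, x a ^ 2
  have hdvd : ∀ j ≤ J, 2 ^ j ∣ N := fun j hj => (Nat.pow_dvd_pow 2 (hj.trans hJβ)).trans hβ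
  have hclose : ∀ j ≤ J, ∀ ω, Good j ω → ∀ x,
      |energy N β U ω j x - ∑ a, x a ^ 2| ≤ δ * ∑ a, x a ^ 2 := by
    intro j hj ω hω x
    have h1 : |energy N β U ω j x - energy N β U ω 0 x| ≤
        ∑ i ∈ Finset.range j, t i * ∑ a, x a ^ 2 := by
      rw [← Finset.sum_range_sub (fun i => energy N β U ω i x)]
      refine (Finset.abs_sum_le_sum_abs _ _).trans (Finset.sum_le_sum fun i hi => ?_)
      exact hω.2 i (Finset.mem_range.mp hi) x
    rw [energy_zero hβ, hU, ← Finset.sum_mul] at h1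
    refine h1.trans (mul_le_mul_of_nonneg_right ?_ (by positivity))
    simp only [t]
    rw [← Finset.mul_sum]
    have := sum_geom_reflect_le (r := 3 / 4) (by norm_num) (by norm_num) hj
    norm_num at this
    nlinarith
  -- `Good j` is decided before round `j` tosses its coins, so it may serve as the weight in the
  -- tail bound for that round.
  have hcongr : ∀ j ≤ J, ∀ ω ω' : ℕ → Bool, (∀ s < 2 * N - N / 2 ^ j, ω s = ω' s) →
      (Good j ω ↔ Good j ω') := by
    intro j hj ω ω' h
    have hmono : ∀ i ≤ j, 2 * N - N / 2 ^ i ≤ 2 * N - N / 2 ^ j := fun i hi =>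
      Nat.sub_le_sub_left (Nat.div_le_div_left (Nat.pow_le_pow_right (by norm_num) hi)
        (by positivity)) _
    refine and_congr ?_ ?_
    · refine forall_congr' fun f => forall_congr' fun hf => ?_
      have := fun y => sketch_congr (β := β) hβ (hdvd 0 (Nat.zero_le _))
        (fun s hs => h s (hs.trans_le (hmono 0 (Nat.zero_le _)))) y f (by simpa using hf)
      simp only [sketch] at this
      simp only [this]
    · refine forall_congr' fun i => forall_congr' fun hi => forall_congr' fun x => ?_
      rw [energy_congr hβ (hdvd _ (by omega)) fun s hs => h s (hs.trans_le (hmono _ hi)),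
        energy_congr hβ (hdvd _ (by omega)) fun s hs => h s (hs.trans_le (hmono i hi.le))]
  -- Mixing fails with probability at most `1/16`. In each round the moment of order `p = lam + 4`
  -- gives at most `2^lam · 4^-(lam + 4) ≤ 1/256`, times the geometric factor.
  have hcount : ∀ j ≤ J, ∑ ω : Fin (2 * N) → Bool, (if ¬ Good j (ext ω) then (1 : ℝ) else 0) ≤
      (1 / 16 + ∑ i ∈ Finset.range j, 1 / 256 * (8 / 9 : ℝ) ^ (J - 1 - i)) * 2 ^ (2 * N) := by
    intro j
    induction j with
    | zero =>
      intro _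
      refine le_trans (Finset.sum_le_sum fun ω _ => ?_) ((count_mix_bad_le hβ hN U hU).trans
        (le_of_eq (by simp; ring)))
      have : ¬ Good 0 (ext ω) → ¬ ∀ f < N, ∑ a, mix β (ext ω) (U a) f ^ 2 ≤
          4 * (((ℓ + 4 : ℕ) : ℝ) + Fintype.card α) := fun h1 h2 =>
        h1 ⟨fun f hf => (h2 f hf).trans hL, fun i hi => absurd hi (Nat.not_lt_zero i)⟩
      by_cases h : Good 0 (ext ω)
      · rw [if_neg (not_not.mpr h)]; split_ifs <;> norm_num
      · rw [if_pos h, if_pos (this h)]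
    | succ j ih =>
      intro hj
      have hq := count_halving_bad_le (t := t j) hβ (hdvd _ hj) U hL0 (ht j) (lam + 4)
        (fun ω => Good j (ext ω))
        (fun k ω hk => hcongr j (by omega) _ _ fun s hs => by
          have hs2 : s < 2 * N := by omega
          simp only [ext, hs2, dif_pos]
          rw [Function.update_of_ne]
          rintro rfl
          simp only at hk; omega)
        (fun ω hω => ⟨hω.1, fun x => by
          have := (abs_le.mp (hclose j (by omega) _ hω x)).2
          have h0 : 0 ≤ ∑ a, x a ^ 2 := by positivity
          nlinarith⟩)
      -- With `J = j + 1 + i` the left side equals `128 (lam + 4) L 2^J (8/9)^i / (2^β δ²)`, which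
      -- explains the constant `512` in `hJ`.
      have hR : 4 * ((lam + 4 : ℕ) : ℝ) * (4 * 2 ^ j * L / 2 ^ β) / t j ^ 2 ≤
          1 / 4 * (8 / 9) ^ (J - 1 - j) := by
        obtain ⟨i, hi⟩ : ∃ i, J = j + 1 + i := ⟨J - (j + 1), by omega⟩
        have hJ := hJ (by omega)
        have e1 : J - 1 - j = i := by omega
        simp only [t, e1]
        rw [hi] at hJ
        rw [div_le_iff₀ (by positivity), mul_div_assoc', div_le_iff₀ (by positivity)]
        have e2 : 1 / 4 * (8 / 9 : ℝ) ^ i * (δ / 4 * (3 / 4) ^ i) ^ 2 * 2 ^ β =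
            (2 ^ β * δ ^ 2) / 64 * (1 / 2) ^ i := by
          rw [mul_pow, ← pow_mul, mul_comm i 2, pow_mul]
          have : (1 / 2 : ℝ) ^ i = (8 / 9) ^ i * ((3 / 4) ^ 2) ^ i := by
            rw [← mul_pow]; norm_num
          rw [this]; ring
        rw [e2]
        have e3 : (1 / 2 : ℝ) ^ i * 2 ^ (j + 1 + i) = 2 * 2 ^ j := by
          rw [pow_add, pow_succ, mul_left_comm, ← mul_pow]; norm_num; ring
        have := mul_le_mul_of_nonneg_right hJ (by positivity : (0 : ℝ) ≤ (1 / 2) ^ i / 64)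
        have e4 : 512 * ((lam : ℝ) + 4) * L * 2 ^ (j + 1 + i) * ((1 / 2) ^ i / 64) =
            8 * (lam + 4) * L * ((1 / 2) ^ i * 2 ^ (j + 1 + i)) := by ring
        rw [e4, e3] at this
        push_cast
        linarith
      have hq2 : Fintype.card α * (4 * ((lam + 4 : ℕ) : ℝ) * (4 * 2 ^ j * L / 2 ^ β) / t j ^ 2) ^
          (lam + 4) ≤ 1 / 256 * (8 / 9) ^ (J - 1 - j) := by
        have h0 : 0 ≤ 4 * ((lam + 4 : ℕ) : ℝ) * (4 * 2 ^ j * L / 2 ^ β) / t j ^ 2 := by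
          have := ht j; positivity
        calc _ ≤ (2 : ℝ) ^ lam * (1 / 4 * (8 / 9) ^ (J - 1 - j)) ^ (lam + 4) := by
              have : (Fintype.card α : ℝ) ≤ 2 ^ lam := by exact_mod_cast hcard
              gcongr
          _ = 1 / 256 * (1 / 2) ^ lam * ((8 / 9) ^ (J - 1 - j)) ^ (lam + 4) := by
              rw [mul_pow, pow_add (1 / 4 : ℝ), show (1 / 4 : ℝ) = 1 / 2 * (1 / 2) by norm_num,
                mul_pow]
              have : (2 : ℝ) ^ lam * (1 / 2) ^ lam = 1 := by rw [← mul_pow]; norm_num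
              linear_combination ((1 / 2 : ℝ) ^ lam * (1 / 2 * (1 / 2)) ^ 4 *
                ((8 / 9) ^ (J - 1 - j)) ^ (lam + 4)) * this
          _ ≤ 1 / 256 * 1 * ((8 / 9) ^ (J - 1 - j)) ^ 1 := by
              gcongr ?_ * ?_ * ?_
              · exact pow_le_one₀ (by norm_num) (by norm_num)
              · exact pow_le_pow_of_le_one (by positivity)
                  (pow_le_one₀ (by norm_num) (by norm_num)) (by omega)
          _ = _ := by ring
      have hstep : ∀ ω : Fin (2 * N) → Bool, (if ¬ Good (j + 1) (ext ω) then (1 : ℝ) else 0) ≤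
          (if ¬ Good j (ext ω) then (1 : ℝ) else 0) +
          (if Good j (ext ω) ∧ ∃ x, t j * ∑ a, x a ^ 2 <
            |energy N β U (ext ω) (j + 1) x - energy N β U (ext ω) j x| then (1 : ℝ) else 0) := by
        intro ω
        refine ite_not_le fun h1 h2 => ⟨h1.1, fun i hi x => ?_⟩
        rcases Nat.lt_succ_iff_lt_or_eq.mp hi with hi | rfl
        · exact h1.2 i hi x
        · push Not at h2; exact h2 x
      refine (Finset.sum_le_sum fun ω _ => hstep ω).trans ?_
      rw [Finset.sum_add_distrib, Finset.sum_range_succ, ← add_assoc, add_mul]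
      refine add_le_add (ih (by omega))
        (le_trans ?_ (mul_le_mul_of_nonneg_right hq2 (by positivity)))
      exact le_trans (le_of_eq (Finset.sum_congr rfl fun ω _ => by congr)) hq
  have hfinal := hcount J le_rfl
  have hgeom : ∑ i ∈ Finset.range J, 1 / 256 * (8 / 9 : ℝ) ^ (J - 1 - i) ≤ 9 / 256 := by
    rw [← Finset.mul_sum]
    have := sum_geom_reflect_le (r := 8 / 9) (by norm_num) (by norm_num) (le_refl J)
    norm_num at this
    linarith
  have hgood : (0.8 : ℝ) ≤ (∑ ω : Fin (2 * N) → Bool,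
      if ω ∈ {ω : Fin (2 * N) → Bool | Good J (ext ω)} then (1 : ℝ) else 0) / 2 ^ (2 * N) := by
    rw [le_div_iff₀ (by positivity)]
    have hsum : ∑ ω : Fin (2 * N) → Bool, (if ω ∈ {ω : Fin (2 * N) → Bool | Good J (ext ω)}
        then (1 : ℝ) else 0) + ∑ ω : Fin (2 * N) → Bool,
          (if ¬ Good J (ext ω) then (1 : ℝ) else 0) = 2 ^ (2 * N) := by
      rw [← Finset.sum_add_distrib]
      have : ∀ ω : Fin (2 * N) → Bool, (if ω ∈ {ω : Fin (2 * N) → Bool | Good J (ext ω)}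
        then (1 : ℝ) else 0) + (if ¬ Good J (ext ω) then (1 : ℝ) else 0) = 1 := by
        intro ω
        by_cases h : Good J (ext ω) <;> simp [h]
      rw [Finset.sum_congr rfl fun ω _ => this ω]
      simp
    have hp : (0 : ℝ) < 2 ^ (2 * N) := by positivity
    nlinarith [mul_le_mul_of_nonneg_right (add_le_add_right hgeom (1 / 16)) hp.le]
  refine (ENNReal.ofReal_le_ofReal hgood).trans ?_
  rw [← coinMeasure_restrict]
  -- Monotonicity alone suffices here, so the larger event need not be shown measurable.
  refine measure_mono fun ω hω x => ?_
  refine hclose J le_rfl ω ((hcongr J le_rfl _ _ fun s hs => ?_).mp hω) x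
  have hs2 : s < 2 * N := hs.trans_le (Nat.sub_le _ _)
  simp [ext, hs2]

end Sketch

/-! ## Least squares solutions of a sketched problem -/

/-! ### Extreme singular values as bounds on stretching -/

namespace LinearMap

open Module

variable {E F : Type*} [NormedAddCommGroup E] [InnerProductSpace ℝ E] [FiniteDimensional ℝ E]
  [NormedAddCommGroup F] [InnerProductSpace ℝ F] [FiniteDimensional ℝ F] (T : E →ₗ[ℝ] F)

/-- Expansion in an orthonormal eigenbasis of `adjoint T ∘ₗ T`, whose eigenvalues are the squared
singular values. -/
theorem norm_sq_eq_sum_singularValues_mul_inner_sq {n : ℕ} (hn : finrank ℝ E = n) (x : E) :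
    ‖T x‖ ^ 2 = ∑ i : Fin n, T.singularValues i ^ 2 *
      inner ℝ (T.isSymmetric_adjoint_comp_self.eigenvectorBasis hn i) x ^ 2 := by
  set B := T.isSymmetric_adjoint_comp_self.eigenvectorBasis hn
  have h1 : ‖T x‖ ^ 2 = inner ℝ x ((adjoint T ∘ₗ T) x) := by
    rw [comp_apply, adjoint_inner_right, real_inner_self_eq_norm_sq]
  rw [h1, ← B.sum_inner_mul_inner]
  refine Finset.sum_congr rfl fun i _ => ?_
  have h2 : inner ℝ (B i) ((adjoint T ∘ₗ T) x) = T.singularValues i ^ 2 * inner ℝ (B i) x := by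
    rw [← T.isSymmetric_adjoint_comp_self, T.isSymmetric_adjoint_comp_self.apply_eigenvectorBasis,
      T.sq_singularValues_fin hn, inner_smul_left]
    simp [B]
  rw [h2, real_inner_comm]; ring

theorem norm_le_singularValues_zero_mul (x : E) : ‖T x‖ ≤ T.singularValues 0 * ‖x‖ := by
  have h0 := T.singularValues_nonneg 0
  refine le_of_sq_le_sq ?_ (by positivity)
  rw [norm_sq_eq_sum_singularValues_mul_inner_sq T rfl, mul_pow,
    ← (T.isSymmetric_adjoint_comp_self.eigenvectorBasis rfl).sum_sq_inner_right x, Finset.mul_sum]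
  refine Finset.sum_le_sum fun i _ => mul_le_mul_of_nonneg_right ?_ (sq_nonneg _)
  exact pow_le_pow_left₀ (T.singularValues_nonneg _) (T.singularValues_antitone (Nat.zero_le _)) 2

theorem singularValues_last_mul_le_norm (x : E) :
    T.singularValues (finrank ℝ E - 1) * ‖x‖ ≤ ‖T x‖ := by
  refine le_of_sq_le_sq ?_ (by positivity)
  rw [norm_sq_eq_sum_singularValues_mul_inner_sq T rfl, mul_pow,
    ← (T.isSymmetric_adjoint_comp_self.eigenvectorBasis rfl).sum_sq_inner_right x, Finset.mul_sum]
  refine Finset.sum_le_sum fun i _ => mul_le_mul_of_nonneg_right ?_ (sq_nonneg _)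
  exact pow_le_pow_left₀ (T.singularValues_nonneg _)
    (T.singularValues_antitone (Nat.le_sub_one_of_lt i.2)) 2

end LinearMap

/-! ### Perturbation of the solution under a subspace embedding -/

namespace LeastSquares

open Module

variable {n d : ℕ} {A : Matrix (Fin n) (Fin d) ℝ} {b : EuclideanSpace ℝ (Fin n)}

theorem IsMinimizer.inner_eq_zero {x : EuclideanSpace ℝ (Fin d)} (h : IsMinimizer A b x)
    (u : EuclideanSpace ℝ (Fin d)) :
    inner ℝ (b - A.toEuclideanLin x) (A.toEuclideanLin u) = 0 := by
  have key := (Submodule.norm_eq_iInf_iff_real_inner_eq_zero (LinearMap.range A.toEuclideanLin)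
    (u := b) (v := A.toEuclideanLin x) ⟨x, rfl⟩).mp ?_
  · exact key _ ⟨u, rfl⟩
  · refine le_antisymm (le_ciInf ?_) ?_
    · rintro ⟨_, y, rfl⟩
      rw [norm_sub_rev, norm_sub_rev b]
      exact h y
    · exact ciInf_le ⟨0, by rintro _ ⟨w, rfl⟩; positivity⟩
        (⟨_, x, rfl⟩ : LinearMap.range A.toEuclideanLin)

theorem IsMinimizer.optValue_eq {x : EuclideanSpace ℝ (Fin d)} (h : IsMinimizer A b x) :
    optValue A b = ‖b - A.toEuclideanLin x‖ := by
  rw [norm_sub_rev]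
  exact le_antisymm (ciInf_le ⟨0, by rintro _ ⟨w, rfl⟩; positivity⟩ x) (le_ciInf h)

theorem IsMinimizer.norm_sq_eq {x : EuclideanSpace ℝ (Fin d)} (h : IsMinimizer A b x) :
    ‖b‖ ^ 2 = ‖A.toEuclideanLin x‖ ^ 2 + ‖b - A.toEuclideanLin x‖ ^ 2 := by
  have h1 : b = A.toEuclideanLin x + (b - A.toEuclideanLin x) := by abel
  conv_lhs => rw [h1]
  rw [norm_add_sq_real, real_inner_comm, h.inner_eq_zero]
  ring

theorem IsMinimizer.colSpaceFraction_eq {x : EuclideanSpace ℝ (Fin d)} (h : IsMinimizer A b x) :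
    colSpaceFraction A b = ‖A.toEuclideanLin x‖ / ‖b‖ := by
  rw [colSpaceFraction, ← Submodule.eq_starProjection_of_mem_of_inner_eq_zero
    (K := LinearMap.range A.toEuclideanLin) (u := b) (LinearMap.mem_range_self _ x)]
  rintro _ ⟨u, rfl⟩
  exact h.inner_eq_zero u

theorem finrank_range_toEuclideanLin (A : Matrix (Fin n) (Fin d) ℝ) :
    finrank ℝ (LinearMap.range A.toEuclideanLin) = A.rank := by
  rw [Matrix.rank_eq_finrank_range_toLin A (EuclideanSpace.basisFun (Fin n) ℝ).toBasis
    (EuclideanSpace.basisFun (Fin d) ℝ).toBasis, Matrix.toEuclideanLin_eq_toLin_orthonormal]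

/-- Put `v = A(y - x)` and `e = b - Ax`. These are orthogonal, whereas the sketched normal equations
say `⟨Se, Sv⟩ = ‖Sv‖²`. Comparing the embedding bounds at `v + te` and `v - te` limits `2tρ⟨Se, Sv⟩`
by `δ(‖v‖² + t²‖e‖²)`, while `ρ‖Sv‖² ≥ (1 - δ)‖v‖² ≥ ‖v‖²/2`. The choice `t = ‖v‖/‖e‖` balances the
two terms. -/
theorem norm_toEuclideanLin_sub_le {δ ρ : ℝ} (hδ0 : 0 ≤ δ) (hδ : δ ≤ 1 / 2)
    {F : Type*} [NormedAddCommGroup F] [InnerProductSpace ℝ F]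
    (S : EuclideanSpace ℝ (Fin n) →ₗ[ℝ] F)
    (hS : ∀ (u : EuclideanSpace ℝ (Fin d)) (c : ℝ),
      |ρ * ‖S (A.toEuclideanLin u + c • b)‖ ^ 2 - ‖A.toEuclideanLin u + c • b‖ ^ 2| ≤
        δ * ‖A.toEuclideanLin u + c • b‖ ^ 2)
    {x y : EuclideanSpace ℝ (Fin d)} (hx : IsMinimizer A b x)
    (hy : ∀ u, inner ℝ (S (A.toEuclideanLin y - b)) (S (A.toEuclideanLin u)) = 0) :
    ‖A.toEuclideanLin (y - x)‖ ≤ 2 * δ * ‖b - A.toEuclideanLin x‖ := by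
  set v := A.toEuclideanLin (y - x) with hv
  set e := b - A.toEuclideanLin x with he
  have hve : inner ℝ e v = 0 := hx.inner_eq_zero _
  have hS1 : ∀ s t : ℝ, |ρ * ‖S (s • v + t • e)‖ ^ 2 - ‖s • v + t • e‖ ^ 2| ≤
      δ * ‖s • v + t • e‖ ^ 2 := by
    intro s t
    have e1 : s • v + t • e = A.toEuclideanLin (s • (y - x) - t • x) + t • b := by
      simp only [hv, he, map_sub, map_smul]; module
    rw [e1]
    exact hS _ _
  have hnorm : ∀ s t : ℝ, ‖s • v + t • e‖ ^ 2 = s ^ 2 * ‖v‖ ^ 2 + t ^ 2 * ‖e‖ ^ 2 := by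
    intro s t
    rw [norm_add_sq_real, inner_smul_left, inner_smul_right, real_inner_comm, hve, norm_smul,
      norm_smul, mul_pow, mul_pow, Real.norm_eq_abs, Real.norm_eq_abs, sq_abs, sq_abs]
    simp
  have hSS : inner ℝ (S e) (S v) = ‖S v‖ ^ 2 := by
    have h1 : A.toEuclideanLin y - b = v - e := by simp only [hv, he, map_sub]; abel
    have h2 := hy (y - x)
    rw [h1, map_sub, inner_sub_left, real_inner_self_eq_norm_sq] at h2
    linarith
  have hnormS : ∀ s t : ℝ, ‖S (s • v + t • e)‖ ^ 2 =
      s ^ 2 * ‖S v‖ ^ 2 + 2 * (s * t) * ‖S v‖ ^ 2 + t ^ 2 * ‖S e‖ ^ 2 := by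
    intro s t
    rw [map_add, map_smul, map_smul, norm_add_sq_real, inner_smul_left, inner_smul_right,
      real_inner_comm, hSS, norm_smul, norm_smul, mul_pow, mul_pow, Real.norm_eq_abs,
      Real.norm_eq_abs, sq_abs, sq_abs]
    simp; ring
  simp only [hnorm, hnormS] at hS1
  have hv1 := (abs_le.mp (hS1 1 0)).1
  have hlow : (1 - δ) * ‖v‖ ^ 2 ≤ ρ * ‖S v‖ ^ 2 := by nlinarith
  have hcross : ∀ t : ℝ, 0 ≤ t → t * ‖v‖ ^ 2 ≤ δ * (‖v‖ ^ 2 + t ^ 2 * ‖e‖ ^ 2) := by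
    intro t ht
    have h1 := (abs_le.mp (hS1 1 t)).2
    have h2 := (abs_le.mp (hS1 1 (-t))).1
    have h3 : t * (‖v‖ ^ 2 / 2) ≤ t * (ρ * ‖S v‖ ^ 2) := by
      refine mul_le_mul_of_nonneg_left (le_trans ?_ hlow) ht
      nlinarith [sq_nonneg ‖v‖]
    nlinarith
  have hvn := norm_nonneg v
  rcases (norm_nonneg e).eq_or_lt with he0 | he0
  · rw [← he0, mul_zero]
    -- With `e = 0` this reads `‖v‖² ≤ δ‖v‖²`, which forces `v = 0`.
    have := hcross 1 zero_le_one
    rw [← he0] at this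
    by_contra! h
    nlinarith [mul_pos h h]
  · rcases hvn.eq_or_lt with hv0 | hv0
    · rw [← hv0]; positivity
    have := hcross (‖v‖ / ‖e‖) (by positivity)
    have h1 : (‖v‖ / ‖e‖) ^ 2 * ‖e‖ ^ 2 = ‖v‖ ^ 2 := by field_simp
    rw [h1, div_mul_eq_mul_div, div_le_iff₀ he0] at this
    have h2 : ‖v‖ ^ 2 * ‖v‖ ≤ ‖v‖ ^ 2 * (2 * δ * ‖e‖) := by linarith
    exact le_of_mul_le_mul_left h2 (by positivity)

/-- The solution of a sketched problem is accurate, if the sketch is a subspace embedding of the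
span of the columns of `A` and `b`. -/
theorem sketched_solution_accurate {ε ρ : ℝ} (hε : 0 < ε) (hε1 : ε < 1) (hd : 0 < d)
    (hA : A.rank = d) {F : Type*} [NormedAddCommGroup F] [InnerProductSpace ℝ F]
    (S : EuclideanSpace ℝ (Fin n) →ₗ[ℝ] F)
    (hS : ∀ (u : EuclideanSpace ℝ (Fin d)) (c : ℝ),
      |ρ * ‖S (A.toEuclideanLin u + c • b)‖ ^ 2 - ‖A.toEuclideanLin u + c • b‖ ^ 2| ≤
        √ε / 2 * ‖A.toEuclideanLin u + c • b‖ ^ 2)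
    {x y : EuclideanSpace ℝ (Fin d)} (hx : IsMinimizer A b x)
    (hy : ∀ u, inner ℝ (S (A.toEuclideanLin y - b)) (S (A.toEuclideanLin u)) = 0) :
    ‖A.toEuclideanLin y - b‖ ≤ (1 + ε) * optValue A b ∧
      (0 < colSpaceFraction A b → ‖x - y‖ ≤ √ε * (condNumber A *
        √((colSpaceFraction A b)⁻¹ ^ 2 - 1)) * ‖x‖) := by
  have hs1 : √ε ≤ 1 := by rw [Real.sqrt_le_one]; exact hε1.le
  have hmain := norm_toEuclideanLin_sub_le (by positivity) (by linarith) S hS hx hy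
  rw [mul_div_cancel₀ _ two_ne_zero] at hmain
  rw [hx.optValue_eq, hx.colSpaceFraction_eq]
  set e := b - A.toEuclideanLin x with he
  constructor
  · have h1 : A.toEuclideanLin y - b = A.toEuclideanLin (y - x) - e := by
      rw [he, map_sub]; abel
    -- Pythagoras bounds the square by `(1 + ε)‖e‖²`, and `1 + ε ≤ (1 + ε)²`.
    refine le_of_sq_le_sq ?_ (by positivity)
    rw [h1, norm_sub_sq_real, real_inner_comm, hx.inner_eq_zero]
    have h2 : ‖A.toEuclideanLin (y - x)‖ ^ 2 ≤ ε * ‖e‖ ^ 2 := by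
      calc _ ≤ (√ε * ‖e‖) ^ 2 := by gcongr
        _ = _ := by rw [mul_pow, Real.sq_sqrt hε.le]
    nlinarith [sq_nonneg ‖e‖, mul_nonneg hε.le (sq_nonneg ‖e‖),
      mul_nonneg (sq_nonneg ε) (sq_nonneg ‖e‖)]
  · intro hγ
    have hAx : 0 < ‖A.toEuclideanLin x‖ := by
      by_contra! h
      rw [le_antisymm h (norm_nonneg _), zero_div] at hγ
      exact hγ.false
    have hb := hx.norm_sq_eq
    -- Since `‖b‖² = ‖Ax‖² + ‖e‖²`, the root is the tangent of the angle between `b` and the column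
    -- space.
    have hroot : √((‖A.toEuclideanLin x‖ / ‖b‖)⁻¹ ^ 2 - 1) = ‖e‖ / ‖A.toEuclideanLin x‖ := by
      rw [inv_div, div_pow, hb, add_div, div_self (by positivity), add_sub_cancel_left, ← div_pow,
        Real.sqrt_sq (by positivity)]
    rw [hroot, condNumber]
    set σ := A.toEuclideanLin.singularValues (A.rank - 1) with hσ
    have hσ0 : 0 < σ := by
      rw [hσ, LinearMap.singularValues_pos_iff_lt_finrank_range, finrank_range_toEuclideanLin, hA]
      omega
    have h1 : σ * ‖y - x‖ ≤ ‖A.toEuclideanLin (y - x)‖ := by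
      have := A.toEuclideanLin.singularValues_last_mul_le_norm (y - x)
      rw [finrank_euclideanSpace_fin] at this
      rwa [hσ, hA]
    have h2 := A.toEuclideanLin.norm_le_singularValues_zero_mul x
    set τ := A.toEuclideanLin.singularValues 0
    rw [norm_sub_rev]
    have h3 : ‖y - x‖ ≤ √ε * ‖e‖ / σ := by
      rw [le_div_iff₀ hσ0, mul_comm]; exact h1.trans hmain
    refine h3.trans ?_
    have h4 : √ε * (τ / σ * (‖e‖ / ‖A.toEuclideanLin x‖)) * ‖x‖ =
        √ε * ‖e‖ / σ * (τ * ‖x‖ / ‖A.toEuclideanLin x‖) := by ring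
    rw [h4]
    refine le_mul_of_one_le_right (by positivity) ?_
    rwa [one_le_div hAx]

end LeastSquares

/-! ## Reasoning about programs of the real random access machine -/

namespace RealRAM

namespace State

variable (s : State) (r r' v a : ℕ) (x : Cell) (z : ℝ)

@[simp] theorem setReg_reg : (s.setReg r v).reg r' = if r' = r then v else s.reg r' := by
  simp [setReg, Function.update_apply]

@[simp] theorem setReg_reals : (s.setReg r v).reals = s.reals := rfl

@[simp] theorem setReg_coins : (s.setReg r v).coins = s.coins := rfl

@[simp] theorem setReal_reg : (s.setReal x z).reg = s.reg := rfl

@[simp] theorem setReal_reals : (s.setReal x z).reals a =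
    if a = x.arr then Function.update (s.reals a) (s.reg x.idx) z else s.reals a := by
  by_cases h : a = x.arr
  · subst h; simp [setReal]
  · simp [setReal, h]

@[simp] theorem setReal_coins : (s.setReal x z).coins = s.coins := rfl

@[simp] theorem setNat_reg : (s.setNat x v).reg = s.reg := rfl

@[simp] theorem setNat_reals : (s.setNat x v).reals = s.reals := rfl

@[simp] theorem setNat_coins : (s.setNat x v).coins = s.coins := rfl

end State

/-- The registers that an instruction may change. -/
def Instr.wregs : Instr → List ℕ
  | .natConst r _ | .natAdd r _ _ | .natSub r _ _ | .natLoad r _ | .coin r => [r]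
  | _ => []

/-- The real arrays that an instruction may change. -/
def Instr.warrs : Instr → List ℕ
  | .realConst x _ | .realCopy x _ | .realOp _ x _ _ => [x.arr]
  | _ => []

def Instr.tosses : Instr → Bool
  | .coin _ => true
  | _ => false

/-- The registers that a program may change. -/
def Prog.wregs : Prog → List ℕ
  | .skip => []
  | .instr i => i.wregs
  | .seq P Q | .ite _ P Q => P.wregs ++ Q.wregs
  | .loop _ P => P.wregs

/-- The real arrays that a program may change. -/
def Prog.warrs : Prog → List ℕ
  | .skip => []
  | .instr i => i.warrs
  | .seq P Q | .ite _ P Q => P.warrs ++ Q.warrs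
  | .loop _ P => P.warrs

def Prog.tosses : Prog → Bool
  | .skip => false
  | .instr i => i.tosses
  | .seq P Q | .ite _ P Q => P.tosses || Q.tosses
  | .loop _ P => P.tosses

/-- What a run of `P` from `s` to `s'` certainly leaves unchanged. -/
structure Frame (P : Prog) (s s' : State) : Prop where
  reg : ∀ r, r ∉ P.wregs → s'.reg r = s.reg r
  arr : ∀ a, a ∉ P.warrs → s'.reals a = s.reals a
  coins : P.tosses = false → s'.coins = s.coins

theorem Frame.refl (P : Prog) (s : State) : Frame P s s :=
  ⟨fun _ _ => rfl, fun _ _ => rfl, fun _ => rfl⟩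

theorem Frame.trans {P : Prog} {s₁ s₂ s₃ : State} (h : Frame P s₁ s₂) (h' : Frame P s₂ s₃) :
    Frame P s₁ s₃ :=
  ⟨fun r hr => (h'.reg r hr).trans (h.reg r hr), fun a ha => (h'.arr a ha).trans (h.arr a ha),
    fun ht => (h'.coins ht).trans (h.coins ht)⟩

theorem Frame.mono {P Q : Prog} {s s' : State} (h : Frame P s s') (h₁ : P.wregs ⊆ Q.wregs)
    (h₂ : P.warrs ⊆ Q.warrs) (h₃ : Q.tosses = false → P.tosses = false) : Frame Q s s' :=
  ⟨fun r hr => h.reg r fun h' => hr (h₁ h'), fun a ha => h.arr a fun h' => ha (h₂ h'),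
    fun ht => h.coins (h₃ ht)⟩

theorem Instr.frame (ω : ℕ → Bool) (i : Instr) (s : State) : Frame (.instr i) s (i.eval ω s) := by
  constructor
  · intro r hr
    cases i <;> simp_all [Prog.wregs, Instr.wregs, Instr.eval]
  · intro a ha
    cases i <;> simp_all [Prog.warrs, Instr.warrs, Instr.eval]
  · intro ht
    cases i <;> simp_all [Prog.tosses, Instr.tosses, Instr.eval]

/-- The sets of written registers and arrays are syntactic over-approximations, so for concrete
programs the side condition "not written" is list membership, settled by `decide`. -/
theorem Exec.frame {ω : ℕ → Bool} {P : Prog} {s s' : State} {t : ℕ} (h : Exec ω P s s' t) :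
    Frame P s s' := by
  induction h with
  | skip s => exact Frame.refl _ _
  | instr i s => exact i.frame ω s
  | @seq P Q _ _ _ _ _ _ _ ih₁ ih₂ =>
    have h₁ := ih₁.mono (Q := .seq P Q) (List.subset_append_left _ _)
      (List.subset_append_left _ _) (by intro h; exact (Bool.or_eq_false_iff.mp h).1)
    exact h₁.trans (ih₂.mono (List.subset_append_right _ _) (List.subset_append_right _ _)
        (by intro h; exact (Bool.or_eq_false_iff.mp h).2))
  | iteTrue _ _ ih =>
    exact ih.mono (List.subset_append_left _ _) (List.subset_append_left _ _)
      (by intro h; exact (Bool.or_eq_false_iff.mp h).1)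
  | iteFalse _ _ ih =>
    exact ih.mono (List.subset_append_right _ _) (List.subset_append_right _ _)
      (by intro h; exact (Bool.or_eq_false_iff.mp h).2)
  | loopTrue _ _ _ ih₁ ih₂ => exact Frame.trans ⟨ih₁.reg, ih₁.arr, ih₁.coins⟩ ih₂
  | loopFalse _ => exact Frame.refl _ _

/-- With coin tosses `ω`, the program `P` started in `s` halts within `T` steps, in a state that
satisfies `Q`. -/
def Spec (ω : ℕ → Bool) (P : Prog) (s : State) (Q : State → Prop) (T : ℕ) : Prop :=
  ∃ s' t, Exec ω P s s' t ∧ t ≤ T ∧ Q s'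

namespace Spec

variable {ω : ℕ → Bool} {P P' : Prog} {s : State} {Q Q' R : State → Prop} {T T' : ℕ}

theorem mono (h : Spec ω P s Q T) (hT : T ≤ T') (hQ : ∀ s', Frame P s s' → Q s' → Q' s') :
    Spec ω P s Q' T' := by
  obtain ⟨s', t, he, ht, hq⟩ := h
  exact ⟨s', t, he, ht.trans hT, hQ s' he.frame hq⟩

theorem seq (h : Spec ω P s R T) (h' : ∀ s', Frame P s s' → R s' → Spec ω P' s' Q T') :
    Spec ω (.seq P P') s Q (T + T') := by
  obtain ⟨s₁, t₁, he₁, ht₁, hr⟩ := h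
  obtain ⟨s₂, t₂, he₂, ht₂, hq⟩ := h' s₁ he₁.frame hr
  exact ⟨s₂, t₁ + t₂, .seq he₁ he₂, by omega, hq⟩

theorem skip (h : Q s) : Spec ω .skip s Q 1 := ⟨s, 1, .skip s, le_rfl, h⟩

theorem instr {i : Instr} (h : Q (i.eval ω s)) : Spec ω (.instr i) s Q 1 :=
  ⟨_, 1, .instr i s, le_rfl, h⟩

theorem ite {c : Test} (h : c.Holds s → Spec ω P s Q T) (h' : ¬ c.Holds s → Spec ω P' s Q T) :
    Spec ω (.ite c P P') s Q (T + 1) := by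
  by_cases hc : c.Holds s
  · obtain ⟨s', t, he, ht, hq⟩ := h hc
    exact ⟨s', t + 1, .iteTrue hc he, by omega, hq⟩
  · obtain ⟨s', t, he, ht, hq⟩ := h' hc
    exact ⟨s', t + 1, .iteFalse hc he, by omega, hq⟩

/-- Induction on the number of remaining rounds. The time bound may vary with the round, as the
geometrically shrinking rounds of `halvingLoop` require. Each step also receives the frame relative
to the start, so unchanged data stay out of the invariant. -/
theorem loop_sum {c : Test} (n : ℕ) (T : ℕ → ℕ) (Inv : ℕ → State → Prop) (h0 : Inv 0 s)
    (hstep : ∀ k < n, ∀ s', Frame P s s' → Inv k s' →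
      c.Holds s' ∧ Spec ω P s' (Inv (k + 1)) (T k))
    (hend : ∀ s', Frame P s s' → Inv n s' → ¬ c.Holds s') :
    Spec ω (.loop c P) s (Inv n) (∑ k ∈ Finset.range n, (T k + 1) + 1) := by
  have key : ∀ m ≤ n, ∀ s', Frame P s s' → Inv (n - m) s' →
      Spec ω (.loop c P) s' (Inv n) (∑ k ∈ Finset.Ico (n - m) n, (T k + 1) + 1) := by
    intro m
    induction m with
    | zero =>
      intro _ s' hf hI
      exact ⟨s', 1, .loopFalse (hend s' hf hI), by simp, hI⟩
    | succ m ih =>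
      intro hm s' hf hI
      obtain ⟨hc, s₁, t₁, he₁, ht₁, hI₁⟩ := hstep _ (by omega) s' hf hI
      rw [show n - (m + 1) + 1 = n - m by omega] at hI₁
      obtain ⟨s₂, t₂, he₂, ht₂, hI₂⟩ := ih (by omega) s₁ (hf.trans he₁.frame) hI₁
      refine ⟨s₂, t₁ + t₂ + 1, .loopTrue hc he₁ he₂, ?_, hI₂⟩
      rw [Finset.sum_eq_sum_Ico_succ_bot (by omega), show n - (m + 1) + 1 = n - m by omega]
      omega
  have := key n le_rfl s (Frame.refl _ _) (by rwa [Nat.sub_self])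
  rwa [Nat.sub_self, Nat.Ico_zero_eq_range] at this

theorem loop {c : Test} (n T : ℕ) (Inv : ℕ → State → Prop) (h0 : Inv 0 s)
    (hstep : ∀ k < n, ∀ s', Frame P s s' → Inv k s' → c.Holds s' ∧ Spec ω P s' (Inv (k + 1)) T)
    (hend : ∀ s', Frame P s s' → Inv n s' → ¬ c.Holds s') :
    Spec ω (.loop c P) s (Inv n) (n * (T + 1) + 1) := by
  have := loop_sum n (fun _ => T) Inv h0 hstep hend
  rwa [Finset.sum_const, Finset.card_range, smul_eq_mul] at this

end Spec

/-- Straight-line code. -/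
def block : List Instr → Prog
  | [] => .skip
  | i :: l => .seq (.instr i) (block l)

/-- The effect of straight-line code. -/
noncomputable def evalBlock (ω : ℕ → Bool) : List Instr → State → State
  | [], s => s
  | i :: l, s => evalBlock ω l (i.eval ω s)

theorem Spec.block {ω : ℕ → Bool} {l : List Instr} {s : State} {Q : State → Prop}
    (h : Q (evalBlock ω l s)) : Spec ω (block l) s Q (l.length + 1) := by
  induction l generalizing s with
  | nil => exact Spec.skip h
  | cons i l ih =>
    have := Spec.seq (P' := RealRAM.block l) (R := fun s' => s' = i.eval ω s)
      (Spec.instr (ω := ω) (i := i) (s := s) rfl)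
      (fun s' _ hs => by subst hs; exact ih h)
    rw [List.length_cons]
    exact this.mono (by omega) fun _ _ h => h

/-- The array `f` holds the matrix `Y` row by row, with rows of length `w`. -/
def IsMat (f : ℕ → ℝ) (w : ℕ) (Y : ℕ → ℕ → ℝ) : Prop := ∀ i j, j < w → f (i * w + j) = Y i j

theorem mul_add_eq_iff {w i i' j j' : ℕ} (hj : j < w) (hj' : j' < w) :
    i' * w + j' = i * w + j ↔ i' = i ∧ j' = j := by
  constructor
  · intro h
    have h1 := congrArg (· / w) h

    have hw : 0 < w := by omega
    simp only [Nat.mul_comm _ w, Nat.mul_add_div hw, Nat.div_eq_of_lt hj, Nat.div_eq_of_lt hj',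
      add_zero] at h1
    subst h1
    exact ⟨rfl, by omega⟩
  · rintro ⟨rfl, rfl⟩; rfl

/-- Row-major indexing is injective for columns below `w`, so one write changes exactly one matrix
entry. -/
theorem IsMat.update {f : ℕ → ℝ} {w : ℕ} {Y : ℕ → ℕ → ℝ} (h : IsMat f w Y) {i j : ℕ} (hj : j < w)
    {e : ℕ} (he : e = i * w + j) (v : ℝ) {Y' : ℕ → ℕ → ℝ} (hv : Y' i j = v)
    (hY : ∀ i' j', j' < w → ¬ (i' = i ∧ j' = j) → Y' i' j' = Y i' j') :
    IsMat (Function.update f e v) w Y' := by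
  intro i' j' hj'
  by_cases hc : i' = i ∧ j' = j
  · rw [hc.1, hc.2, ← he, Function.update_self, hv]
  · rw [Function.update_of_ne (fun h' => hc ((mul_add_eq_iff hj hj').mp (h'.trans he))),
      h i' j' hj', hY i' j' hj' hc]

theorem IsMat.congr {f : ℕ → ℝ} {w : ℕ} {Y Y' : ℕ → ℕ → ℝ} (h : IsMat f w Y)
    (hY : ∀ i j, j < w → Y i j = Y' i j) : IsMat f w Y' :=
  fun i j hj => (h i j hj).trans (hY i j hj)

end RealRAM

/-! ## Initialization of the parameters -/

namespace RealRAM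

/-- The cell `0` of the array `a`, provided that the register `3` contains zero. -/
def scalar (a : ℕ) : Cell := ⟨a, 3⟩

/-- Squares the register `1` into the register `5`, and adds it to the scalar `11`. -/
def squareLoop : Prog :=
  .loop (.natLt 9 1) (block [.natAdd 5 5 1,
    .realOp .add (scalar 11) (scalar 11) (scalar 10), .natAdd 9 9 2])

/-- The machine neither multiplies naturals nor converts them to reals; `d` rounds of additions
yield the natural `d * d` and the real `d` together. -/
theorem squareLoop_spec (ω : ℕ → Bool) (s : State) {d : ℕ} (h1 : s.reg 1 = d) (h2 : s.reg 2 = 1)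
    (h3 : s.reg 3 = 0) (h5 : s.reg 5 = 0) (h9 : s.reg 9 = 0) (h10 : s.reals 10 0 = 1) :
    Spec ω squareLoop s (fun s' => s'.reg 5 = d * d ∧ s'.reals 11 0 = s.reals 11 0 + d)
      (d * 5 + 1) := by
  refine (Spec.loop d 4 (fun k s' => s'.reg 9 = k ∧ s'.reg 5 = k * d ∧
    s'.reals 11 0 = s.reals 11 0 + k) (by simp [h5, h9]) ?_ ?_).mono (by omega)
    fun s' _ h => h.2
  · rintro k hk s' hf ⟨a9, a5, a11⟩
    have f1 := hf.reg 1 (by decide)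
    have f2 := hf.reg 2 (by decide)
    have f3 := hf.reg 3 (by decide)
    have f10 := hf.arr 10 (by decide)
    refine ⟨by simp [Test.Holds, f1, h1, a9, hk], Spec.block ?_⟩
    simp [evalBlock, Instr.eval, State.getReal, FieldOp.eval, scalar, f1, f2, f3, f10, h1, h2, h3,
      h10, a9, a5, a11, add_mul, add_assoc]
  · rintro s' hf ⟨a9, -⟩
    have f1 := hf.reg 1 (by decide)
    simp [Test.Holds, f1, h1, a9]

/-- Doubles the register `r` until it is at least the register `t`, and performs the operation
`x := x + y` in each round. -/
def doubleLoop (r t : ℕ) (x y : Cell) : Prog :=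
  .loop (.natLt r t) (block [.natAdd r r r, .realOp .add x x y])

/-- `2 ^ k < v` holds exactly for `k < Nat.clog 2 v`, so the number of rounds is the logarithm,
which the added ones record as a real. -/
theorem doubleLoop_spec_add (ω : ℕ → Bool) (s : State) {r t a v : ℕ} (ht : s.reg t = v)
    (hr : s.reg r = 1) (h3 : s.reg 3 = 0) (h10 : s.reals 10 0 = 1) (hrt : t ≠ r) (hr3 : r ≠ 3)
    (ha : a ≠ 10) :
    Spec ω (doubleLoop r t (scalar a) (scalar 10)) s (fun s' => s'.reg r = 2 ^ Nat.clog 2 v ∧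
      s'.reals a 0 = s.reals a 0 + Nat.clog 2 v) (Nat.clog 2 v * 4 + 1) := by
  have hw : (block [.natAdd r r r, .realOp .add (scalar a) (scalar a) (scalar 10)]).wregs = [r] :=
    rfl
  have hw' : (block [.natAdd r r r, .realOp .add (scalar a) (scalar a) (scalar 10)]).warrs = [a] :=
    rfl
  refine (Spec.loop (Nat.clog 2 v) 3 (fun k s' => s'.reg r = 2 ^ k ∧
    s'.reals a 0 = s.reals a 0 + k) (by simp [hr]) ?_ ?_)
  · rintro k hk s' hf ⟨a9, a11⟩
    have f1 := hf.reg t (by simp [hw, hrt])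
    have f3 := hf.reg 3 (by simp [hw, hr3.symm])
    have f10 := hf.arr 10 (by simp [hw', ha.symm])
    refine ⟨?_, Spec.block ?_⟩
    · simp only [Test.Holds, f1, ht, a9]
      exact (Nat.lt_clog_iff_pow_lt (by norm_num)).mp hk
    · simp [evalBlock, Instr.eval, State.getReal, FieldOp.eval, scalar, f3, f10, h3, h10, a9, a11,
        hr3.symm, pow_succ, add_assoc, mul_two]
  · rintro s' hf ⟨a9, -⟩
    have f1 := hf.reg t (by simp [hw, hrt])
    simp only [Test.Holds, f1, ht, a9, not_lt]
    exact Nat.le_pow_clog (by norm_num) v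

/-- Adding the scalar to itself makes it a real copy of the power of two. -/
theorem doubleLoop_spec_double (ω : ℕ → Bool) (s : State) {r t a v : ℕ} (ht : s.reg t = v)
    (hr : s.reg r = 1) (h3 : s.reg 3 = 0) (hrt : t ≠ r) (hr3 : r ≠ 3) (ha : s.reals a 0 = 1) :
    Spec ω (doubleLoop r t (scalar a) (scalar a)) s (fun s' => s'.reg r = 2 ^ Nat.clog 2 v ∧
      s'.reals a 0 = 2 ^ Nat.clog 2 v) (Nat.clog 2 v * 4 + 1) := by
  have hw : (block [.natAdd r r r, .realOp .add (scalar a) (scalar a) (scalar a)]).wregs = [r] :=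
    rfl
  refine (Spec.loop (Nat.clog 2 v) 3 (fun k s' => s'.reg r = 2 ^ k ∧
    s'.reals a 0 = 2 ^ k) (by simp [hr, ha]) ?_ ?_)
  · rintro k hk s' hf ⟨a9, a11⟩
    have f1 := hf.reg t (by simp [hw, hrt])
    have f3 := hf.reg 3 (by simp [hw, hr3.symm])
    refine ⟨?_, Spec.block ?_⟩
    · simp only [Test.Holds, f1, ht, a9]
      exact (Nat.lt_clog_iff_pow_lt (by norm_num)).mp hk
    · simp [evalBlock, Instr.eval, State.getReal, FieldOp.eval, scalar, f3, h3, a9, a11,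
        hr3.symm, pow_succ, mul_two]
  · rintro s' hf ⟨a9, -⟩
    have f1 := hf.reg t (by simp [hw, hrt])
    simp only [Test.Holds, f1, ht, a9, not_lt]
    exact Nat.le_pow_clog (by norm_num) v

/-- Rounds the register `0` up to a multiple of the register `6`. -/
def roundUpLoop : Prog := .loop (.natLt 8 0) (block [.natAdd 8 8 6])

theorem roundUpLoop_spec (ω : ℕ → Bool) (s : State) {n B : ℕ} (h0 : s.reg 0 = n) (h6 : s.reg 6 = B)
    (hB : 0 < B) (h8 : s.reg 8 = 0) :
    Spec ω roundUpLoop s (fun s' => s'.reg 8 = (n + B - 1) / B * B) ((n + B - 1) / B * 3 + 1) := by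
  refine Spec.loop _ 2 (fun k s' => s'.reg 8 = k * B) (by simp [h8]) ?_ ?_
  · rintro k hk s' hf a8
    have f0 := hf.reg 0 (by decide)
    have f6 := hf.reg 6 (by decide)
    refine ⟨?_, Spec.block ?_⟩
    · simp only [Test.Holds, f0, h0, a8]
      have := (Nat.le_div_iff_mul_le hB).mp (Nat.succ_le_of_lt hk)
      rw [Nat.succ_mul] at this
      omega
    · simp [evalBlock, Instr.eval, f6, h6, a8, add_mul]
  · rintro s' hf a8
    have f0 := hf.reg 0 (by decide)
    simp only [Test.Holds, f0, h0, a8, not_lt]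
    have := Nat.lt_div_mul_add (a := n + B - 1) hB
    omega

/-- The logarithm of the block length. -/
def logBlock (d : ℕ) : ℕ := Nat.clog 2 (d * d)

/-- The number of rows, rounded up to a multiple of the block length. -/
def paddedRows (n d : ℕ) : ℕ := (n + 2 ^ logBlock d - 1) / 2 ^ logBlock d * 2 ^ logBlock d

/-- An upper bound for the factor by which the number of rows may be reduced. -/
noncomputable def reduction (n d : ℕ) (ε : ℝ) : ℝ :=
  2 ^ logBlock d * ε / (16384 * ((4 + Nat.clog 2 (d + 1)) * (5 + d + Nat.clog 2 (paddedRows n d))))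

/-- Computes the parameters of the algorithm. -/
def setup : Prog :=
  .seq (block [.natConst 2 1, .natAdd 4 1 2, .natConst 6 1, .natConst 7 1,
    .realConst (scalar 10) 1, .realConst (scalar 11) 5, .realConst (scalar 12) 4,
    .realConst (scalar 13) 1, .realConst (scalar 14) 16384, .realConst (scalar 16) 2]) <|
  .seq squareLoop <|
  .seq (doubleLoop 6 5 (scalar 13) (scalar 13)) <|
  .seq (doubleLoop 7 4 (scalar 12) (scalar 10)) <|
  .seq roundUpLoop <|
  .seq (block [.natConst 7 1]) <|
  .seq (doubleLoop 7 8 (scalar 11) (scalar 10)) <|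
  block [.realOp .mul (scalar 12) (scalar 12) (scalar 11),
    .realOp .mul (scalar 14) (scalar 14) (scalar 12),
    .realOp .mul (scalar 13) (scalar 13) (scalar 2),
    .realOp .div (scalar 14) (scalar 13) (scalar 14)]

/-- A bound for the running time of `setup`. -/
def setupTime (n d : ℕ) : ℕ :=
  40 + 5 * d + 4 * logBlock d + 4 * Nat.clog 2 (d + 1) +
    3 * ((n + 2 ^ logBlock d - 1) / 2 ^ logBlock d) + 4 * Nat.clog 2 (paddedRows n d)

/-- The memory content that all stages of the algorithm rely on. -/
structure Ready (n d : ℕ) (s : State) : Prop where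
  reg0 : s.reg 0 = n
  reg1 : s.reg 1 = d
  reg2 : s.reg 2 = 1
  reg3 : s.reg 3 = 0
  reg4 : s.reg 4 = d + 1
  reg6 : s.reg 6 = 2 ^ logBlock d
  one : s.reals 10 0 = 1
  two : s.reals 16 0 = 2

theorem Ready.of_frame {n d : ℕ} {s s' : State} {P : Prog} (h : Ready n d s) (hf : Frame P s s')
    (h1 : ∀ r ∈ [0, 1, 2, 3, 4, 6], r ∉ P.wregs) (h2 : ∀ a ∈ [10, 16], a ∉ P.warrs) :
    Ready n d s' where
  reg0 := by rw [hf.reg 0 (h1 0 (by simp)), h.reg0]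
  reg1 := by rw [hf.reg 1 (h1 1 (by simp)), h.reg1]
  reg2 := by rw [hf.reg 2 (h1 2 (by simp)), h.reg2]
  reg3 := by rw [hf.reg 3 (h1 3 (by simp)), h.reg3]
  reg4 := by rw [hf.reg 4 (h1 4 (by simp)), h.reg4]
  reg6 := by rw [hf.reg 6 (h1 6 (by simp)), h.reg6]
  one := by rw [hf.arr 10 (h2 10 (by simp)), h.one]
  two := by rw [hf.arr 16 (h2 16 (by simp)), h.two]

theorem setup_spec (ω : ℕ → Bool) (s : State) {n d : ℕ} {ε : ℝ} (h0 : s.reg 0 = n)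
    (h1 : s.reg 1 = d) (hr : ∀ r, 2 ≤ r → s.reg r = 0) (hε : s.reals 2 0 = ε) :
    Spec ω setup s (fun s' => Ready n d s' ∧ s'.reg 8 = paddedRows n d ∧
      s'.reals 14 0 = reduction n d ε) (setupTime n d) := by
  have h3 := hr 3 (by norm_num)
  have H : Spec ω setup s (fun s' => Ready n d s' ∧ s'.reg 8 = paddedRows n d ∧
      s'.reals 14 0 = reduction n d ε) (11 + ((d * 5 + 1) + ((logBlock d * 4 + 1) +
      ((Nat.clog 2 (d + 1) * 4 + 1) + ((n + 2 ^ logBlock d - 1) / 2 ^ logBlock d * 3 + 1 + (2 +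
      (Nat.clog 2 (paddedRows n d) * 4 + 1 + 5))))))) := by
    refine Spec.seq (Spec.block (Q := fun s' => s'.reg 0 = n ∧ s'.reg 1 = d ∧ s'.reg 2 = 1 ∧
      s'.reg 3 = 0 ∧ s'.reg 4 = d + 1 ∧ s'.reg 5 = 0 ∧ s'.reg 6 = 1 ∧ s'.reg 7 = 1 ∧
      s'.reg 8 = 0 ∧ s'.reg 9 = 0 ∧ s'.reals 2 0 = ε ∧ s'.reals 10 0 = 1 ∧ s'.reals 11 0 = 5 ∧
      s'.reals 12 0 = 4 ∧ s'.reals 13 0 = 1 ∧ s'.reals 14 0 = 16384 ∧ s'.reals 16 0 = 2) ?_) ?_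
    · simp [evalBlock, Instr.eval, scalar, h0, h1, hε, h3, hr 5, hr 8, hr 9]
    clear hr h0 h1 hε h3
    rintro s - ⟨h0, h1, h2, h3, h4, h5, h6, h7, h8, h9, r2, r10, r11, r12, r13, r14, r16⟩
    refine Spec.seq (squareLoop_spec ω s h1 h2 h3 h5 h9 r10) ?_
    rintro s₁ f ⟨b5, b11⟩
    rw [← f.reg 0 (by decide)] at h0
    rw [← f.reg 1 (by decide)] at h1
    rw [← f.reg 2 (by decide)] at h2
    rw [← f.reg 3 (by decide)] at h3
    rw [← f.reg 4 (by decide)] at h4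
    rw [← f.reg 6 (by decide)] at h6
    rw [← f.reg 7 (by decide)] at h7
    rw [← f.reg 8 (by decide)] at h8
    rw [← f.arr 2 (by decide)] at r2
    rw [← f.arr 10 (by decide)] at r10
    rw [← f.arr 12 (by decide)] at r12
    rw [← f.arr 13 (by decide)] at r13
    rw [← f.arr 14 (by decide)] at r14
    rw [← f.arr 16 (by decide)] at r16
    rw [r11] at b11
    clear f
    refine Spec.seq (doubleLoop_spec_double ω s₁ b5 h6 h3 (by norm_num) (by norm_num) r13) ?_
    rintro s₂ f ⟨c6, c13⟩
    rw [← f.reg 0 (by decide)] at h0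
    rw [← f.reg 1 (by decide)] at h1
    rw [← f.reg 2 (by decide)] at h2
    rw [← f.reg 3 (by decide)] at h3
    rw [← f.reg 4 (by decide)] at h4
    rw [← f.reg 7 (by decide)] at h7
    rw [← f.reg 8 (by decide)] at h8
    rw [← f.arr 2 (by decide)] at r2
    rw [← f.arr 10 (by decide)] at r10
    rw [← f.arr 11 (by decide)] at b11
    rw [← f.arr 12 (by decide)] at r12
    rw [← f.arr 14 (by decide)] at r14
    rw [← f.arr 16 (by decide)] at r16
    clear f b5 h6
    refine Spec.seq (doubleLoop_spec_add ω s₂ h4 h7 h3 r10 (by norm_num) (by norm_num)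
      (by norm_num)) ?_
    rintro s₃ f ⟨-, e12⟩
    rw [← f.reg 0 (by decide)] at h0
    rw [← f.reg 1 (by decide)] at h1
    rw [← f.reg 2 (by decide)] at h2
    rw [← f.reg 3 (by decide)] at h3
    rw [← f.reg 4 (by decide)] at h4
    rw [← f.reg 6 (by decide)] at c6
    rw [← f.reg 8 (by decide)] at h8
    rw [← f.arr 2 (by decide)] at r2
    rw [← f.arr 10 (by decide)] at r10
    rw [← f.arr 11 (by decide)] at b11
    rw [← f.arr 13 (by decide)] at c13
    rw [← f.arr 14 (by decide)] at r14
    rw [← f.arr 16 (by decide)] at r16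
    rw [r12] at e12
    clear f h7 r12
    refine Spec.seq (roundUpLoop_spec ω s₃ h0 c6 (by positivity) h8) ?_
    rintro s₄ f g8
    rw [← f.reg 0 (by decide)] at h0
    rw [← f.reg 1 (by decide)] at h1
    rw [← f.reg 2 (by decide)] at h2
    rw [← f.reg 3 (by decide)] at h3
    rw [← f.reg 4 (by decide)] at h4
    rw [← f.reg 6 (by decide)] at c6
    rw [← f.arr 2 (by decide)] at r2
    rw [← f.arr 10 (by decide)] at r10
    rw [← f.arr 11 (by decide)] at b11
    rw [← f.arr 12 (by decide)] at e12
    rw [← f.arr 13 (by decide)] at c13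
    rw [← f.arr 14 (by decide)] at r14
    rw [← f.arr 16 (by decide)] at r16
    clear f h8
    refine Spec.seq (Spec.block (Q := fun s' => s'.reg 7 = 1) (by simp [evalBlock, Instr.eval])) ?_
    rintro s₅ f g7
    rw [← f.reg 0 (by decide)] at h0
    rw [← f.reg 1 (by decide)] at h1
    rw [← f.reg 2 (by decide)] at h2
    rw [← f.reg 3 (by decide)] at h3
    rw [← f.reg 4 (by decide)] at h4
    rw [← f.reg 6 (by decide)] at c6
    rw [← f.reg 8 (by decide)] at g8
    rw [← f.arr 2 (by decide)] at r2
    rw [← f.arr 10 (by decide)] at r10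
    rw [← f.arr 11 (by decide)] at b11
    rw [← f.arr 12 (by decide)] at e12
    rw [← f.arr 13 (by decide)] at c13
    rw [← f.arr 14 (by decide)] at r14
    rw [← f.arr 16 (by decide)] at r16
    clear f
    refine Spec.seq (doubleLoop_spec_add ω s₅ g8 g7 h3 r10 (by norm_num) (by norm_num)
      (by norm_num)) ?_
    rintro s₆ f ⟨-, i11⟩
    rw [← f.reg 0 (by decide)] at h0
    rw [← f.reg 1 (by decide)] at h1
    rw [← f.reg 2 (by decide)] at h2
    rw [← f.reg 3 (by decide)] at h3
    rw [← f.reg 4 (by decide)] at h4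
    rw [← f.reg 6 (by decide)] at c6
    rw [← f.reg 8 (by decide)] at g8
    rw [← f.arr 2 (by decide)] at r2
    rw [← f.arr 10 (by decide)] at r10
    rw [← f.arr 12 (by decide)] at e12
    rw [← f.arr 13 (by decide)] at c13
    rw [← f.arr 14 (by decide)] at r14
    rw [← f.arr 16 (by decide)] at r16
    rw [b11] at i11
    clear f b11
    refine Spec.block ⟨⟨?_, ?_, ?_, ?_, ?_, ?_, ?_, ?_⟩, ?_, ?_⟩ <;>
      simp [evalBlock, Instr.eval, State.getReal, FieldOp.eval, scalar, paddedRows, reduction,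
        logBlock, *]
  refine H.mono ?_ fun _ _ h => h
  simp only [setupTime]
  omega

end RealRAM

/-! ## Copying the input and random signs -/

namespace RealRAM

/-- Copies the rows of `A` and the entries of `b` to the array `4`, as the rows of `[A | b]`. -/
def copyRows : Prog :=
  .seq (block [.natConst 9 0, .natConst 11 0, .natConst 12 0]) <|
  .loop (.natLt 9 0) <|
    .seq (block [.natConst 10 0]) <|
    .seq (.loop (.natLt 10 1) (block [.realCopy ⟨4, 11⟩ ⟨0, 12⟩, .natAdd 10 10 2,
      .natAdd 11 11 2, .natAdd 12 12 2])) <|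
    block [.realCopy ⟨4, 11⟩ ⟨1, 9⟩, .natAdd 11 11 2, .natAdd 9 9 2]

/-- The array `4` starts out zero, so the padding rows need no instructions. -/
theorem copyRows_spec (ω : ℕ → Bool) (s : State) {n d : ℕ} (hs : Ready n d s)
    (h4 : ∀ e, s.reals 4 e = 0) :
    Spec ω copyRows s (fun s' => IsMat (s'.reals 4) (d + 1) fun i j =>
      if i < n then (if j < d then s.reals 0 (i * d + j) else s.reals 1 i) else 0)
      (n * (d * 6 + 8) + 5) := by
  set a := s.reals 0 with ha
  set b := s.reals 1 with hb
  let M : ℕ → ℕ → ℝ := fun i j => if j < d then a (i * d + j) else b i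
  refine (Spec.seq (T' := n * (2 + (d * 6 + 1 + 4) + 1) + 1) (Spec.block (Q := fun s' =>
    s'.reg 9 = 0 ∧ s'.reg 11 = 0 ∧ s'.reg 12 = 0) (by simp [evalBlock, Instr.eval])) ?_).mono
    (by simp only [List.length]; ring_nf; omega) fun _ _ h => h
  rintro s₁ f ⟨h9, h11, h12⟩
  have hs₁ := hs.of_frame f (by decide) (by decide)
  rw [← f.arr 0 (by decide)] at ha
  rw [← f.arr 1 (by decide)] at hb
  rw [← f.arr 4 (by decide)] at h4
  clear f hs
  refine (Spec.loop n _ (fun k s' => s'.reg 9 = k ∧ s'.reg 11 = k * (d + 1) ∧ s'.reg 12 = k * d ∧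
    IsMat (s'.reals 4) (d + 1) fun i j => if i < k then M i j else 0)
    ⟨h9, by simpa using h11, by simpa using h12, fun i j _ => by simp [h4]⟩ ?_ ?_).mono le_rfl
    fun s' _ h => h.2.2.2
  · rintro k hk s₂ f ⟨h9, h11, h12, hM⟩
    have hs₂ := hs₁.of_frame f (by decide) (by decide)
    rw [← f.arr 0 (by decide)] at ha
    rw [← f.arr 1 (by decide)] at hb
    clear f
    refine ⟨by simp [Test.Holds, h9, hs₂.reg0, hk], ?_⟩
    refine Spec.seq (Spec.block (Q := fun s' => s'.reg 10 = 0) (by simp [evalBlock, Instr.eval])) ?_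
    intro s₃ f h10
    have hs₃ := hs₂.of_frame f (by decide) (by decide)
    rw [← f.reg 9 (by decide)] at h9
    rw [← f.reg 11 (by decide)] at h11
    rw [← f.reg 12 (by decide)] at h12
    rw [← f.arr 0 (by decide)] at ha
    rw [← f.arr 1 (by decide)] at hb
    rw [← f.arr 4 (by decide)] at hM
    clear f
    refine Spec.seq (Spec.loop d 5 (fun l s' => s'.reg 10 = l ∧ s'.reg 11 = k * (d + 1) + l ∧
      s'.reg 12 = k * d + l ∧ IsMat (s'.reals 4) (d + 1) fun i j =>
        if i < k ∨ i = k ∧ j < l then M i j else 0) ⟨h10, by simpa using h11, by simpa using h12,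
        by simpa using hM⟩ ?_ ?_) ?_
    · rintro l hl s₄ f ⟨g10, g11, g12, gM⟩
      have hs₄ := hs₃.of_frame f (by decide) (by decide)
      rw [← f.arr 0 (by decide)] at ha
      refine ⟨by simp [Test.Holds, g10, hs₄.reg1, hl], Spec.block ?_⟩
      simp only [evalBlock, Instr.eval, State.setReg_reg, State.setReg_reals, State.setReal_reg,
        State.setReal_reals, State.getReal, g10, g11, g12, hs₄.reg2, ← ha]
      refine ⟨by simp, by simp [add_assoc], by simp [add_assoc], ?_⟩
      refine gM.update (i := k) (j := l) (by omega) rfl _ ?_ ?_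
      · simp [M, hl]
      · intro i' j' _ hne
        have : (i' < k ∨ i' = k ∧ j' < l + 1) ↔ (i' < k ∨ i' = k ∧ j' < l) := by omega
        simp only [this]
    · rintro s₄ f ⟨g10, -⟩
      have hs₄ := hs₃.of_frame f (by decide) (by decide)
      simp [Test.Holds, g10, hs₄.reg1]
    · rintro s₄ f ⟨-, g11, g12, gM⟩
      have hs₄ := hs₃.of_frame f (by decide) (by decide)
      rw [← f.arr 1 (by decide)] at hb
      rw [← f.reg 9 (by decide)] at h9
      refine Spec.block ?_
      simp only [evalBlock, Instr.eval, State.setReg_reg, State.setReg_reals, State.setReal_reg,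
        State.setReal_reals, State.getReal, h9, g11, g12, hs₄.reg2, ← hb]
      refine ⟨by simp, by simp; ring, by simp; ring, ?_⟩
      refine gM.update (i := k) (j := d) (by omega) rfl _ ?_ ?_
      · simp [M]
      · intro i' j' _ hne
        have : i' < k + 1 ↔ (i' < k ∨ i' = k ∧ j' < d) := by omega
        simp only [this]
  · rintro s₂ f ⟨h9, -⟩
    have hs₂ := hs₁.of_frame f (by decide) (by decide)
    simp [Test.Holds, h9, hs₂.reg0]

/-- Multiplies each row of the array `4` by a random sign. -/
def signRows : Prog :=
  .seq (block [.natConst 9 0, .natConst 11 0]) <|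
  .loop (.natLt 9 8) <|
    .seq (block [.coin 7, .natConst 10 0]) <|
    .seq (.ite (.natLt 3 7) (.instr (.realConst (scalar 15) (-1)))
      (.instr (.realConst (scalar 15) 1))) <|
    .seq (.loop (.natLt 10 4) (block [.realOp .mul ⟨4, 11⟩ ⟨4, 11⟩ (scalar 15), .natAdd 10 10 2,
      .natAdd 11 11 2])) <|
    block [.natAdd 9 9 2]

open RademacherVector in
theorem signRows_spec (ω : ℕ → Bool) (s : State) {n d N : ℕ} (hs : Ready n d s) (h8 : s.reg 8 = N)
    (hc : s.coins = 0) {Y : ℕ → ℕ → ℝ} (hY : IsMat (s.reals 4) (d + 1) Y) :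
    Spec ω signRows s (fun s' => s'.reg 11 = N * (d + 1) ∧ s'.coins = N ∧
      IsMat (s'.reals 4) (d + 1) fun i j => if i < N then sgn (ω i) * Y i j else Y i j)
      (N * (d * 5 + 14) + 4) := by
  refine (Spec.seq (T' := N * (3 + (2 + ((d + 1) * 5 + 1 + 2)) + 1) + 1) (Spec.block (Q := fun s' =>
    s'.reg 9 = 0 ∧ s'.reg 11 = 0) (by simp [evalBlock, Instr.eval])) ?_).mono
    (by simp only [List.length]; ring_nf; omega) fun _ _ h => h
  rintro s₁ f ⟨h9, h11⟩
  have hs₁ := hs.of_frame f (by decide) (by decide)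
  rw [← f.arr 4 (by decide)] at hY
  rw [← f.reg 8 (by decide)] at h8
  rw [← f.coins rfl] at hc
  clear f hs
  refine (Spec.loop N _ (fun k s' => s'.reg 9 = k ∧ s'.reg 11 = k * (d + 1) ∧ s'.coins = k ∧
    IsMat (s'.reals 4) (d + 1) fun i j => if i < k then sgn (ω i) * Y i j else Y i j)
    ⟨h9, by simpa using h11, hc, by simpa using hY⟩ ?_ ?_).mono le_rfl
    fun s' _ h => h.2
  · rintro k hk s₂ f ⟨h9, h11, hc, hM⟩
    have hs₂ := hs₁.of_frame f (by decide) (by decide)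
    rw [← f.reg 8 (by decide)] at h8
    clear f
    refine ⟨by simp [Test.Holds, h9, h8, hk], ?_⟩
    refine Spec.seq (Spec.block (Q := fun s' => s'.reg 7 = (ω k).toNat ∧ s'.reg 10 = 0 ∧
      s'.coins = k + 1) (by simp [evalBlock, Instr.eval, State.setReg, hc])) ?_
    rintro s₃ f ⟨h7, h10, hc'⟩
    have hs₃ := hs₂.of_frame f (by decide) (by decide)
    rw [← f.reg 9 (by decide)] at h9
    rw [← f.reg 11 (by decide)] at h11
    rw [← f.arr 4 (by decide)] at hM
    clear f hc
    refine Spec.seq (R := fun s' => s'.reals 15 0 = sgn (ω k)) (T := 2) (Spec.ite (fun hh =>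
      Spec.instr ?_) (fun hh => Spec.instr ?_)) ?_
    · rw [Test.Holds, hs₃.reg3, h7] at hh
      have : ω k = true := by cases h : ω k <;> simp_all
      simp [Instr.eval, scalar, hs₃.reg3, this, sgn]
    · rw [Test.Holds, hs₃.reg3, h7] at hh
      have : ω k = false := by cases h : ω k <;> simp_all
      simp [Instr.eval, scalar, hs₃.reg3, this, sgn]
    intro s₄ f h15
    have hs₄ := hs₃.of_frame f (by decide) (by decide)
    rw [← f.reg 9 (by decide)] at h9
    rw [← f.reg 10 (by decide)] at h10
    rw [← f.reg 11 (by decide)] at h11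
    rw [← f.arr 4 (by decide)] at hM
    rw [← f.coins (by decide)] at hc'
    clear f
    refine Spec.seq (Spec.loop (d + 1) 4 (fun l s' => s'.reg 10 = l ∧
      s'.reg 11 = k * (d + 1) + l ∧ IsMat (s'.reals 4) (d + 1) fun i j =>
        if i < k ∨ i = k ∧ j < l then sgn (ω i) * Y i j else Y i j) ⟨h10, by simpa using h11,
        by simpa using hM⟩ ?_ ?_) ?_
    · rintro l hl s₅ f ⟨g10, g11, gM⟩
      have hs₅ := hs₄.of_frame f (by decide) (by decide)
      rw [← f.arr 15 (by decide)] at h15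
      refine ⟨by simp [Test.Holds, g10, hs₅.reg4, hl], Spec.block ?_⟩
      simp only [evalBlock, Instr.eval, State.setReg_reg, State.setReg_reals, State.setReal_reg,
        State.setReal_reals, State.getReal, g10, g11, hs₅.reg2, hs₅.reg3, h15, FieldOp.eval, scalar]
      refine ⟨by simp, by simp [add_assoc], ?_⟩
      refine gM.update (i := k) (j := l) (by omega) rfl _ ?_ ?_
      · rw [gM k l hl]; simp; ring
      · intro i' j' _ hne
        have : (i' < k ∨ i' = k ∧ j' < l + 1) ↔ (i' < k ∨ i' = k ∧ j' < l) := by omega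
        simp only [this]
    · rintro s₅ f ⟨g10, -⟩
      have hs₅ := hs₄.of_frame f (by decide) (by decide)
      simp [Test.Holds, g10, hs₅.reg4]
    · rintro s₅ f ⟨-, g11, gM⟩
      have hs₅ := hs₄.of_frame f (by decide) (by decide)
      rw [← f.coins (by decide)] at hc'
      rw [← f.reg 9 (by decide)] at h9
      refine Spec.block ?_
      simp only [evalBlock, Instr.eval, State.setReg_reg, State.setReg_reals, State.setReg_coins,
        h9, g11, hs₅.reg2, hc']
      refine ⟨by simp, by simp; ring, trivial, gM.congr fun i j hj => ?_⟩
      have : i < k + 1 ↔ (i < k ∨ i = k ∧ j < d + 1) := by omega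
      simp only [this]
  · rintro s₂ f ⟨h9, -⟩
    rw [← f.reg 8 (by decide)] at h8
    simp [Test.Holds, h9, h8]

end RealRAM

/-! ## The Walsh–Hadamard transform -/

namespace RealRAM

open Sketch

/-- The Walsh–Hadamard transform of the array `4` of length `reg 11`, in blocks of `reg 6` rows. -/
def hadamardLoop : Prog :=
  .seq (block [.natAdd 15 11 3, .natConst 14 1, .natAdd 13 4 3]) <|
  .loop (.natLt 14 6) <|
    .seq (block [.natConst 11 0]) <|
    .seq (.loop (.natLt 11 15) <|
      .seq (block [.natConst 10 0, .natAdd 12 11 13]) <|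
      .seq (.loop (.natLt 10 13) (block [.realOp .add (scalar 17) ⟨4, 11⟩ ⟨4, 12⟩,
        .realOp .sub ⟨4, 12⟩ ⟨4, 11⟩ ⟨4, 12⟩, .realCopy ⟨4, 11⟩ (scalar 17), .natAdd 10 10 2,
        .natAdd 11 11 2, .natAdd 12 12 2])) <|
      block [.natAdd 11 12 3]) <|
    block [.natAdd 14 14 14, .natAdd 13 13 13]

/-- One stage of the transform of a flat array of length `L`. -/
noncomputable def hadBelow (L h : ℕ) (F : ℕ → ℝ) (e : ℕ) : ℝ := if e < L then had h F e else F e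

/-- The stage ignores rows and works on `q` groups of `2H` flat entries. Within a pair the sum waits
in the scalar `17` until the difference is stored, so both results use the old values and the
transform runs in place. -/
theorem hadamardStage_spec (ω : ℕ → Bool) (s : State) {H q : ℕ} (hH : 0 < H)
    (h2 : s.reg 2 = 1) (h3 : s.reg 3 = 0) (h11 : s.reg 11 = 0) (h13 : s.reg 13 = H)
    (h15 : s.reg 15 = 2 * H * q) :
    Spec ω (.loop (.natLt 11 15) <|
      .seq (block [.natConst 10 0, .natAdd 12 11 13]) <|
      .seq (.loop (.natLt 10 13) (block [.realOp .add (scalar 17) ⟨4, 11⟩ ⟨4, 12⟩,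
        .realOp .sub ⟨4, 12⟩ ⟨4, 11⟩ ⟨4, 12⟩, .realCopy ⟨4, 11⟩ (scalar 17), .natAdd 10 10 2,
        .natAdd 11 11 2, .natAdd 12 12 2])) <|
      block [.natAdd 11 12 3]) s
      (fun s' => ∀ e, s'.reals 4 e = hadBelow (2 * H * q) H (s.reals 4) e)
      (q * (H * 8 + 7) + 1) := by
  set F := s.reals 4 with hF
  refine (Spec.loop q (3 + (H * 8 + 1 + 2)) (fun g s' => s'.reg 11 = 2 * H * g ∧
    ∀ e, s'.reals 4 e = if e < 2 * H * g then had H F e else F e)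
    ⟨by simpa using h11, fun e => by simp [hF]⟩ ?_ ?_).mono (by ring_nf; omega)
    fun s' _ h => h.2
  · rintro g hg s₁ f ⟨g11, gF⟩
    have hlt : 2 * H * g < 2 * H * q := Nat.mul_lt_mul_of_pos_left hg (by omega)
    rw [← f.reg 2 (by decide)] at h2
    rw [← f.reg 3 (by decide)] at h3
    rw [← f.reg 13 (by decide)] at h13
    rw [← f.reg 15 (by decide)] at h15
    clear f
    refine ⟨by simp [Test.Holds, g11, h15, hlt], ?_⟩
    refine Spec.seq (Spec.block (Q := fun s' => s'.reg 10 = 0 ∧ s'.reg 12 = 2 * H * g + H)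
      (by simp [evalBlock, Instr.eval, g11, h13])) ?_
    rintro s₂ f ⟨h10, h12⟩
    rw [← f.reg 2 (by decide)] at h2
    rw [← f.reg 3 (by decide)] at h3
    rw [← f.reg 11 (by decide)] at g11
    rw [← f.reg 13 (by decide)] at h13
    rw [← f.arr 4 (by decide)] at gF
    clear f
    have he1 : ∀ i < H, (2 * H * g + i) / H % 2 = 0 := by
      intro i hi
      rw [show 2 * H * g + i = i + H * (2 * g) by ring, Nat.add_mul_div_left _ _ hH,
        Nat.div_eq_of_lt hi, zero_add, Nat.mul_mod_right]
    have he2 : ∀ i < H, ¬ (2 * H * g + H + i) / H % 2 = 0 := by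
      intro i hi
      rw [show 2 * H * g + H + i = i + H * (2 * g + 1) by ring, Nat.add_mul_div_left _ _ hH,
        Nat.div_eq_of_lt hi, zero_add]
      omega
    have heq : 2 * H * (g + 1) = 2 * H * g + H + H := by ring
    generalize 2 * H * g = base at *
    refine Spec.seq (Spec.loop H 7 (fun i s' => s'.reg 10 = i ∧ s'.reg 11 = base + i ∧
      s'.reg 12 = base + H + i ∧ ∀ e, s'.reals 4 e =
        if e < base + i ∨ (base + H ≤ e ∧ e < base + H + i) then had H F e else F e)
      ⟨h10, by simpa using g11, by simpa using h12, fun e => ?_⟩ ?_ ?_) ?_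
    · rw [gF]
      have : (e < base + 0 ∨ base + H ≤ e ∧ e < base + H + 0) ↔ e < base := by omega
      simp only [this]
    · rintro i hi s₃ f ⟨k10, k11, k12, kF⟩
      rw [← f.reg 2 (by decide)] at h2
      rw [← f.reg 3 (by decide)] at h3
      rw [← f.reg 13 (by decide)] at h13
      refine ⟨by simp [Test.Holds, k10, h13, hi], Spec.block ?_⟩
      have r1 : s₃.reals 4 (base + i) = F (base + i) := by
        rw [kF, if_neg (by omega)]
      have r2 : s₃.reals 4 (base + H + i) = F (base + H + i) := by
        rw [kF, if_neg (by omega)]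
      simp only [evalBlock, Instr.eval, State.setReg_reg, State.setReg_reals, State.setReal_reg,
        State.setReal_reals, State.getReal, k10, k11, k12, h2, h3, FieldOp.eval, scalar]
      refine ⟨by simp, by simp [add_assoc], by simp [add_assoc], fun e => ?_⟩
      simp only [reduceIte, Nat.reduceEqDiff, r1, r2,
        Function.update_apply]
      by_cases c1 : e = base + i
      · rw [if_pos c1, if_pos (by omega), c1, had, if_pos (he1 i hi)]
        simp [show base + i + H = base + H + i by omega]
      · rw [if_neg c1]
        by_cases c2 : e = base + H + i
        · rw [if_pos c2, if_pos (by omega), c2, had, if_neg (he2 i hi),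
            show base + H + i - H = base + i by omega]
        · rw [if_neg c2, kF]
          have : (e < base + (i + 1) ∨ base + H ≤ e ∧ e < base + H + (i + 1)) ↔
            (e < base + i ∨ base + H ≤ e ∧ e < base + H + i) := by omega
          simp only [this]
    · rintro s₃ f ⟨k10, -⟩
      rw [← f.reg 13 (by decide)] at h13
      simp [Test.Holds, k10, h13]
    · rintro s₃ f ⟨-, -, k12, kF⟩
      rw [← f.reg 3 (by decide)] at h3
      refine Spec.block ?_
      simp only [evalBlock, Instr.eval, State.setReg_reg, State.setReg_reals, k12, h3]
      refine ⟨by simp [heq], fun e => ?_⟩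
      rw [kF, heq]
      have : (e < base + H ∨ base + H ≤ e ∧ e < base + H + H) ↔ e < base + H + H := by omega
      simp only [this]
  · rintro s₁ f ⟨g11, -⟩
    rw [← f.reg 15 (by decide)] at h15
    simp [Test.Holds, g11, h15]

/-- In row-major layout, stride `h` between rows is stride `h * w` in the flat array; entries of the
same column meet. -/
theorem had_row {w h : ℕ} {F : ℕ → ℝ} {Y : ℕ → ℕ → ℝ} {N : ℕ} (hN : 2 * h ∣ N)
    (hF : ∀ f < N, ∀ j < w, F (f * w + j) = Y j f) {f j : ℕ} (hf : f < N) (hj : j < w) :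
    had (h * w) F (f * w + j) = had h (Y j) f := by
  have hw : 0 < w := by omega
  have h1 : (f * w + j) / (h * w) = f / h := by
    rw [mul_comm h w, ← Nat.div_div_eq_div_mul, mul_comm f w, Nat.mul_add_div hw,
      Nat.div_eq_of_lt hj, add_zero]
  rw [had, had, h1]
  split_ifs with h0
  · rw [hF f hf j hj, show f * w + j + h * w = (f + h) * w + j by ring,
      hF _ (lt_of_div_even hN hf h0) j hj]
  · have hle : h ≤ f := by
      by_contra! hlt
      rw [Nat.div_eq_of_lt hlt] at h0; simp at h0
    have : f * w + j - h * w = (f - h) * w + j := by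
      rw [Nat.sub_mul]
      have := Nat.mul_le_mul_right w hle
      omega
    rw [hF f hf j hj, this, hF _ (by omega) j hj]

theorem hadamardLoop_spec (ω : ℕ → Bool) (s : State) {n d N : ℕ} (hs : Ready n d s)
    (hN : 2 ^ logBlock d ∣ N) (h11 : s.reg 11 = N * (d + 1)) {Y : ℕ → ℕ → ℝ}
    (hY : ∀ f < N, ∀ j < d + 1, s.reals 4 (f * (d + 1) + j) = Y j f) :
    Spec ω hadamardLoop s (fun s' => ∀ f < N, ∀ j < d + 1,
      s'.reals 4 (f * (d + 1) + j) = hads (logBlock d) (Y j) f)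
      (logBlock d * (8 * (N * (d + 1)) + 9) + 5) := by
  set β := logBlock d with hβ
  refine (Spec.seq (T' := β * (2 + (8 * (N * (d + 1)) + 1 + 3) + 1) + 1) (Spec.block (Q := fun s' =>
    s'.reg 15 = N * (d + 1) ∧ s'.reg 14 = 1 ∧ s'.reg 13 = d + 1)
    (by simp [evalBlock, Instr.eval, h11, hs.reg3, hs.reg4])) ?_).mono
    (by simp only [List.length]; ring_nf; omega) fun _ _ h => h
  rintro s₁ f ⟨h15, h14, h13⟩
  have hs₁ := hs.of_frame f (by decide) (by decide)
  rw [← f.arr 4 (by decide)] at hY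
  clear f hs h11
  refine (Spec.loop β _ (fun k s' => s'.reg 14 = 2 ^ k ∧ s'.reg 13 = 2 ^ k * (d + 1) ∧
    ∀ f < N, ∀ j < d + 1, s'.reals 4 (f * (d + 1) + j) = hads k (Y j) f)
    ⟨by simpa using h14, by simpa using h13, hY⟩ ?_ ?_).mono le_rfl fun s' _ h => h.2.2
  · rintro k hk s₂ f ⟨g14, g13, gY⟩
    have hs₂ := hs₁.of_frame f (by decide) (by decide)
    rw [← f.reg 15 (by decide)] at h15
    clear f
    have hdvd : 2 * 2 ^ k ∣ N := by
      rw [← pow_succ']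
      exact (Nat.pow_dvd_pow 2 hk).trans hN
    obtain ⟨q, hq⟩ := id hdvd
    have hlen : N * (d + 1) = 2 * (2 ^ k * (d + 1)) * q := by rw [hq]; ring
    refine ⟨?_, ?_⟩
    · simp only [Test.Holds, g14, hs₂.reg6, ← hβ]
      exact Nat.pow_lt_pow_right (by norm_num) hk
    refine Spec.seq (Spec.block (Q := fun s' => s'.reg 11 = 0) (by simp [evalBlock, Instr.eval])) ?_
    intro s₃ f g11
    have hs₃ := hs₂.of_frame f (by decide) (by decide)
    rw [← f.reg 13 (by decide)] at g13
    rw [← f.reg 14 (by decide)] at g14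
    rw [← f.reg 15 (by decide)] at h15
    rw [← f.arr 4 (by decide)] at gY
    clear f
    refine Spec.seq (((hadamardStage_spec ω s₃ (by positivity) hs₃.reg2 hs₃.reg3 g11 g13
      (by rw [h15, hlen]))).mono ?_ fun _ _ h => h) ?_
    · have h1 : 1 ≤ 2 ^ k * (d + 1) := Nat.one_le_iff_ne_zero.mpr (by positivity)
      rw [hlen]
      have h2 : q ≤ 2 ^ k * (d + 1) * q := Nat.le_mul_of_pos_left q h1
      have h3 : q * (2 ^ k * (d + 1) * 8 + 7) = 8 * (2 ^ k * (d + 1) * q) + 7 * q := by ring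
      have h4 : 8 * (2 * (2 ^ k * (d + 1)) * q) = 16 * (2 ^ k * (d + 1) * q) := by ring
      omega
    · intro s₄ f kF
      have hs₄ := hs₃.of_frame f (by decide) (by decide)
      rw [← f.reg 13 (by decide)] at g13
      rw [← f.reg 14 (by decide)] at g14
      clear f
      refine Spec.block ?_
      simp only [evalBlock, Instr.eval, State.setReg_reg, State.setReg_reals, g13, g14]
      refine ⟨by simp [pow_succ, mul_two], by simp [pow_succ]; ring, fun f hf j hj => ?_⟩
      rw [kF, hadBelow, ← hlen, if_pos, hads, had_row hdvd gY hf hj]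
      calc f * (d + 1) + j < f * (d + 1) + (d + 1) := by omega
        _ = (f + 1) * (d + 1) := by ring
        _ ≤ N * (d + 1) := Nat.mul_le_mul_right _ hf
  · rintro s₂ f ⟨g14, -⟩
    have hs₂ := hs₁.of_frame f (by decide) (by decide)
    simp [Test.Holds, g14, hs₂.reg6, hβ]

end RealRAM

/-! ## Random halving of the number of rows -/

namespace RealRAM

open Sketch

/-- Moves a random row of each pair of consecutive rows of the array `4` to the front. -/
def halveRows : Prog :=
  .loop (.natLt 7 8) <|
    .seq (block [.coin 14, .natAdd 12 13 3]) <|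
    .seq (.ite (.natLt 3 14) (.instr (.natAdd 12 12 4)) .skip) <|
    .seq (block [.natConst 10 0]) <|
    .seq (.loop (.natLt 10 4) (block [.realCopy ⟨4, 11⟩ ⟨4, 12⟩, .natAdd 10 10 2, .natAdd 11 11 2,
      .natAdd 12 12 2])) <|
    block [.natAdd 13 13 4, .natAdd 13 13 4, .natAdd 7 7 2, .natAdd 7 7 2, .natAdd 9 9 2]

/-- Row `k` is overwritten by row `2k` or `2k + 1`, neither of which precedes it. Rows still to be
read are therefore intact; only row `0` can be copied onto itself. -/
theorem halveRows_spec (ω : ℕ → Bool) (s : State) {n d r c : ℕ} (hs : Ready n d s)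
    (h8 : s.reg 8 = 2 * r) (hc : s.coins = c) (h7 : s.reg 7 = 0) (h9 : s.reg 9 = 0)
    (h11 : s.reg 11 = 0) (h13 : s.reg 13 = 0) {Y : ℕ → ℕ → ℝ} (hY : IsMat (s.reals 4) (d + 1) Y) :
    Spec ω halveRows s (fun s' => s'.reg 9 = r ∧ s'.coins = c + r ∧
      IsMat (s'.reals 4) (d + 1) fun k j =>
        if k < r then Y (2 * k + (ω (c + k)).toNat) j else Y k j)
      (r * (d * 6 + 22) + 1) := by
  refine (Spec.loop r (3 + (2 + (2 + ((d + 1) * 6 + 1 + 6)))) (fun k s' => s'.reg 7 = 2 * k ∧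
    s'.reg 9 = k ∧ s'.reg 11 = k * (d + 1) ∧
    s'.reg 13 = (2 * k) * (d + 1) ∧ s'.coins = c + k ∧
    IsMat (s'.reals 4) (d + 1) fun i j =>
      if i < k then Y (2 * i + (ω (c + i)).toNat) j else Y i j)
    ⟨by simpa using h7, h9, by simpa using h11, by simpa using h13, by simpa using hc,
      by simpa using hY⟩ ?_ ?_).mono (by ring_nf; omega)
    fun s' _ h => ⟨h.2.1, h.2.2.2.2.1, h.2.2.2.2.2⟩
  · rintro k hk s₂ f ⟨h7, h9, h11, h13, hc, hM⟩
    have hs₂ := hs.of_frame f (by decide) (by decide)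
    rw [← f.reg 8 (by decide)] at h8
    clear f hs hY
    refine ⟨by simp [Test.Holds, h7, h8, hk], ?_⟩
    set t : ℕ := (ω (c + k)).toNat with ht
    have ht1 : t ≤ 1 := Bool.toNat_le _
    refine Spec.seq (Spec.block (Q := fun s' => s'.reg 14 = t ∧ s'.reg 12 = (2 * k) * (d + 1) ∧
      s'.coins = c + (k + 1)) (by
        simp [evalBlock, Instr.eval, State.setReg, hc, ht, h13, hs₂.reg3, add_assoc])) ?_
    rintro s₃ f ⟨h14, h12, hc'⟩
    have hs₃ := hs₂.of_frame f (by decide) (by decide)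
    rw [← f.reg 7 (by decide)] at h7
    rw [← f.reg 9 (by decide)] at h9
    rw [← f.reg 11 (by decide)] at h11
    rw [← f.reg 13 (by decide)] at h13
    rw [← f.arr 4 (by decide)] at hM
    clear f hc
    refine Spec.seq (R := fun s' => s'.reg 12 = (2 * k + t) * (d + 1)) (Spec.ite (T := 1) (fun hh =>
      Spec.instr ?_) (fun hh => Spec.skip ?_)) ?_
    · rw [Test.Holds, hs₃.reg3, h14] at hh
      have : t = 1 := by omega
      simp [Instr.eval, hs₃.reg4, h12, this]; ring
    · rw [Test.Holds, hs₃.reg3, h14] at hh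
      have : t = 0 := by omega
      simp [h12, this]
    intro s₄ f g12
    have hs₄ := hs₃.of_frame f (by decide) (by decide)
    rw [← f.reg 7 (by decide)] at h7
    rw [← f.reg 9 (by decide)] at h9
    rw [← f.reg 11 (by decide)] at h11
    rw [← f.reg 13 (by decide)] at h13
    rw [← f.arr 4 (by decide)] at hM
    rw [← f.coins (by decide)] at hc'
    clear f h14 h12
    refine Spec.seq (Spec.block (Q := fun s' => s'.reg 10 = 0) (by simp [evalBlock, Instr.eval])) ?_
    intro s₅ f h10
    have hs₅ := hs₄.of_frame f (by decide) (by decide)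
    rw [← f.reg 7 (by decide)] at h7
    rw [← f.reg 9 (by decide)] at h9
    rw [← f.reg 11 (by decide)] at h11
    rw [← f.reg 12 (by decide)] at g12
    rw [← f.reg 13 (by decide)] at h13
    rw [← f.arr 4 (by decide)] at hM
    rw [← f.coins (by decide)] at hc'
    clear f
    refine Spec.seq (Spec.loop (d + 1) 5 (fun l s' => s'.reg 10 = l ∧
      s'.reg 11 = k * (d + 1) + l ∧ s'.reg 12 = (2 * k + t) * (d + 1) + l ∧
      IsMat (s'.reals 4) (d + 1) fun i j =>
        if i < k ∨ i = k ∧ j < l then Y (2 * i + (ω (c + i)).toNat) j else Y i j)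
        ⟨h10, by simpa using h11, by simpa using g12, by simpa using hM⟩ ?_ ?_) ?_
    · rintro l hl s₆ f ⟨k10, k11, k12, gM⟩
      have hs₆ := hs₅.of_frame f (by decide) (by decide)
      refine ⟨by simp [Test.Holds, k10, hs₆.reg4, hl], Spec.block ?_⟩
      simp only [evalBlock, Instr.eval, State.setReg_reg, State.setReg_reals, State.setReal_reg,
        State.setReal_reals, State.getReal, k10, k11, k12, hs₆.reg2]
      refine ⟨by simp, by simp [add_assoc], by simp [add_assoc], ?_⟩
      refine gM.update (i := k) (j := l) (by omega) rfl _ ?_ ?_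
      · have := gM (2 * k + t) l hl
        beta_reduce at this ⊢
        rw [this, if_pos (by omega), if_neg (by omega)]
      · intro i' j' _ hne
        have : (i' < k ∨ i' = k ∧ j' < l + 1) ↔ (i' < k ∨ i' = k ∧ j' < l) := by omega
        simp only [this]
    · rintro s₆ f ⟨k10, -⟩
      have hs₆ := hs₅.of_frame f (by decide) (by decide)
      simp [Test.Holds, k10, hs₆.reg4]
    · rintro s₆ f ⟨-, k11, -, gM⟩
      have hs₆ := hs₅.of_frame f (by decide) (by decide)
      rw [← f.coins (by decide)] at hc'
      rw [← f.reg 7 (by decide)] at h7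
      rw [← f.reg 9 (by decide)] at h9
      rw [← f.reg 13 (by decide)] at h13
      refine Spec.block ?_
      simp only [evalBlock, Instr.eval, State.setReg_reg, State.setReg_reals, State.setReg_coins,
        h7, h9, h13, k11, hs₆.reg2, hs₆.reg4, hc']
      refine ⟨by simp; ring, by simp, by simp; ring, by simp; ring, trivial,
        gM.congr fun i j hj => ?_⟩
      have : i < k + 1 ↔ (i < k ∨ i = k ∧ j < d + 1) := by omega
      simp only [this]
  · rintro s₂ f ⟨h7, -⟩
    rw [← f.reg 8 (by decide)] at h8
    simp [Test.Holds, h7, h8]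

/-- Halves the number of rows as long as the scalar `14` exceeds one. -/
def halvingLoop : Prog :=
  .loop (.realLt (scalar 10) (scalar 14)) <|
    .seq (block [.natConst 7 0, .natConst 9 0, .natConst 11 0, .natConst 13 0]) <|
    .seq halveRows <|
    block [.natAdd 8 9 3, .realOp .div (scalar 14) (scalar 14) (scalar 16)]

/-- The real test `1 < θ / 2^k` says `k < Nat.clog 2 ⌈θ⌉₊`, so no rounding to naturals is performed.
The sizes `N / 2^(k+1)` sum to at most `N`, so all rounds together cost no more than one pass plus a
constant per round. -/
theorem halvingLoop_spec (ω : ℕ → Bool) (s : State) {n d N J : ℕ} {θ : ℝ} (hs : Ready n d s)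
    (h8 : s.reg 8 = N) (hc : s.coins = N) (hθ : s.reals 14 0 = θ) (hJ : J = Nat.clog 2 ⌈θ⌉₊)
    (hN : 2 ^ J ∣ N) {β : ℕ} {Y : ℕ → ℕ → ℝ}
    (hY : ∀ k < N, ∀ j < d + 1, s.reals 4 (k * (d + 1) + j) = sketch N β ω 0 (Y j) k) :
    Spec ω halvingLoop s (fun s' => s'.reg 8 = N / 2 ^ J ∧
      ∀ k < N / 2 ^ J, ∀ j < d + 1, s'.reals 4 (k * (d + 1) + j) = sketch N β ω J (Y j) k)
      (N * (d * 6 + 22) + J * 10 + 1) := by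
  have hlt : ∀ k : ℕ, (1 : ℝ) < θ / 2 ^ k ↔ k < J := by
    intro k
    rw [one_lt_div (by positivity), hJ, Nat.lt_clog_iff_pow_lt (by norm_num), Nat.lt_ceil]
    push_cast; rfl
  refine (Spec.loop_sum J (fun k => 5 + (N / 2 ^ (k + 1) * (d * 6 + 22) + 1 + 3)) (fun k s' =>
    s'.reg 8 = N / 2 ^ k ∧ s'.coins = 2 * N - N / 2 ^ k ∧ s'.reals 14 0 = θ / 2 ^ k ∧
    ∀ i < N / 2 ^ k, ∀ j < d + 1, s'.reals 4 (i * (d + 1) + j) = sketch N β ω k (Y j) i)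
    ⟨by simpa using h8, by simp [hc]; omega, by simpa using hθ, by simpa using hY⟩ ?_ ?_).mono ?_
    fun s' _ h => ⟨h.1, h.2.2.2⟩
  · rintro k hk s₁ f ⟨h8, hc, hθ, hM⟩
    have hs₁ := hs.of_frame f (by decide) (by decide)
    clear f
    have e := div_pow_eq_two_mul ((Nat.pow_dvd_pow 2 hk).trans hN)
    have hle : N / 2 ^ k ≤ N := Nat.div_le_self _ _
    refine ⟨?_, ?_⟩
    · simp only [Test.Holds, State.getReal, scalar, hs₁.reg3, hs₁.one, hθ]
      exact (hlt k).mpr hk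
    refine Spec.seq (Spec.block (Q := fun s' => s'.reg 7 = 0 ∧ s'.reg 9 = 0 ∧ s'.reg 11 = 0 ∧
      s'.reg 13 = 0) (by simp [evalBlock, Instr.eval])) ?_
    rintro s₂ f ⟨h7, h9, h11, h13⟩
    have hs₂ := hs₁.of_frame f (by decide) (by decide)
    rw [← f.reg 8 (by decide), e] at h8
    rw [← f.arr 4 (by decide)] at hM
    rw [← f.arr 14 (by decide)] at hθ
    rw [← f.coins (by decide)] at hc
    clear f
    -- The lemma is applied to the entire array, whose rows beyond `N / 2^k` are leftovers about
    -- which nothing is known.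
    refine Spec.seq (halveRows_spec ω s₂ (Y := fun i j => s₂.reals 4 (i * (d + 1) + j)) hs₂ h8 hc
      h7 h9 h11 h13 (fun i j _ => rfl)) ?_
    rintro s₃ f ⟨g9, gc, gM⟩
    have hs₃ := hs₂.of_frame f (by decide) (by decide)
    rw [← f.arr 14 (by decide)] at hθ
    refine Spec.block ?_
    simp only [evalBlock, Instr.eval, State.setReg_reg, State.setReg_reals, State.setReal_reg,
        State.setReal_reals, State.setReal_coins, State.setReg_coins, State.getReal, g9, gc,
        hs₃.reg3, FieldOp.eval, scalar]
    refine ⟨by simp, by omega, ?_, fun i hi j hj => ?_⟩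
    · simp [hs₃.two, hθ, pow_succ, div_div]
    · have ht := Bool.toNat_le (ω (2 * N - N / 2 ^ k + i))
      have := gM i j hj
      beta_reduce at this
      rw [if_neg (by norm_num), this, if_pos hi, hM _ (by omega) j hj]
      rfl
  · rintro s₁ f ⟨-, -, hθ, -⟩
    have hs₁ := hs.of_frame f (by decide) (by decide)
    simp only [Test.Holds, State.getReal, scalar, hs₁.reg3, hs₁.one, hθ, hlt]
    exact lt_irrefl _
  · have key : ∀ m ≤ J, ∑ k ∈ Finset.range m, N / 2 ^ (k + 1) + N / 2 ^ m ≤ N := by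
      intro m hm
      induction m with
      | zero => simp
      | succ m ih =>
        rw [Finset.sum_range_succ]
        have e := div_pow_eq_two_mul ((Nat.pow_dvd_pow 2 hm).trans hN)
        have := ih (by omega)
        omega
    have h1 : ∑ k ∈ Finset.range J, N / 2 ^ (k + 1) ≤ N :=
      (Nat.le_add_right _ _).trans (key J le_rfl)
    have h2 : ∑ k ∈ Finset.range J, (5 + (N / 2 ^ (k + 1) * (d * 6 + 22) + 1 + 3) + 1) =
        (∑ k ∈ Finset.range J, N / 2 ^ (k + 1)) * (d * 6 + 22) + J * 10 := by
      rw [Finset.sum_mul, ← smul_eq_mul (a := J), ← Finset.card_range J, ← Finset.sum_const,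
        Finset.card_range, ← Finset.sum_add_distrib]
      exact Finset.sum_congr rfl fun k _ => by ring
    rw [h2]
    have := Nat.mul_le_mul_right (d * 6 + 22) h1
    omega

end RealRAM

/-! ## Gauss–Jordan elimination for positive definite systems -/

namespace GaussJordan

/-- Clears the column `k` in all rows below `d` except for the row `k`. -/
noncomputable def elimStep (d k : ℕ) (C : ℕ → ℕ → ℝ) (i j : ℕ) : ℝ :=
  if i < d ∧ i ≠ k then C i j - C i k / C k k * C k j else C i j

/-- Clears the first `k` columns one after the other. -/
noncomputable def elim (d : ℕ) : ℕ → (ℕ → ℕ → ℝ) → ℕ → ℕ → ℝ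
  | 0, C => C
  | k + 1, C => elimStep d k (elim d k C)

/-- The state of the elimination after `k` columns: the solution `x` of the original system still
solves the equations, and the part that is left is positive definite. -/
structure Inv (d k : ℕ) (x : ℕ → ℝ) (C : ℕ → ℕ → ℝ) : Prop where
  solves : ∀ i < d, ∑ j ∈ Finset.range d, C i j * x j = C i d
  cleared : ∀ j < k, ∀ i < d, i ≠ j → C i j = 0
  pivot : ∀ j < k, C j j ≠ 0
  symm : ∀ i ∈ Finset.Ico k d, ∀ j ∈ Finset.Ico k d, C i j = C j i
  pos : ∀ y : ℕ → ℝ, (∃ i ∈ Finset.Ico k d, y i ≠ 0) →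
    0 < ∑ i ∈ Finset.Ico k d, ∑ j ∈ Finset.Ico k d, y i * C i j * y j

theorem Inv.pivot_pos {d k : ℕ} {x : ℕ → ℝ} {C : ℕ → ℕ → ℝ} (h : Inv d k x C) (hk : k < d) :
    0 < C k k := by
  have hmem : k ∈ Finset.Ico k d := Finset.mem_Ico.mpr ⟨le_rfl, hk⟩
  have := h.pos (fun i => if i = k then 1 else 0) ⟨k, hmem, by simp⟩
  rw [Finset.sum_eq_single_of_mem k hmem, Finset.sum_eq_single_of_mem k hmem] at this
  · simpa using this
  · intro j _ hj; simp [hj]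
  · intro i _ hi; simp [hi]

/-- Row operations keep the solution. The remaining block becomes the Schur complement of the pivot:
its form at `y` is the old form at `y` extended by the minimizing coordinate `-s / C k k`. Positive
definiteness is thus inherited, and no row exchanges are needed. -/
theorem Inv.step {d k : ℕ} {x : ℕ → ℝ} {C : ℕ → ℕ → ℝ} (h : Inv d k x C) (hk : k < d) :
    Inv d (k + 1) x (elimStep d k C) := by
  have hp := h.pivot_pos hk
  have hsub : ∀ i, i ∈ Finset.Ico (k + 1) d → i ∈ Finset.Ico k d ∧ i < d ∧ i ≠ k ∧ k < i := by
    intro i hi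
    rw [Finset.mem_Ico] at hi ⊢
    omega
  have hkm : k ∈ Finset.Ico k d := Finset.mem_Ico.mpr ⟨le_rfl, hk⟩
  refine ⟨?_, ?_, ?_, ?_, ?_⟩
  · intro i hi
    by_cases hik : i = k
    · simp only [elimStep, hik, ne_eq, not_true_eq_false, and_false, if_false]
      exact h.solves k hk
    · simp only [elimStep, hi, hik, ne_eq, not_false_eq_true, and_self, if_true, sub_mul]
      rw [Finset.sum_sub_distrib, h.solves i hi]
      simp only [mul_assoc (C i k / C k k)]
      rw [← Finset.mul_sum, h.solves k hk]
  · intro j hj i hi hij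
    rcases Nat.lt_succ_iff_lt_or_eq.mp hj with hj | rfl
    · rw [elimStep]
      have h1 := h.cleared j hj i hi hij
      have h2 := h.cleared j hj k hk (by omega)
      split_ifs
      · rw [h1, h2]; ring
      · exact h1
    · rw [elimStep, if_pos ⟨hi, hij⟩]
      field_simp; ring
  · intro j hj
    rcases Nat.lt_succ_iff_lt_or_eq.mp hj with hj | rfl
    · rw [elimStep, if_pos ⟨by omega, by omega⟩, h.cleared j hj k hk (by omega)]
      simpa using h.pivot j hj
    · rw [elimStep, if_neg (by simp)]
      exact hp.ne'
  · intro i hi j hj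
    obtain ⟨hi1, hi2, hi3, -⟩ := hsub i hi
    obtain ⟨hj1, hj2, hj3, -⟩ := hsub j hj
    rw [elimStep, elimStep, if_pos ⟨hi2, hi3⟩, if_pos ⟨hj2, hj3⟩, h.symm i hi1 j hj1,
      h.symm i hi1 k hkm, h.symm k hkm j hj1]
    ring
  · rintro y ⟨i₀, hi₀, hy₀⟩
    obtain ⟨hi1, -, hi3, -⟩ := hsub i₀ hi₀
    set s := ∑ j ∈ Finset.Ico (k + 1) d, C k j * y j with hs
    set R := ∑ i ∈ Finset.Ico (k + 1) d, ∑ j ∈ Finset.Ico (k + 1) d, y i * C i j * y j with hR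
    have hcol : ∑ i ∈ Finset.Ico (k + 1) d, y i * C i k = s := by
      rw [hs]
      refine Finset.sum_congr rfl fun i hi => ?_
      rw [h.symm i (hsub i hi).1 k hkm, mul_comm]
    have hpos := h.pos (Function.update y k (-(s / C k k)))
      ⟨i₀, hi1, by rwa [Function.update_of_ne hi3]⟩
    have hup : ∀ i ∈ Finset.Ico (k + 1) d, Function.update y k (-(s / C k k)) i = y i :=
      fun i hi => Function.update_of_ne (hsub i hi).2.2.1 _ _
    have e1 : ∑ i ∈ Finset.Ico k d, ∑ j ∈ Finset.Ico k d,
        Function.update y k (-(s / C k k)) i * C i j * Function.update y k (-(s / C k k)) j =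
        R - s ^ 2 / C k k := by
      simp only [Finset.sum_eq_sum_Ico_succ_bot hk, Finset.sum_add_distrib, Function.update_self]
      have a1 : ∑ j ∈ Finset.Ico (k + 1) d, -(s / C k k) * C k j *
          Function.update y k (-(s / C k k)) j = -(s / C k k) * s := by
        rw [hs, Finset.mul_sum]
        exact Finset.sum_congr rfl fun j hj => by rw [hup j hj]; ring
      have a2 : ∑ i ∈ Finset.Ico (k + 1) d, Function.update y k (-(s / C k k)) i * C i k *
          -(s / C k k) = -(s / C k k) * s := by
        refine (Finset.sum_congr rfl fun i hi => by rw [hup i hi]).trans ?_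
        rw [← Finset.sum_mul, hcol, mul_comm]
      have a3 : ∑ i ∈ Finset.Ico (k + 1) d, ∑ j ∈ Finset.Ico (k + 1) d,
          Function.update y k (-(s / C k k)) i * C i j * Function.update y k (-(s / C k k)) j =
          R :=
        Finset.sum_congr rfl fun i hi => Finset.sum_congr rfl fun j hj => by rw [hup i hi, hup j hj]
      rw [a1, a2, a3]
      field_simp; ring
    have e2 : ∑ i ∈ Finset.Ico (k + 1) d, ∑ j ∈ Finset.Ico (k + 1) d,
        y i * elimStep d k C i j * y j = R - s ^ 2 / C k k := by
      have a1 : s ^ 2 / C k k = ∑ i ∈ Finset.Ico (k + 1) d, ∑ j ∈ Finset.Ico (k + 1) d,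
          (y i * C i k) * (C k j * y j) / C k k := by
        rw [sq]
        nth_rewrite 1 [← hcol]
        rw [hs, Finset.sum_mul_sum, Finset.sum_div]
        exact Finset.sum_congr rfl fun i _ => by rw [Finset.sum_div]
      rw [a1, hR, ← Finset.sum_sub_distrib]
      refine Finset.sum_congr rfl fun i hi => ?_
      rw [← Finset.sum_sub_distrib]
      refine Finset.sum_congr rfl fun j hj => ?_
      rw [elimStep, if_pos ⟨(hsub i hi).2.1, (hsub i hi).2.2.1⟩]
      ring
    rw [e2, ← e1]
    exact hpos

theorem Inv.elim {d : ℕ} {x : ℕ → ℝ} {C : ℕ → ℕ → ℝ} (h : Inv d 0 x C) {k : ℕ} (hk : k ≤ d) :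
    Inv d k x (elim d k C) := by
  induction k with
  | zero => exact h
  | succ k ih => exact (ih (by omega)).step hk

theorem Inv.elim_div_eq {d : ℕ} {x : ℕ → ℝ} {C : ℕ → ℕ → ℝ} (h : Inv d 0 x C) {i : ℕ} (hi : i < d) :
    GaussJordan.elim d d C i d / GaussJordan.elim d d C i i = x i := by
  have H := h.elim le_rfl
  rw [div_eq_iff (H.pivot i hi), ← H.solves i hi,
    Finset.sum_eq_single_of_mem i (Finset.mem_range.mpr hi), mul_comm]
  intro j hj hji
  rw [H.cleared j (Finset.mem_range.mp hj) i hi hji.symm, zero_mul]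

end GaussJordan

/-! ### Programs for the Gram matrix, the elimination and the output -/

namespace RealRAM

open GaussJordan

/-- Accumulates the Gram matrix of the columns of the array `4` in the array `5`. -/
def gramLoop : Prog :=
  .seq (block [.natConst 9 0, .natConst 13 0]) <|
  .loop (.natLt 9 8) <|
    .seq (block [.natConst 7 0, .natConst 14 0, .natAdd 12 13 3]) <|
    .seq (.loop (.natLt 7 1) <|
      .seq (block [.natConst 10 0, .natAdd 11 13 3]) <|
      .seq (.loop (.natLt 10 4) (block [.realOp .mul (scalar 17) ⟨4, 12⟩ ⟨4, 11⟩,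
        .realOp .add ⟨5, 14⟩ ⟨5, 14⟩ (scalar 17), .natAdd 10 10 2, .natAdd 11 11 2,
        .natAdd 14 14 2])) <|
      block [.natAdd 7 7 2, .natAdd 12 12 2]) <|
    block [.natAdd 9 9 2, .natAdd 13 13 4]

theorem gramLoop_spec (ω : ℕ → Bool) (s : State) {n d r : ℕ} (hs : Ready n d s) (h8 : s.reg 8 = r)
    (h5 : ∀ e, s.reals 5 e = 0) {X : ℕ → ℕ → ℝ}
    (hX : ∀ k < r, ∀ j < d + 1, s.reals 4 (k * (d + 1) + j) = X j k) :
    Spec ω gramLoop s (fun s' => IsMat (s'.reals 5) (d + 1) fun i j =>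
      if i < d then ∑ k ∈ Finset.range r, X i k * X j k else 0)
      (r * (d * (d * 7 + 15) + 9) + 4) := by
  refine (Spec.seq (T' := r * (4 + (d * (3 + ((d + 1) * 7 + 1 + 3) + 1) + 1 + 3) + 1) + 1)
    (Spec.block (Q := fun s' => s'.reg 9 = 0 ∧ s'.reg 13 = 0)
    (by simp [evalBlock, Instr.eval])) ?_).mono
    (by simp only [List.length]; ring_nf; omega) fun _ _ h => h
  rintro s₁ f ⟨h9, h13⟩
  have hs₁ := hs.of_frame f (by decide) (by decide)
  rw [← f.reg 8 (by decide)] at h8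
  rw [← f.arr 4 (by decide)] at hX
  rw [← f.arr 5 (by decide)] at h5
  clear f hs
  refine (Spec.loop r _ (fun k s' => s'.reg 9 = k ∧ s'.reg 13 = k * (d + 1) ∧
    IsMat (s'.reals 5) (d + 1) fun i j => if i < d then ∑ k ∈ Finset.range k, X i k * X j k else 0)
    ⟨h9, by simpa using h13, fun i j _ => by simp [h5]⟩ ?_ ?_).mono le_rfl
    fun s' _ h => h.2.2
  · rintro k hk s₂ f ⟨h9, h13, hM⟩
    have hs₂ := hs₁.of_frame f (by decide) (by decide)
    rw [← f.reg 8 (by decide)] at h8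
    rw [← f.arr 4 (by decide)] at hX
    clear f h5 hs₁
    refine ⟨by simp [Test.Holds, h9, h8, hk], ?_⟩
    refine Spec.seq (Spec.block (Q := fun s' => s'.reg 7 = 0 ∧ s'.reg 14 = 0 ∧
      s'.reg 12 = k * (d + 1)) (by simp [evalBlock, Instr.eval, h13, hs₂.reg3])) ?_
    rintro s₃ f ⟨h7, h14, h12⟩
    have hs₃ := hs₂.of_frame f (by decide) (by decide)
    rw [← f.reg 9 (by decide)] at h9
    rw [← f.reg 13 (by decide)] at h13
    rw [← f.arr 4 (by decide)] at hX
    rw [← f.arr 5 (by decide)] at hM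
    clear f hs₂
    refine Spec.seq (Spec.loop d (3 + ((d + 1) * 7 + 1 + 3)) (fun i s' => s'.reg 7 = i ∧
      s'.reg 14 = i * (d + 1) ∧ s'.reg 12 = k * (d + 1) + i ∧
      IsMat (s'.reals 5) (d + 1) fun i' j => if i' < i then
        ∑ k ∈ Finset.range (k + 1), X i' k * X j k else
        if i' < d then ∑ k ∈ Finset.range k, X i' k * X j k else 0)
        ⟨h7, by simpa using h14, by simpa using h12, by simpa using hM⟩ ?_ ?_) ?_
    · rintro i hi s₄ f ⟨g7, g14, g12, gM⟩
      have hs₄ := hs₃.of_frame f (by decide) (by decide)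
      rw [← f.reg 13 (by decide)] at h13
      rw [← f.arr 4 (by decide)] at hX
      clear f hs₃ hM
      refine ⟨by simp [Test.Holds, g7, hs₄.reg1, hi], ?_⟩
      refine Spec.seq (Spec.block (Q := fun s' => s'.reg 10 = 0 ∧ s'.reg 11 = k * (d + 1))
        (by simp [evalBlock, Instr.eval, h13, hs₄.reg3])) ?_
      rintro s₅ f ⟨g10, g11⟩
      have hs₅ := hs₄.of_frame f (by decide) (by decide)
      rw [← f.reg 7 (by decide)] at g7
      rw [← f.reg 12 (by decide)] at g12
      rw [← f.reg 14 (by decide)] at g14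
      rw [← f.arr 4 (by decide)] at hX
      rw [← f.arr 5 (by decide)] at gM
      clear f hs₄
      refine Spec.seq (Spec.loop (d + 1) 6 (fun l s' => s'.reg 10 = l ∧
        s'.reg 11 = k * (d + 1) + l ∧ s'.reg 14 = i * (d + 1) + l ∧
        IsMat (s'.reals 5) (d + 1) fun i' j => if i' < i ∨ i' = i ∧ j < l then
          ∑ k ∈ Finset.range (k + 1), X i' k * X j k else
          if i' < d then ∑ k ∈ Finset.range k, X i' k * X j k else 0)
          ⟨g10, by simpa using g11, by simpa using g14, by simpa using gM⟩ ?_ ?_) ?_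
      · rintro l hl s₆ f ⟨k10, k11, k14, kM⟩
        have hs₆ := hs₅.of_frame f (by decide) (by decide)
        rw [← f.arr 4 (by decide)] at hX
        rw [← f.reg 12 (by decide)] at g12
        refine ⟨by simp [Test.Holds, k10, hs₆.reg4, hl], Spec.block ?_⟩
        simp only [evalBlock, Instr.eval, State.setReg_reg, State.setReg_reals, State.setReal_reg,
          State.setReal_reals, State.getReal, k10, k11, k14, g12, hs₆.reg2, hs₆.reg3, FieldOp.eval,
          scalar]
        refine ⟨by simp, by simp [add_assoc], by simp [add_assoc], ?_⟩
        simp only [reduceIte, Nat.reduceEqDiff, Function.update_self]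
        refine kM.update (i := i) (j := l) (by omega) rfl _ ?_ ?_
        · have := kM i l hl
          beta_reduce at this
          rw [this, hX k hk i (by omega), hX k hk l hl, if_pos (by omega), if_neg (by omega),
            if_pos hi, Finset.sum_range_succ]
        · intro i' j' _ hne
          have : (i' < i ∨ i' = i ∧ j' < l + 1) ↔ (i' < i ∨ i' = i ∧ j' < l) := by omega
          simp only [this]
      · rintro s₆ f ⟨k10, -⟩
        have hs₆ := hs₅.of_frame f (by decide) (by decide)
        simp [Test.Holds, k10, hs₆.reg4]
      · rintro s₆ f ⟨-, -, k14, kM⟩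
        have hs₆ := hs₅.of_frame f (by decide) (by decide)
        rw [← f.reg 7 (by decide)] at g7
        rw [← f.reg 12 (by decide)] at g12
        refine Spec.block ?_
        simp only [evalBlock, Instr.eval, State.setReg_reg, State.setReg_reals, g7, g12, k14,
          hs₆.reg2]
        refine ⟨by simp, by simp; ring, by simp [add_assoc], kM.congr fun i' j hj => ?_⟩
        have : i' < i + 1 ↔ (i' < i ∨ i' = i ∧ j < d + 1) := by omega
        simp only [this]
    · rintro s₄ f ⟨g7, -⟩
      have hs₄ := hs₃.of_frame f (by decide) (by decide)
      simp [Test.Holds, g7, hs₄.reg1]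
    · rintro s₄ f ⟨-, -, -, gM⟩
      have hs₄ := hs₃.of_frame f (by decide) (by decide)
      rw [← f.reg 9 (by decide)] at h9
      rw [← f.reg 13 (by decide)] at h13
      refine Spec.block ?_
      simp only [evalBlock, Instr.eval, State.setReg_reg, State.setReg_reals, h9, h13, hs₄.reg2,
        hs₄.reg4]
      refine ⟨by simp, by simp; ring, gM.congr fun i j _ => ?_⟩
      by_cases hi : i < d <;> simp [hi]
  · rintro s₂ f ⟨h9, -⟩
    rw [← f.reg 8 (by decide)] at h8
    simp [Test.Holds, h9, h8]

/-- Subtracts a multiple of the pivot row from the row that starts at `reg 12`. -/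
def eliminateRow : Prog :=
  .seq (block [.natAdd 15 12 9, .realOp .div (scalar 17) ⟨5, 15⟩ ⟨5, 14⟩, .natConst 10 0,
    .natAdd 11 12 3, .natAdd 15 13 3]) <|
  .loop (.natLt 10 4) (block [.realOp .mul (scalar 15) (scalar 17) ⟨5, 15⟩,
    .realOp .sub ⟨5, 11⟩ ⟨5, 11⟩ (scalar 15), .natAdd 10 10 2, .natAdd 11 11 2, .natAdd 15 15 2])

/-- The multiplier `C i k / C k k` is saved in the scalar `17` before the entry `C i k` is
overwritten, so all columns use the same one. -/
theorem eliminateRow_spec (ω : ℕ → Bool) (s : State) {n d k i : ℕ} (hs : Ready n d s) (hk : k < d)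
    (h9 : s.reg 9 = k) (h13 : s.reg 13 = k * (d + 1))
    (h14 : s.reg 14 = k * (d + 1) + k) (h12 : s.reg 12 = i * (d + 1)) {C : ℕ → ℕ → ℝ}
    (hC : IsMat (s.reals 5) (d + 1) C) :
    Spec ω eliminateRow s (fun s' => IsMat (s'.reals 5) (d + 1) fun i' j =>
      if i' = i then C i j - C i k / C k k * C k j else C i' j) (d * 7 + 14) := by
  refine (Spec.seq (T' := (d + 1) * 7 + 1) (Spec.block (Q := fun s' =>
    s'.reals 17 0 = C i k / C k k ∧ s'.reg 10 = 0 ∧ s'.reg 11 = i * (d + 1) ∧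
    s'.reg 15 = k * (d + 1)) ?_) ?_).mono (by simp only [List.length]; omega) fun _ _ h => h
  · have h1 := hC i k (by omega)
    have h2 := hC k k (by omega)
    simp [evalBlock, Instr.eval, scalar, State.getReal, FieldOp.eval, h9, h12, h13, h14, hs.reg3,
      h1, h2]
  · rintro s₁ f ⟨h17, h10, h11, h15⟩
    have hs₁ := hs.of_frame f (by decide) (by decide)
    rw [← f.arr 5 (by decide)] at hC
    clear f hs
    refine (Spec.loop (d + 1) 6 (fun l s' => s'.reg 10 = l ∧ s'.reg 11 = i * (d + 1) + l ∧
      s'.reg 15 = k * (d + 1) + l ∧ IsMat (s'.reals 5) (d + 1) fun i' j =>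
        if i' = i ∧ j < l then C i j - C i k / C k k * C k j else C i' j)
        ⟨h10, by simpa using h11, by simpa using h15, by simpa using hC⟩ ?_ ?_).mono le_rfl
        fun s' _ h => h.2.2.2.congr fun i' j hj => by simp [hj]
    · rintro l hl s₂ f ⟨g10, g11, g15, gM⟩
      have hs₂ := hs₁.of_frame f (by decide) (by decide)
      rw [← f.arr 17 (by decide)] at h17
      refine ⟨by simp [Test.Holds, g10, hs₂.reg4, hl], Spec.block ?_⟩
      simp only [evalBlock, Instr.eval, State.setReg_reg, State.setReg_reals, State.setReal_reg,
          State.setReal_reals, State.getReal, g10, g11, g15, hs₂.reg2, hs₂.reg3, h17, FieldOp.eval,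
          scalar]
      refine ⟨by simp, by simp [add_assoc], by simp [add_assoc], ?_⟩
      simp only [reduceIte, Nat.reduceEqDiff, Function.update_self]
      refine gM.update (i := i) (j := l) (by omega) rfl _ ?_ ?_
      · have h1 := gM i l hl
        have h2 := gM k l hl
        beta_reduce at h1 h2
        rw [h1, h2, if_pos (by omega), if_neg (by omega), if_neg (by omega)]
      · intro i' j' _ hne
        have : (i' = i ∧ j' < l + 1) ↔ (i' = i ∧ j' < l) := by omega
        simp only [this]
    · rintro s₂ f ⟨g10, -⟩
      have hs₂ := hs₁.of_frame f (by decide) (by decide)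
      simp [Test.Holds, g10, hs₂.reg4]

/-- Gauss–Jordan elimination of the first `reg 1` columns of the array `5`. -/
def eliminate : Prog :=
  .seq (block [.natConst 9 0, .natConst 13 0]) <|
  .loop (.natLt 9 1) <|
    .seq (block [.natAdd 14 13 9, .natConst 7 0, .natConst 12 0]) <|
    .seq (.loop (.natLt 7 1) <|
      .seq (.ite (.natLt 7 9) eliminateRow (.ite (.natLt 9 7) eliminateRow .skip)) <|
      block [.natAdd 7 7 2, .natAdd 12 12 4]) <|
    block [.natAdd 9 9 2, .natAdd 13 13 4]

theorem eliminate_spec (ω : ℕ → Bool) (s : State) {n d : ℕ} (hs : Ready n d s) {C : ℕ → ℕ → ℝ}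
    (hC : IsMat (s.reals 5) (d + 1) C) :
    Spec ω eliminate s (fun s' => IsMat (s'.reals 5) (d + 1) (elim d d C))
      (d * (d * (d * 7 + 20) + 9) + 4) := by
  refine (Spec.seq (T' := d * (4 + (d * (d * 7 + 14 + 1 + 1 + 3 + 1) + 1 + 3) + 1) + 1)
    (Spec.block (Q := fun s' => s'.reg 9 = 0 ∧ s'.reg 13 = 0)
    (by simp [evalBlock, Instr.eval])) ?_).mono
    (by simp only [List.length]; ring_nf; omega) fun _ _ h => h
  rintro s₁ f ⟨h9, h13⟩
  have hs₁ := hs.of_frame f (by decide) (by decide)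
  rw [← f.arr 5 (by decide)] at hC
  clear f hs
  refine (Spec.loop d _ (fun k s' => s'.reg 9 = k ∧ s'.reg 13 = k * (d + 1) ∧
    IsMat (s'.reals 5) (d + 1) (elim d k C))
    ⟨h9, by simpa using h13, hC⟩ ?_ ?_).mono le_rfl fun s' _ h => h.2.2
  · rintro k hk s₂ f ⟨h9, h13, hM⟩
    have hs₂ := hs₁.of_frame f (by decide) (by decide)
    clear f hs₁ hC
    refine ⟨by simp [Test.Holds, h9, hs₂.reg1, hk], ?_⟩
    refine Spec.seq (Spec.block (Q := fun s' => s'.reg 14 = k * (d + 1) + k ∧ s'.reg 7 = 0 ∧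
      s'.reg 12 = 0) (by simp [evalBlock, Instr.eval, h13, h9])) ?_
    rintro s₃ f ⟨h14, h7, h12⟩
    have hs₃ := hs₂.of_frame f (by decide) (by decide)
    rw [← f.reg 9 (by decide)] at h9
    rw [← f.reg 13 (by decide)] at h13
    rw [← f.arr 5 (by decide)] at hM
    clear f hs₂
    generalize hD : elim d k C = D at hM
    refine Spec.seq (Spec.loop d (d * 7 + 14 + 1 + 1 + 3) (fun i s' => s'.reg 7 = i ∧
      s'.reg 12 = i * (d + 1) ∧ IsMat (s'.reals 5) (d + 1) fun i' j =>
        if i' < i then elimStep d k D i' j else D i' j)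
        ⟨h7, by simpa using h12, by simpa using hM⟩ ?_ ?_) ?_
    · rintro i hi s₄ f ⟨g7, g12, gM⟩
      have hs₄ := hs₃.of_frame f (by decide) (by decide)
      rw [← f.reg 9 (by decide)] at h9
      rw [← f.reg 13 (by decide)] at h13
      rw [← f.reg 14 (by decide)] at h14
      clear f hs₃
      refine ⟨by simp [Test.Holds, g7, hs₄.reg1, hi], ?_⟩
      have hrow : i ≠ k → Spec ω eliminateRow s₄ (fun s' => IsMat (s'.reals 5) (d + 1) fun i' j =>
          if i' < i + 1 then elimStep d k D i' j else D i' j) (d * 7 + 14) := by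
        intro hik
        refine (eliminateRow_spec ω s₄ hs₄ hk h9 h13 h14 g12 gM).mono le_rfl
          fun s' _ h => h.congr fun i' j _ => ?_
        -- `elimStep` fixes the pivot row, so treating the rows one after the other agrees with
        -- clearing them simultaneously.
        have hkk : ∀ j, (if k < i then elimStep d k D k j else D k j) = D k j := by
          intro j
          simp [elimStep]
        simp only [lt_irrefl, if_false, hkk]
        by_cases h1 : i' = i
        · subst h1
          simp [elimStep, hi, hik]
        · have : i' < i + 1 ↔ i' < i := by omega
          simp only [h1, if_false, this]
      refine Spec.seq (R := fun s' => IsMat (s'.reals 5) (d + 1) fun i' j =>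
          if i' < i + 1 then elimStep d k D i' j else D i' j) (Spec.ite (fun hh => ?_) fun hh =>
            Spec.ite (T := d * 7 + 14) (fun hh' => hrow ?_) fun hh' => ?_) ?_
      · refine (hrow ?_).mono (by omega) fun _ _ h => h
        simp only [Test.Holds, g7, h9] at hh
        omega
      · simp only [Test.Holds, g7, h9] at hh'
        omega
      · simp only [Test.Holds, g7, h9] at hh hh'
        have hik : i = k := by omega
        refine (Spec.skip ?_).mono (by omega) fun _ _ h => h
        refine gM.congr fun i' j _ => ?_
        by_cases h1 : i' = k
        · simp [elimStep, h1]
        · have : i' < i + 1 ↔ i' < i := by omega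
          simp only [this]
      · intro s₅ f kM
        have hs₅ := hs₄.of_frame f (by decide) (by decide)
        rw [← f.reg 7 (by decide)] at g7
        rw [← f.reg 12 (by decide)] at g12
        refine Spec.block ?_
        simp only [evalBlock, Instr.eval, State.setReg_reg, State.setReg_reals, g7, g12, hs₅.reg2,
          hs₅.reg4]
        exact ⟨by simp, by simp; ring, kM⟩
    · rintro s₄ f ⟨g7, -⟩
      have hs₄ := hs₃.of_frame f (by decide) (by decide)
      simp [Test.Holds, g7, hs₄.reg1]
    · rintro s₄ f ⟨-, -, gM⟩
      have hs₄ := hs₃.of_frame f (by decide) (by decide)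
      rw [← f.reg 9 (by decide)] at h9
      rw [← f.reg 13 (by decide)] at h13
      refine Spec.block ?_
      simp only [evalBlock, Instr.eval, State.setReg_reg, State.setReg_reals, h9, h13, hs₄.reg2,
        hs₄.reg4]
      refine ⟨by simp, by simp; ring, gM.congr fun i j _ => ?_⟩
      rw [elim, hD]
      by_cases hi : i < d <;> simp [hi, elimStep]
  · rintro s₂ f ⟨h9, -⟩
    have hs₂ := hs₁.of_frame f (by decide) (by decide)
    simp [Test.Holds, h9, hs₂.reg1]

/-- Divides the last column by the pivots. -/
def writeOutput : Prog :=
  .seq (block [.natConst 9 0, .natConst 13 0]) <|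
  .loop (.natLt 9 1) (block [.natAdd 14 13 9, .natAdd 15 13 1, .realOp .div ⟨3, 9⟩ ⟨5, 15⟩ ⟨5, 14⟩,
    .natAdd 9 9 2, .natAdd 13 13 4])

theorem writeOutput_spec (ω : ℕ → Bool) (s : State) {n d : ℕ} (hs : Ready n d s) {C : ℕ → ℕ → ℝ}
    (hC : IsMat (s.reals 5) (d + 1) C) :
    Spec ω writeOutput s (fun s' => ∀ i < d, s'.reals 3 i = C i d / C i i) (d * 7 + 4) := by
  refine (Spec.seq (T' := d * 7 + 1) (Spec.block (Q := fun s' => s'.reg 9 = 0 ∧ s'.reg 13 = 0)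
    (by simp [evalBlock, Instr.eval])) ?_).mono (by simp only [List.length]; omega) fun _ _ h => h
  rintro s₁ f ⟨h9, h13⟩
  have hs₁ := hs.of_frame f (by decide) (by decide)
  rw [← f.arr 5 (by decide)] at hC
  clear f hs
  refine (Spec.loop d 6 (fun k s' => s'.reg 9 = k ∧ s'.reg 13 = k * (d + 1) ∧
    ∀ i < k, s'.reals 3 i = C i d / C i i)
    ⟨h9, by simpa using h13, by simp⟩ ?_ ?_).mono le_rfl fun s' _ h => h.2.2
  · rintro k hk s₂ f ⟨h9, h13, hM⟩
    have hs₂ := hs₁.of_frame f (by decide) (by decide)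
    rw [← f.arr 5 (by decide)] at hC
    refine ⟨by simp [Test.Holds, h9, hs₂.reg1, hk], Spec.block ?_⟩
    have h1 := hC k d (by omega)
    have h2 := hC k k (by omega)
    simp only [evalBlock, Instr.eval, State.setReg_reg, State.setReg_reals, State.setReal_reg,
          State.setReal_reals, State.getReal, h9, h13, hs₂.reg1, hs₂.reg2, hs₂.reg4, FieldOp.eval]
    refine ⟨by simp, by simp; ring, fun i hi => ?_⟩
    simp only [reduceIte, Nat.reduceEqDiff, h1, h2, Function.update_apply]
    by_cases hik : i = k
    · simp [hik]
    · rw [if_neg hik, hM i (by omega)]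
  · rintro s₂ f ⟨h9, -⟩
    have hs₂ := hs₁.of_frame f (by decide) (by decide)
    simp [Test.Holds, h9, hs₂.reg1]

end RealRAM

/-! ## The algorithm -/

namespace RealRAM

open Sketch RademacherVector GaussJordan

variable {n d : ℕ}

/-- The extension of a vector by zeros. -/
noncomputable def extend (z : EuclideanSpace ℝ (Fin n)) (i : ℕ) : ℝ :=
  if h : i < n then z ⟨i, h⟩ else 0

/-- The columns of the matrix `[A | b]`. -/
noncomputable def column (A : Matrix (Fin n) (Fin d) ℝ) (b : EuclideanSpace ℝ (Fin n)) (j : ℕ) :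
    EuclideanSpace ℝ (Fin n) :=
  if h : j < d then WithLp.toLp 2 fun i => A i ⟨j, h⟩ else b

/-- The number of times that the number of rows is halved. -/
noncomputable def halvings (n d : ℕ) (ε : ℝ) : ℕ := Nat.clog 2 ⌈reduction n d ε⌉₊

/-- The number of rows that remain. -/
noncomputable def sketchRows (n d : ℕ) (ε : ℝ) : ℕ := paddedRows n d / 2 ^ halvings n d ε

/-- The sketch of a vector that the algorithm uses. -/
noncomputable def sketchVec (d : ℕ) (ε : ℝ) (ω : ℕ → Bool) (z : EuclideanSpace ℝ (Fin n)) (k : ℕ) :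
    ℝ :=
  sketch (paddedRows n d) (logBlock d) ω (halvings n d ε) (extend z) k

/-- The matrix of the normal equations of the sketched problem, with the right hand side. -/
noncomputable def normalMatrix (A : Matrix (Fin n) (Fin d) ℝ) (b : EuclideanSpace ℝ (Fin n))
    (ε : ℝ) (ω : ℕ → Bool) (i j : ℕ) : ℝ :=
  if i < d then ∑ k ∈ Finset.range (sketchRows n d ε),
    sketchVec d ε ω (column A b i) k * sketchVec d ε ω (column A b j) k else 0

theorem pow_logBlock_dvd_paddedRows (n d : ℕ) : 2 ^ logBlock d ∣ paddedRows n d :=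
  dvd_mul_left _ _

theorem le_paddedRows (n d : ℕ) : n ≤ paddedRows n d := by
  have h : 0 < 2 ^ logBlock d := by positivity
  have := Nat.lt_div_mul_add (a := n + 2 ^ logBlock d - 1) h
  rw [paddedRows]
  generalize 2 ^ logBlock d = B at *
  omega

theorem paddedRows_le (n d : ℕ) : paddedRows n d ≤ n + 2 ^ logBlock d := by
  exact (Nat.div_mul_le_self _ _).trans (Nat.sub_le _ _)

/-- The reduction factor never exceeds the block length. Since that length divides the padded number
of rows, all halvings are exact. -/
theorem halvings_le_logBlock {ε : ℝ} (hε : 0 < ε) (hε1 : ε < 1) : halvings n d ε ≤ logBlock d := by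
  refine Nat.clog_le_of_le_pow (Nat.ceil_le.mpr ?_)
  push_cast
  have h1 : (1 : ℝ) ≤ (4 + Nat.clog 2 (d + 1)) * (5 + d + Nat.clog 2 (paddedRows n d)) :=
    one_le_mul_of_one_le_of_one_le (by linarith [Nat.cast_nonneg (α := ℝ) (Nat.clog 2 (d + 1))])
      (by linarith [Nat.cast_nonneg (α := ℝ) (Nat.clog 2 (paddedRows n d)),
        Nat.cast_nonneg (α := ℝ) d])
  refine (div_le_self (by positivity) (by linarith)).trans ?_
  exact mul_le_of_le_one_right (by positivity) hε1.le

theorem input_reals_zero (A : Matrix (Fin n) (Fin d) ℝ) (b : EuclideanSpace ℝ (Fin n)) (ε : ℝ)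
    (i : Fin n) (j : Fin d) : (input A b ε).reals 0 (i * d + j) = A i j := by
  have hlt : (i : ℕ) * d + j < n * d :=
    calc (i : ℕ) * d + j < (i + 1) * d := by rw [add_mul, one_mul]; omega
      _ ≤ n * d := Nat.mul_le_mul_right _ i.2
  have hd : 0 < d := j.pos
  simp only [input, if_true, dif_pos hlt]
  congr 1
  · ext
    simp only [Fin.divNat]
    rw [mul_comm, Nat.mul_add_div hd, Nat.div_eq_of_lt j.2, add_zero]
  · ext
    simp only [Fin.modNat]
    rw [mul_comm, Nat.mul_add_mod, Nat.mod_eq_of_lt j.2]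

theorem input_reals_one (A : Matrix (Fin n) (Fin d) ℝ) (b : EuclideanSpace ℝ (Fin n)) (ε : ℝ)
    (i : Fin n) : (input A b ε).reals 1 i = b i := by
  simp [input]

theorem input_columns (A : Matrix (Fin n) (Fin d) ℝ) (b : EuclideanSpace ℝ (Fin n)) (ε : ℝ)
    (i j : ℕ) : (if i < n then (if j < d then (input A b ε).reals 0 (i * d + j)
      else (input A b ε).reals 1 i) else 0) = extend (column A b j) i := by
  by_cases hi : i < n
  · by_cases hj : j < d
    · simp [extend, column, hi, hj, input_reals_zero A b ε ⟨i, hi⟩ ⟨j, hj⟩]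
    · simp [extend, column, hi, hj, input_reals_one A b ε ⟨i, hi⟩]
  · simp [extend, hi]

/-- The algorithm: it replaces `[A | b]` by a random sketch with fewer rows, and solves the normal
equations of the sketched problem. -/
def solver : Prog :=
  .seq setup <| .seq copyRows <| .seq signRows <| .seq hadamardLoop <| .seq halvingLoop <|
    .seq gramLoop <| .seq eliminate writeOutput

/-- A bound for the running time of `solver`. -/
noncomputable def solverTime (n d : ℕ) (ε : ℝ) : ℕ :=
  setupTime n d + ((n * (d * 6 + 8) + 5) + ((paddedRows n d * (d * 5 + 14) + 4) +
    ((logBlock d * (8 * (paddedRows n d * (d + 1)) + 9) + 5) +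
    ((paddedRows n d * (d * 6 + 22) + halvings n d ε * 10 + 1) +
    ((sketchRows n d ε * (d * (d * 7 + 15) + 9) + 4) +
    ((d * (d * (d * 7 + 20) + 9) + 4) + (d * 7 + 4)))))))

/-- No rank condition and no luck with the coins is required: division by zero has a value, and the
time bound depends only on `n`, `d` and `ε`. Hence the program halts in time even when the sketch is
degenerate. -/
theorem solver_spec (A : Matrix (Fin n) (Fin d) ℝ) (b : EuclideanSpace ℝ (Fin n)) {ε : ℝ}
    (hε : 0 < ε) (hε1 : ε < 1) (ω : ℕ → Bool) :
    Spec ω solver (input A b ε) (fun s => ∀ i < d, s.reals 3 i =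
      elim d d (normalMatrix A b ε ω) i d / elim d d (normalMatrix A b ε ω) i i)
      (solverTime n d ε) := by
  have hβ := pow_logBlock_dvd_paddedRows n d
  refine Spec.seq (setup_spec ω _ (n := n) (d := d) (ε := ε) (by simp [input]) (by simp [input])
    (fun r hr => ?_) (by simp [input])) ?_
  · have h0 : r ≠ 0 := by omega
    have h1 : r ≠ 1 := by omega
    simp [input, h0, h1]
  rintro s₁ f ⟨hs, h8, h14⟩
  have i0 := f.arr 0 (by decide)
  have i1 := f.arr 1 (by decide)
  have i4 : ∀ e, s₁.reals 4 e = 0 := by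
    rw [f.arr 4 (by decide)]; simp [input]
  have i5 : ∀ e, s₁.reals 5 e = 0 := by
    rw [f.arr 5 (by decide)]; simp [input]
  have hc : s₁.coins = 0 := f.coins rfl
  clear f
  refine Spec.seq (copyRows_spec ω s₁ hs i4) fun s₂ f hM => ?_
  replace hs := hs.of_frame f (by decide) (by decide)
  rw [i0, i1] at hM
  rw [← f.reg 8 (by decide)] at h8
  rw [← f.arr 14 (by decide)] at h14
  rw [← f.arr 5 (by decide)] at i5
  rw [← f.coins rfl] at hc
  clear f i4 i0 i1
  replace hM := hM.congr (Y' := fun i j => extend (column A b j) i)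
    fun i j _ => input_columns A b ε i j
  refine Spec.seq (signRows_spec ω s₂ hs h8 hc hM) ?_
  rintro s₃ f ⟨h11, hc, hM⟩
  replace hs := hs.of_frame f (by decide) (by decide)
  rw [← f.reg 8 (by decide)] at h8
  rw [← f.arr 14 (by decide)] at h14
  rw [← f.arr 5 (by decide)] at i5
  clear f
  refine Spec.seq (hadamardLoop_spec ω s₃ hs hβ h11
    (Y := fun j f => sgn (ω f) * extend (column A b j) f)
    fun f hf j hj => by simpa [hf] using hM f j hj) ?_
  intro s₄ f hM
  replace hs := hs.of_frame f (by decide) (by decide)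
  rw [← f.reg 8 (by decide)] at h8
  rw [← f.arr 14 (by decide)] at h14
  rw [← f.arr 5 (by decide)] at i5
  rw [← f.coins rfl] at hc
  clear f
  refine Spec.seq (halvingLoop_spec ω s₄ (J := halvings n d ε) (β := logBlock d) hs h8 hc h14 rfl
    ((pow_dvd_pow 2 (halvings_le_logBlock hε hε1)).trans hβ)
    (Y := fun j => extend (column A b j)) hM) ?_
  rintro s₅ f ⟨h8, hM⟩
  replace hs := hs.of_frame f (by decide) (by decide)
  rw [← f.arr 5 (by decide)] at i5
  clear f
  refine Spec.seq (gramLoop_spec ω s₅ hs h8 i5 hM) ?_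
  intro s₆ f hC
  replace hs := hs.of_frame f (by decide) (by decide)
  clear f
  refine Spec.seq (eliminate_spec ω s₆ hs hC) ?_
  intro s₇ f hC
  exact writeOutput_spec ω s₇ (hs.of_frame f (by decide) (by decide)) hC

theorem Spec.exists_returns {P : Prog} {A : Matrix (Fin n) (Fin d) ℝ}
    {b : EuclideanSpace ℝ (Fin n)} {ε : ℝ} {ω : ℕ → Bool} {y : ℕ → ℝ} {T : ℕ}
    (h : Spec ω P (input A b ε) (fun s => ∀ i < d, s.reals 3 i = y i) T) :
    ∃ t ≤ T, Returns P ω A b ε (WithLp.toLp 2 fun i : Fin d => y i) t := by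
  obtain ⟨s, t, he, ht, hs⟩ := h
  refine ⟨t, ht, s, he, ?_⟩
  simp only [output]
  congr 1
  ext i
  exact hs i i.2

end RealRAM

/-! ## The algorithm is accurate with high probability -/

namespace RealRAM

open Sketch RademacherVector GaussJordan Module

variable {n d : ℕ}

theorem extend_sum {ι : Type*} (s : Finset ι) (x : ι → ℝ) (v : ι → EuclideanSpace ℝ (Fin n))
    (i : ℕ) : extend (∑ a ∈ s, x a • v a) i = ∑ a ∈ s, x a * extend (v a) i := by
  by_cases h : i < n <;> simp [extend, h]

theorem sum_extend_sq {N : ℕ} (hN : n ≤ N) (z : EuclideanSpace ℝ (Fin n)) :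
    ∑ i ∈ Finset.range N, extend z i ^ 2 = ‖z‖ ^ 2 := by
  rw [← Finset.sum_subset (Finset.range_subset_range.mpr hN) fun i _ hi => by
    simp only [Finset.mem_range] at hi; simp [extend, hi], Finset.sum_range,
    EuclideanSpace.real_norm_sq_eq]
  simp [extend]

theorem sketchVec_sum {ι : Type*} (ε : ℝ) (ω : ℕ → Bool) (s : Finset ι) (x : ι → ℝ)
    (v : ι → EuclideanSpace ℝ (Fin n)) (k : ℕ) :
    sketchVec d ε ω (∑ a ∈ s, x a • v a) k = ∑ a ∈ s, x a * sketchVec d ε ω (v a) k := by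
  simp only [sketchVec, ← sketch_sum]
  congr 1
  exact funext fun i => extend_sum s x v i

/-- The sketch as a linear map. -/
noncomputable def sketchMap (n d : ℕ) (ε : ℝ) (ω : ℕ → Bool) :
    EuclideanSpace ℝ (Fin n) →ₗ[ℝ] EuclideanSpace ℝ (Fin (sketchRows n d ε)) where
  toFun z := WithLp.toLp 2 fun k => sketchVec d ε ω z k
  map_add' z w := by
    ext k
    simpa using sketchVec_sum (d := d) ε ω Finset.univ ![1, 1] ![z, w] k
  map_smul' c z := by
    ext k
    simpa using sketchVec_sum (d := d) ε ω Finset.univ ![c] ![z] k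

theorem inner_sketchMap (ε : ℝ) (ω : ℕ → Bool) (z w : EuclideanSpace ℝ (Fin n)) :
    inner ℝ (sketchMap n d ε ω z) (sketchMap n d ε ω w) =
      ∑ k ∈ Finset.range (sketchRows n d ε), sketchVec d ε ω z k * sketchVec d ε ω w k := by
  rw [Finset.sum_range]
  simp [sketchMap, PiLp.inner_apply, mul_comm]

/-- The normalization of the sketch. -/
noncomputable def sketchScale (n d : ℕ) (ε : ℝ) : ℝ := 2 ^ halvings n d ε / 2 ^ logBlock d

/-- Minimality of the ceiling logarithm. Without any halving the bound may fail, since `reduction`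
can be tiny; this is why `le_measure_energy_close` asks its condition only for `0 < J`. -/
theorem two_pow_halvings_lt {ε : ℝ} (h : 0 < halvings n d ε) :
    2 ^ halvings n d ε < 2 * reduction n d ε := by
  have h1 : 2 ^ (halvings n d ε - 1) < ⌈reduction n d ε⌉₊ :=
    (Nat.lt_clog_iff_pow_lt (by norm_num)).mp (Nat.sub_lt h one_pos)
  rw [Nat.lt_ceil] at h1
  push_cast at h1
  calc (2 : ℝ) ^ halvings n d ε = 2 * 2 ^ (halvings n d ε - 1) := by
        rw [← pow_succ', Nat.sub_add_cancel h]
    _ < _ := by linarith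

/-- The sketch is a subspace embedding of each subspace of low dimension. -/
theorem le_measure_embedding {ε : ℝ} (hε : 0 < ε) (hε1 : ε < 1)
    (V : Submodule ℝ (EuclideanSpace ℝ (Fin n))) (hV : finrank ℝ V ≤ d + 1) :
    ENNReal.ofReal 0.8 ≤ coinMeasure {ω | ∀ z ∈ V,
      |sketchScale n d ε * ‖sketchMap n d ε ω z‖ ^ 2 - ‖z‖ ^ 2| ≤ √ε / 2 * ‖z‖ ^ 2} := by
  let e := stdOrthonormalBasis ℝ V
  have hsum : ∀ x : Fin (finrank ℝ V) → ℝ,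
      ‖∑ a, x a • (e a : EuclideanSpace ℝ (Fin n))‖ ^ 2 = ∑ a, x a ^ 2 := by
    intro x
    have h1 : ∑ a, x a • (e a : EuclideanSpace ℝ (Fin n)) =
        ((e.repr.symm (WithLp.toLp 2 x) : V) : EuclideanSpace ℝ (Fin n)) := by
      rw [← e.sum_repr_symm]; simp
    rw [h1, ← Submodule.coe_norm, LinearIsometryEquiv.norm_map, EuclideanSpace.real_norm_sq_eq]
  set lam := Nat.clog 2 (d + 1) with hlam
  set ℓ := Nat.clog 2 (paddedRows n d) with hℓ
  have hs1 : √ε ≤ 1 := Real.sqrt_le_one.mpr hε1.le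
  have hmain := le_measure_energy_close (pow_logBlock_dvd_paddedRows n d)
    (halvings_le_logBlock (n := n) hε hε1) (Nat.le_pow_clog (by norm_num) (paddedRows n d))
    (fun a => extend (e a : EuclideanSpace ℝ (Fin n))) (fun x => ?_) (lam := lam) ?_
    (δ := √ε / 2) (L := 4 * (5 + d + ℓ)) (by positivity) (by linarith) ?_ ?_
  · refine hmain.trans (measure_mono fun ω hω z hz => ?_)
    have h1 : ∑ a, e.repr ⟨z, hz⟩ a • (e a : EuclideanSpace ℝ (Fin n)) = z := by
      have := congrArg Subtype.val (e.sum_repr ⟨z, hz⟩)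
      simpa using this
    have h2 := hω (e.repr ⟨z, hz⟩)
    rw [← hsum, h1] at h2
    have h3 : energy (paddedRows n d) (logBlock d)
        (fun a => extend (e a : EuclideanSpace ℝ (Fin n))) ω (halvings n d ε) (e.repr ⟨z, hz⟩) = sketchScale n d ε * ‖sketchMap n d ε ω z‖ ^ 2 := by
      rw [← real_inner_self_eq_norm_sq, inner_sketchMap, energy, sketchScale, sketchRows]
      congr 1
      refine Finset.sum_congr rfl fun k _ => ?_
      have h4 := sketchVec_sum (d := d) ε ω Finset.univ (e.repr ⟨z, hz⟩)
        (fun a => (e a : EuclideanSpace ℝ (Fin n))) k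
      rw [h1] at h4
      rw [h4, sq]
      rfl
    rwa [h3] at h2
  · simp only [← extend_sum]
    rw [sum_extend_sq (le_paddedRows n d), hsum]
  · rw [Fintype.card_fin]
    exact hV.trans (Nat.le_pow_clog (by norm_num) _)
  · rw [Fintype.card_fin]
    have : (finrank ℝ V : ℝ) ≤ d + 1 := by exact_mod_cast hV
    push_cast
    linarith
  -- The constant is `16384 = 512 · 4 · 4 · 2`: the factors come from the embedding condition, from
  -- `L`, from `δ² = ε/4`, and from rounding up to a power of two.
  · intro hJ
    have h1 := (two_pow_halvings_lt hJ).le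
    rw [reduction, ← hlam, ← hℓ] at h1
    set D : ℝ := (4 + lam) * (5 + d + ℓ) with hD
    have hD0 : 0 < D := by positivity
    rw [← mul_div_assoc, le_div_iff₀ (by positivity)] at h1
    have h2 : (√ε / 2) ^ 2 = ε / 4 := by rw [div_pow, Real.sq_sqrt hε.le]; norm_num
    rw [h2]
    calc 512 * ((lam : ℝ) + 4) * (4 * (5 + d + ℓ)) * 2 ^ halvings n d ε =
        2 ^ halvings n d ε * (16384 * D) / 8 := by rw [hD]; ring
      _ ≤ 2 * (2 ^ logBlock d * ε) / 8 := by gcongr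
      _ = _ := by ring

theorem toEuclideanLin_eq_sum (A : Matrix (Fin n) (Fin d) ℝ) (b : EuclideanSpace ℝ (Fin n))
    (u : EuclideanSpace ℝ (Fin d)) :
    A.toEuclideanLin u = ∑ j : Fin d, u j • column A b j := by
  ext i
  simp [column, Matrix.toLpLin_apply, Matrix.mulVec, dotProduct, mul_comm]

theorem column_eq (A : Matrix (Fin n) (Fin d) ℝ) (b : EuclideanSpace ℝ (Fin n)) (j : Fin d) :
    column A b j = A.toEuclideanLin (EuclideanSpace.single j 1) := by
  rw [toEuclideanLin_eq_sum A b]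
  simp

/-- Gauss–Jordan elimination finds a solution of the sketched problem, if the sketch is injective
on the column space. -/
theorem exists_solution {A : Matrix (Fin n) (Fin d) ℝ} {b : EuclideanSpace ℝ (Fin n)} {ε : ℝ}
    {ω : ℕ → Bool} (hinj : ∀ u, sketchMap n d ε ω (A.toEuclideanLin u) = 0 → u = 0) :
    ∃ y : EuclideanSpace ℝ (Fin d), (∀ i : Fin d,
        elim d d (normalMatrix A b ε ω) i d / elim d d (normalMatrix A b ε ω) i i = y i) ∧
      ∀ u, inner ℝ (sketchMap n d ε ω (A.toEuclideanLin y - b))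
        (sketchMap n d ε ω (A.toEuclideanLin u)) = 0 := by
  set S := sketchMap n d ε ω with hS
  set R := LinearMap.range (S ∘ₗ A.toEuclideanLin) with hR
  -- A solution of the sketched problem exists as a projection; the elimination is then shown to
  -- recover this `y`.
  obtain ⟨y, hy⟩ : R.starProjection (S b) ∈ R := Submodule.starProjection_apply_mem _ _
  rw [LinearMap.comp_apply] at hy
  have horth : ∀ u, inner ℝ (S (A.toEuclideanLin y - b)) (S (A.toEuclideanLin u)) = 0 := by
    intro u
    have hu : S (A.toEuclideanLin u) ∈ R := ⟨u, rfl⟩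
    rw [map_sub, hy, ← neg_sub, inner_neg_left, Submodule.starProjection_inner_eq_zero _ _ hu,
      neg_zero]
  have hC : ∀ i < d, ∀ j, normalMatrix A b ε ω i j =
      inner ℝ (S (column A b i)) (S (column A b j)) := by
    intro i hi j
    rw [normalMatrix, if_pos hi, hS, inner_sketchMap]
  have hSA : ∀ x : ℕ → ℝ, ∑ j ∈ Finset.range d, x j • S (column A b j) =
      S (A.toEuclideanLin (WithLp.toLp 2 fun j : Fin d => x j)) := by
    intro x
    rw [toEuclideanLin_eq_sum A b, map_sum, Finset.sum_range]
    simp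
  refine ⟨y, fun i => ?_, horth⟩
  let x : ℕ → ℝ := fun j => if h : j < d then y ⟨j, h⟩ else 0
  have hx : (WithLp.toLp 2 fun j : Fin d => x j) = y := by
    ext j; simp [x]
  have hInv : GaussJordan.Inv d 0 x (normalMatrix A b ε ω) := by
    refine ⟨fun i hi => ?_, by simp, by simp, fun i hi j hj => ?_, fun v hv => ?_⟩
    · have h1 : ∑ j ∈ Finset.range d, normalMatrix A b ε ω i j * x j =
          inner ℝ (S (column A b i)) (∑ j ∈ Finset.range d, x j • S (column A b j)) := by
        rw [inner_sum]
        exact Finset.sum_congr rfl fun j _ => by rw [hC i hi, inner_smul_right, mul_comm]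
      have h2 := horth (EuclideanSpace.single ⟨i, hi⟩ 1)
      rw [← column_eq A b ⟨i, hi⟩, map_sub, real_inner_comm, inner_sub_right, sub_eq_zero] at h2
      have h3 : column A b d = b := by simp [column]
      rw [h1, hSA, hx, hC i hi, h2, h3]
    · rw [Finset.mem_Ico] at hi hj
      rw [hC i hi.2, hC j hj.2, real_inner_comm]
    · have h1 : ∑ i ∈ Finset.Ico 0 d, ∑ j ∈ Finset.Ico 0 d, v i * normalMatrix A b ε ω i j * v j =
          inner ℝ (∑ j ∈ Finset.range d, v j • S (column A b j))
            (∑ j ∈ Finset.range d, v j • S (column A b j)) := by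
        rw [sum_inner, ← Finset.range_eq_Ico]
        refine Finset.sum_congr rfl fun i hi => ?_
        rw [inner_sum]
        refine Finset.sum_congr rfl fun j _ => ?_
        rw [hC i (Finset.mem_range.mp hi), real_inner_smul_left, real_inner_smul_right]
        ring
      rw [h1, hSA, real_inner_self_pos]
      intro h0
      obtain ⟨i, hi, hvi⟩ := hv
      have h2 := hinj _ h0
      have h3 := congrArg (fun w : EuclideanSpace ℝ (Fin d) => w ⟨i, (Finset.mem_Ico.mp hi).2⟩) h2
      exact hvi (by simpa using h3)
  rw [hInv.elim_div_eq i.2]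
  simp [x]

/-- The embedding is used on the column space of `A` enlarged by `b`, of dimension at most `d + 1`.
The same event gives both accuracy claims and, with coefficient zero on `b`, the injectivity that
makes the normal matrix positive definite. -/
theorem solver_accurate {A : Matrix (Fin n) (Fin d) ℝ} (b : EuclideanSpace ℝ (Fin n)) {ε : ℝ}
    (hd : 0 < d) (hA : A.rank = d) (hε : 0 < ε) (hε1 : ε < 1) {xopt : EuclideanSpace ℝ (Fin d)}
    (hx : LeastSquares.IsMinimizer A b xopt) :
    ENNReal.ofReal 0.8 ≤ coinMeasure {ω | ∃ x t, Returns solver ω A b ε x t ∧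
      ‖A.toEuclideanLin x - b‖ ≤ (1 + ε) * LeastSquares.optValue A b ∧
      (0 < LeastSquares.colSpaceFraction A b →
        ‖xopt - x‖ ≤ √ε * (LeastSquares.condNumber A *
          √((LeastSquares.colSpaceFraction A b)⁻¹ ^ 2 - 1)) * ‖xopt‖)} := by
  have hrange := LeastSquares.finrank_range_toEuclideanLin A
  rw [hA] at hrange
  have hV : finrank ℝ (LinearMap.range A.toEuclideanLin ⊔ Submodule.span ℝ {b} :
      Submodule ℝ (EuclideanSpace ℝ (Fin n))) ≤ d + 1 := by
    refine (Submodule.finrank_add_le_finrank_add_finrank _ _).trans ?_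
    have := finrank_span_le_card (R := ℝ) ({b} : Set (EuclideanSpace ℝ (Fin n)))
    rw [hrange]
    simpa using this
  have hAinj : Function.Injective A.toEuclideanLin := by
    rw [← LinearMap.ker_eq_bot, ← Submodule.finrank_eq_zero]
    have := A.toEuclideanLin.finrank_range_add_finrank_ker
    rw [hrange, finrank_euclideanSpace_fin] at this
    omega
  have hs1 : √ε ≤ 1 := Real.sqrt_le_one.mpr hε1.le
  refine (le_measure_embedding hε hε1 _ hV).trans (measure_mono fun ω hω => ?_)
  have hclose : ∀ (u : EuclideanSpace ℝ (Fin d)) (c : ℝ), |sketchScale n d ε *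
      ‖sketchMap n d ε ω (A.toEuclideanLin u + c • b)‖ ^ 2 - ‖A.toEuclideanLin u + c • b‖ ^ 2| ≤
        √ε / 2 * ‖A.toEuclideanLin u + c • b‖ ^ 2 := fun u c =>
    hω _ (Submodule.add_mem_sup ⟨u, rfl⟩
      (Submodule.smul_mem _ _ (Submodule.mem_span_singleton_self b)))
  obtain ⟨y, hy, horth⟩ := exists_solution (A := A) (b := b) (ε := ε) (ω := ω) fun u hu => by
    have h1 := hclose u 0
    rw [zero_smul, add_zero, hu, norm_zero, zero_pow two_ne_zero, mul_zero, zero_sub, abs_neg,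
      abs_of_nonneg (by positivity)] at h1
    have h2 : ‖A.toEuclideanLin u‖ ^ 2 = 0 := by nlinarith [sq_nonneg ‖A.toEuclideanLin u‖]
    exact hAinj (by simpa using h2)
  obtain ⟨t, -, ht⟩ := (solver_spec A b hε hε1 ω).exists_returns
  refine ⟨_, t, ht, ?_⟩
  have hout : (WithLp.toLp 2 fun i : Fin d => elim d d (normalMatrix A b ε ω) i d /
      elim d d (normalMatrix A b ε ω) i i) = y := by
    ext i; exact hy i
  rw [hout]
  exact LeastSquares.sketched_solution_accurate hε hε1 hd hA _ hclose hx horth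

end RealRAM

/-! ## The running time -/

namespace RealRAM

theorem two_pow_clog_le {x : ℕ} (hx : 0 < x) : 2 ^ Nat.clog 2 x ≤ 2 * x := by
  obtain h | h := Nat.eq_zero_or_pos (Nat.clog 2 x)
  · rw [h]; omega
  · have := (Nat.lt_clog_iff_pow_lt (b := 2) (by norm_num)).mp (Nat.sub_lt h one_pos)
    have h2 : 2 ^ Nat.clog 2 x = 2 * 2 ^ (Nat.clog 2 x - 1) := by
      rw [← pow_succ', Nat.sub_add_cancel h]
    omega

/-- The constant `5` exceeds `3 / log 2`. -/
theorem cast_le_log_of_two_pow_le {d k : ℕ} (h : 2 ^ k ≤ d ^ 3) : (k : ℝ) ≤ 5 * Real.log d := by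
  have h1 : ((2 : ℝ) ^ k) ≤ (d : ℝ) ^ 3 := by exact_mod_cast h
  have h2 := Real.log_le_log (by positivity) h1
  rw [Real.log_pow, Real.log_pow] at h2
  have h3 := Real.log_two_gt_d9
  push_cast at h2
  nlinarith [Nat.cast_nonneg (α := ℝ) k]

theorem logBlock_le_log {d : ℕ} (hd : 2 ≤ d) : (logBlock d : ℝ) ≤ 5 * Real.log d := by
  refine cast_le_log_of_two_pow_le ((two_pow_clog_le (by positivity)).trans ?_)
  rw [pow_succ, sq, mul_comm]
  exact Nat.mul_le_mul_left _ hd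

theorem clog_succ_le_log {d : ℕ} (hd : 2 ≤ d) : (Nat.clog 2 (d + 1) : ℝ) ≤ 5 * Real.log d := by
  refine cast_le_log_of_two_pow_le ((two_pow_clog_le (by positivity)).trans ?_)
  nlinarith [Nat.mul_le_mul hd hd]

/-- Taking logarithms of `2 ^ clog ≤ 2K exp d` gives `log (2K) + d`. Here the restriction `n ≤ e^d`
enters: it makes the row bound after mixing `O(d)`. -/
theorem clog_le_of_le_exp {N d : ℕ} {K : ℝ} (hK : 0 < K) (h0 : 0 < N) (h : (N : ℝ) ≤ K * Real.exp d)
    (hd : 2 ≤ d) : (Nat.clog 2 N : ℝ) ≤ (2 * K + 2) * d := by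
  have h1 : ((2 : ℝ) ^ Nat.clog 2 N) ≤ 2 * N := by exact_mod_cast two_pow_clog_le h0
  have h2 := Real.log_le_log (by positivity) (h1.trans (by linarith : _ ≤ 2 * K * Real.exp d))
  rw [Real.log_pow, Real.log_mul (by positivity) (by positivity), Real.log_exp] at h2
  have h3 := Real.log_two_gt_d9
  have h4 := Real.log_le_self (by positivity : 0 ≤ 2 * K)
  have hd' : (2 : ℝ) ≤ d := by exact_mod_cast hd
  nlinarith [Nat.cast_nonneg (α := ℝ) (Nat.clog 2 N)]

/-- The power `2 ^ halvings` is at least `reduction`, and the block length in its numerator is at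
least `d²`; this bounds the dominant cost of the Gram matrix. -/
theorem sketchRows_mul_le {n d : ℕ} {ε : ℝ} (hd : 0 < d) (hε : 0 < ε) :
    (sketchRows n d ε : ℝ) * d ^ 2 * ε ≤ paddedRows n d * (16384 *
      ((4 + Nat.clog 2 (d + 1)) * (5 + d + Nat.clog 2 (paddedRows n d)))) := by
  set D : ℝ := 16384 * ((4 + Nat.clog 2 (d + 1)) * (5 + d + Nat.clog 2 (paddedRows n d))) with hD
  have hD0 : 0 < D := by positivity
  have h1 : reduction n d ε ≤ 2 ^ halvings n d ε := by
    refine (Nat.le_ceil _).trans ?_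
    exact_mod_cast Nat.le_pow_clog (by norm_num) _
  have h2 : (sketchRows n d ε : ℝ) * 2 ^ halvings n d ε ≤ paddedRows n d := by
    exact_mod_cast Nat.div_mul_le_self _ _
  have h3 : (d : ℝ) ^ 2 ≤ 2 ^ logBlock d := by
    have := Nat.le_pow_clog (b := 2) (by norm_num) (d * d)
    rw [sq]
    exact_mod_cast this
  have h4 : 2 ^ logBlock d * ε = reduction n d ε * D := by
    rw [reduction, ← hD, div_mul_cancel₀ _ hD0.ne']
  calc (sketchRows n d ε : ℝ) * d ^ 2 * ε ≤ sketchRows n d ε * 2 ^ logBlock d * ε := by gcongr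
    _ = sketchRows n d ε * reduction n d ε * D := by rw [mul_assoc, h4, mul_assoc]
    _ ≤ sketchRows n d ε * 2 ^ halvings n d ε * D := by gcongr
    _ ≤ _ := by gcongr

/-- The running time in terms of the parameters: `m` rows, `x` columns, `N` rows after padding, `r`
rows of the sketch. -/
theorem running_time_bound {m x l K K' v N r β J lam ℓ q : ℝ} (hm1 : 1 ≤ m) (hx2 : 2 ≤ x)
    (hl : 0.6 ≤ l) (hK1 : 1 ≤ K) (hv : 0 ≤ v) (hr0 : 0 ≤ r) (hβ : β ≤ 5 * l) (hlam : lam ≤ 5 * l)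
    (hJ : J ≤ β) (hN : N ≤ K * m) (hNx : N * x ≤ K * m * x) (hq : q ≤ N)
    (hℓ : ℓ ≤ (2 * K + 2) * x) (hx3 : x ^ 3 ≤ v * (m * x)) (hr : r * x ^ 2 ≤ K' * (m * x * l))
    (hβN : β * (N * x) ≤ 5 * l * (K * m * x)) (hβN1 : β * N ≤ β * (N * x)) :
    40 + 5 * x + 4 * β + 4 * lam + 3 * q + 4 * ℓ + ((m * (x * 6 + 8) + 5) +
      ((N * (x * 5 + 14) + 4) + ((β * (8 * (N * (x + 1)) + 9) + 5) +
      ((N * (x * 6 + 22) + J * 10 + 1) + ((r * (x * (x * 7 + 15) + 9) + 4) +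
      ((x * (x * (x * 7 + 20) + 9) + 4) + (x * 7 + 4))))))) ≤
      (400 + 200 * K + 31 * K' + 72 * v) * (m * x * l) := by
  have hβN' : 5 * l * (K * m * x) = 5 * (K * (m * x * l)) := by ring
  rw [hβN'] at hβN
  have hmx0 : 0 < m * x := by positivity
  have hlX : l ≤ m * x * l := le_mul_of_one_le_left (by linarith)
    (one_le_mul_of_one_le_of_one_le hm1 (by linarith))
  have hmx : m * x ≤ 2 * (m * x * l) := by nlinarith
  have hx : x ≤ m * x := le_mul_of_one_le_left (by linarith) hm1
  have hm : m ≤ m * x := le_mul_of_one_le_right (by linarith) (by linarith)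
  -- With every product dominated by a multiple of `X`, each stage becomes a linear estimate.
  generalize m * x * l = X at *
  have hKm : K * m ≤ K * (2 * X) := by gcongr; linarith
  have hKmx : K * m * x ≤ K * (2 * X) := by rw [mul_assoc]; gcongr
  have hKx : K * x ≤ K * (2 * X) := by gcongr; linarith
  have hcX : v * (m * x) ≤ v * (2 * X) := by gcongr
  have h32 : x ^ 2 ≤ x ^ 3 := pow_le_pow_right₀ (by linarith) (by norm_num)
  have h31 : x ≤ x ^ 3 := le_self_pow₀ (by linarith) (by norm_num)
  have hrx : r * x ≤ r * x ^ 2 := by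
    gcongr; exact le_self_pow₀ (by linarith) (by norm_num)
  have hr1 : r ≤ r * x ^ 2 := le_mul_of_one_le_right hr0 (one_le_pow₀ (by linarith))
  have hKX : X ≤ K * X := le_mul_of_one_le_left (by linarith) hK1
  have t1 : 40 + 5 * x + 4 * β + 4 * lam + 3 * q + 4 * ℓ ≤ 146 * X + 22 * (K * X) := by linarith
  have t2 : m * (x * 6 + 8) + 5 ≤ 38 * X := by linarith
  have t3 : N * (x * 5 + 14) + 4 ≤ 8 * X + 38 * (K * X) := by linarith
  have t4 : β * (8 * (N * (x + 1)) + 9) + 5 ≤ 55 * X + 80 * (K * X) := by linarith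
  have t5 : N * (x * 6 + 22) + J * 10 + 1 ≤ 52 * X + 56 * (K * X) := by linarith
  have t6 : r * (x * (x * 7 + 15) + 9) + 4 ≤ 8 * X + 31 * (K' * X) := by linarith
  have t7 : x * (x * (x * 7 + 20) + 9) + 4 ≤ 8 * X + 72 * (v * X) := by linarith
  have t8 : x * 7 + 4 ≤ 22 * X := by linarith
  linarith

theorem exists_solverTime_le {ε c : ℝ} (hε : 0 < ε) (hε1 : ε < 1) (hc : 0 < c) :
    ∃ C : ℝ, ∀ n d : ℕ, 2 ≤ d → c * (d : ℝ) ^ 2 ≤ n → (n : ℝ) ≤ Real.exp d →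
      (solverTime n d ε : ℝ) ≤ C * (n * d * Real.log d) := by
  -- Padding adds at most `2d² ≤ (2/c) n` rows.
  set K : ℝ := 1 + 2 / c with hK
  have hK1 : 1 ≤ K := by rw [hK]; linarith [div_pos two_pos hc]
  -- The factors `12` and `2K + 6` come from `4 + clog (d + 1) ≤ 12 log d` and `5 + d + clog N ≤ (2K
  -- + 6) d`.
  set K' : ℝ := 16384 * 12 * K * (2 * K + 6) / ε with hK'
  refine ⟨400 + 200 * K + 31 * K' + 72 * (1 / c), fun n d hd hn hnd => ?_⟩
  have hd2 : (2 : ℝ) ≤ d := by exact_mod_cast hd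
  have hd0 : (0 : ℝ) < d := by linarith
  have hn0 : (0 : ℝ) < n := lt_of_lt_of_le (by positivity) hn
  have hn1 : (1 : ℝ) ≤ n := by exact_mod_cast Nat.cast_pos.mp hn0
  have hl : 0.6 ≤ Real.log d := by
    have := Real.log_le_log two_pos hd2
    linarith [Real.log_two_gt_d9]
  have hβ := logBlock_le_log hd
  have hlam := clog_succ_le_log hd
  have hJ : (halvings n d ε : ℝ) ≤ logBlock d := by exact_mod_cast halvings_le_logBlock hε hε1
  have hN : (paddedRows n d : ℝ) ≤ K * n := by
    have h1 : (paddedRows n d : ℝ) ≤ n + 2 * (d * d) := by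
      exact_mod_cast (paddedRows_le n d).trans
        (Nat.add_le_add_left (two_pow_clog_le (by positivity)) n)
    have h2 : 2 / c * (c * (d : ℝ) ^ 2) ≤ 2 / c * n := by gcongr
    have h3 : 2 / c * (c * (d : ℝ) ^ 2) = 2 * (d * d) := by field_simp
    rw [hK, add_mul, one_mul]
    linarith
  have hN0 : 0 < paddedRows n d := lt_of_lt_of_le (Nat.cast_pos.mp hn0) (le_paddedRows n d)
  have hq : (((n + 2 ^ logBlock d - 1) / 2 ^ logBlock d : ℕ) : ℝ) ≤ paddedRows n d := by
    exact_mod_cast Nat.le_mul_of_pos_right _ (by positivity)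
  have hℓ := clog_le_of_le_exp (K := K) (by linarith) hN0 (hN.trans (by gcongr)) hd
  have hr := sketchRows_mul_le (n := n) (d := d) (by omega) hε
  have hd3 : (d : ℝ) ^ 3 ≤ 1 / c * (n * d) := by
    rw [one_div, inv_mul_eq_div, le_div_iff₀ hc]
    nlinarith
  have hp : (4 + Nat.clog 2 (d + 1) : ℝ) ≤ 12 * Real.log d := by linarith
  have hℓ' : (5 + d + Nat.clog 2 (paddedRows n d) : ℝ) ≤ (2 * K + 6) * d := by linarith
  have hr' : (sketchRows n d ε : ℝ) * d ^ 2 ≤ K' * (n * d * Real.log d) := by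
    rw [hK', div_mul_eq_mul_div, le_div_iff₀ hε]
    refine hr.trans ?_
    calc _ ≤ K * n * (16384 * ((12 * Real.log d) * ((2 * K + 6) * d))) := by gcongr
      _ = _ := by ring
  have hβN : (logBlock d : ℝ) * (paddedRows n d * d) ≤ 5 * Real.log d * (K * n * d) := by gcongr
  have hβN1 : (logBlock d : ℝ) * paddedRows n d ≤ logBlock d * (paddedRows n d * d) := by
    gcongr; exact le_mul_of_one_le_right (by positivity) (by linarith)
  have hNd : (paddedRows n d : ℝ) * d ≤ K * n * d := by gcongr
  have := running_time_bound hn1 hd2 hl hK1 (by positivity) (by positivity) hβ hlam hJ hN hNd hq hℓ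
    hd3 hr' hβN hβN1
  refine (le_of_eq ?_).trans this
  simp only [solverTime, setupTime]
  push_cast
  ring

end RealRAM

theorem theorem1 :
    ∃ P : RealRAM.Prog,
      (∀ (n d : ℕ) (A : Matrix (Fin n) (Fin d) ℝ) (b : EuclideanSpace ℝ (Fin n)) (ε : ℝ),
        0 < d → A.rank = d → 0 < ε → ε < 1 →
          (∀ ω : ℕ → Bool, ∃ x t, RealRAM.Returns P ω A b ε x t) ∧
          ∀ xopt : EuclideanSpace ℝ (Fin d), LeastSquares.IsMinNormSolution A b xopt →
            ENNReal.ofReal 0.8 ≤ RealRAM.coinMeasure {ω | ∃ x t, RealRAM.Returns P ω A b ε x t ∧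
              ‖A.toEuclideanLin x - b‖ ≤ (1 + ε) * LeastSquares.optValue A b ∧
              (0 < LeastSquares.colSpaceFraction A b →
                ‖xopt - x‖ ≤ √ε * (LeastSquares.condNumber A *
                  √((LeastSquares.colSpaceFraction A b)⁻¹ ^ 2 - 1)) * ‖xopt‖)}) ∧
      (∀ ε c : ℝ, 0 < ε → ε < 1 → 0 < c →
        ∃ C : ℝ, ∀ (n d : ℕ) (A : Matrix (Fin n) (Fin d) ℝ) (b : EuclideanSpace ℝ (Fin n)),
          2 ≤ d → A.rank = d → c * (d : ℝ) ^ 2 ≤ n → (n : ℝ) ≤ Real.exp d →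
          ∀ ω : ℕ → Bool, ∃ x t, RealRAM.Returns P ω A b ε x t ∧
            (t : ℝ) ≤ C * (n * d * Real.log d)) := by
  refine ⟨RealRAM.solver, fun n d A b ε hd hA hε hε1 => ⟨fun ω => ?_, fun xopt hx => ?_⟩,
    fun ε c hε hε1 hc => ?_⟩
  · obtain ⟨t, -, ht⟩ := (RealRAM.solver_spec A b hε hε1 ω).exists_returns
    exact ⟨_, t, ht⟩
  · exact RealRAM.solver_accurate b hd hA hε hε1 hx.1
  · obtain ⟨C, hC⟩ := RealRAM.exists_solverTime_le hε hε1 hc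
    refine ⟨C, fun n d A b hd _ hn hnd ω => ?_⟩
    obtain ⟨t, hT, ht⟩ := (RealRAM.solver_spec A b hε hε1 ω).exists_returns
    exact ⟨_, t, ht, (Nat.cast_le.mpr hT).trans (hC n d hd hn hnd)⟩
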